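/- Let $n\ge 4$ and let $\Sigma$ be a connected smooth $(n-1)$-dimensional manifold with (possibly empty) smooth boundary $\partial\Sigma$, equipped with a smooth Riemannian metric $g$, smooth functions $V,\psi:\Sigma\to\mathbb{R}$ and a smooth 2-form $B$ (all smooth up to the boundary), such that $V>0$ in the interior of $\Sigma$, while $V=0$ and $dV\neq 0$ at every point of $\partial\Sigma$. Suppose that on $\mathbb{R}\times\operatorname{int}\Sigma$ the static metric $\tilde g=-V^2dt^2+g$ and the Maxwell field $F=d\psi\wedge dt+B$ satisfy the $n$-dimensional Einstein--Maxwell equations $$\tilde R_{\mu\nu}=2\Big(F_{\mu\rho}F_\nu{}^{\rho}-\frac{1}{2(n-2)}F^2\tilde g_{\mu\nu}\Big),\qquad d\,\tilde\star F=0,\qquad dF=0 .$$ Let $C>0$ be defined by $C^2=\frac{2(n-3)}{n-2}$, and suppose that the solution is asymptotically flat with mass and charge parameters $M,Q\in\mathbb{R}$: there are $R>0$ and a diffeomorphism $x$ from an open subset of $\Sigma$ onto $\{x\in\mathbb{R}^{n-1}:|x|>R\}$ such that for every $r_0>R$ the complement in $\Sigma$ of the region $\{|x|>r_0\}$ is compact,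 and, with $r=|x|\to\infty$, $$g_{ij}=\Big(1+\frac{2M}{n-3}\frac1{r^{n-3}}\Big)\delta_{ij}+O(r^{-(n-2)}),\quad V=1-\frac{M}{r^{n-3}}+O(r^{-(n-2)}),\quad \psi=\frac{Q}{C\,r^{n-3}}+O(r^{-(n-2)}).$$ Then $M\ge |Q|$. Moreover $M=|Q|$ if and only if $B=0$ on $\Sigma$ and either $C\psi=1-V$ everywhere on $\Sigma$ or $-C\psi=1-V$ everywhere on $\Sigma$. -/

import Mathlib

open scoped Manifold ContDiff Matrix
open Asymptotics Bundle

noncomputable section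

namespace StaticEM

/-! Pseudo-Riemannian geometry and Einstein-Maxwell theory in local coordinates. -/

section Coordinates

variable {ι : Type*} [Fintype ι] [DecidableEq ι]

/-- The coordinate partial derivative `∂_μ f` at `x`. -/
def partialDeriv (μ : ι) (f : EuclideanSpace ℝ ι → ℝ) (x : EuclideanSpace ℝ ι) : ℝ :=
  fderiv ℝ f x (EuclideanSpace.single μ 1)

/-- The Christoffel symbol `Γ^ρ_{μν}` of the metric with component matrix `G`. -/
def christoffel (G : EuclideanSpace ℝ ι → Matrix ι ι ℝ) (ρ μ ν : ι)
    (x : EuclideanSpace ℝ ι) : ℝ :=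
  1 / 2 * ∑ σ, (G x)⁻¹ ρ σ *
    (partialDeriv μ (fun y => G y σ ν) x + partialDeriv ν (fun y => G y σ μ) x
      - partialDeriv σ (fun y => G y μ ν) x)

/-- The Ricci tensor
`R_{μν} = ∂_ρ Γ^ρ_{μν} - ∂_ν Γ^ρ_{ρμ} + Γ^ρ_{ρσ} Γ^σ_{μν} - Γ^ρ_{νσ} Γ^σ_{ρμ}`. -/
def ricci (G : EuclideanSpace ℝ ι → Matrix ι ι ℝ) (μ ν : ι) (x : EuclideanSpace ℝ ι) : ℝ :=
  ∑ ρ, (partialDeriv ρ (christoffel G ρ μ ν) x - partialDeriv ν (christoffel G ρ ρ μ) x)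
    + ∑ ρ, ∑ σ, (christoffel G ρ ρ σ x * christoffel G σ μ ν x
        - christoffel G ρ ν σ x * christoffel G σ ρ μ x)

/-- The components `F^{μν} = g^{μα} g^{νβ} F_{αβ}` of a 2-form with both indices raised. -/
def raised (G F : EuclideanSpace ℝ ι → Matrix ι ι ℝ) (x : EuclideanSpace ℝ ι) : Matrix ι ι ℝ :=
  (G x)⁻¹ * F x * ((G x)⁻¹)ᵀ

/-- The scalar `F² = F_{μν} F^{μν}`. -/
def normSq (G F : EuclideanSpace ℝ ι → Matrix ι ι ℝ) (x : EuclideanSpace ℝ ι) : ℝ :=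
  ∑ μ, ∑ ν, F x μ ν * raised G F x μ ν

/-- The Einstein-Maxwell equations at `x`, for a metric `G` and a 2-form `F` on a coordinate
domain of dimension `n = card ι`. -/
structure EinsteinMaxwellAt (G F : EuclideanSpace ℝ ι → Matrix ι ι ℝ)
    (x : EuclideanSpace ℝ ι) : Prop where
  /-- `R_{μν} = 2 (F_{μρ} F_ν^ρ - F² g_{μν} / (2 (n - 2)))`. -/
  einstein : ∀ μ ν, ricci G μ ν x =
    2 * (∑ ρ, ∑ σ, F x μ ρ * (G x)⁻¹ ρ σ * F x ν σ
      - 1 / (2 * ((Fintype.card ι : ℝ) - 2)) * normSq G F x * G x μ ν)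
  /-- `d⋆F = 0`, that is, `∂_μ (√|det g| F^{μν}) = 0`. -/
  maxwell : ∀ ν, ∑ μ, partialDeriv μ (fun y => √|(G y).det| * raised G F y μ ν) x = 0
  /-- `dF = 0`. -/
  closed : ∀ l μ ν, partialDeriv l (fun y => F y μ ν) x + partialDeriv μ (fun y => F y ν l) x
    + partialDeriv ν (fun y => F y l μ) x = 0

end Coordinates

/-! Static Einstein-Maxwell data on a `d`-dimensional manifold with (possibly empty) boundary;
the spacetime dimension is `n = d + 1`. -/

section Static

variable {d : ℕ} [NeZero d] {X : Type*} [TopologicalSpace X]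
  [ChartedSpace (EuclideanHalfSpace d) X]

/-- A smooth coordinate system on an open subset of `X`, with values in an open subset of `ℝ^d`
(so that its domain lies in the interior of `X`). -/
def IsSmoothChart (Φ : OpenPartialHomeomorph X (EuclideanSpace ℝ (Fin d))) : Prop :=
  ContMDiffOn (𝓡∂ d) 𝓘(ℝ, EuclideanSpace ℝ (Fin d)) ∞ Φ Φ.source ∧
    ContMDiffOn 𝓘(ℝ, EuclideanSpace ℝ (Fin d)) (𝓡∂ d) ∞ Φ.symm Φ.target

/-- The coordinate components `T_{ij}` in the chart `Φ`, as functions of the coordinates, of a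
covariant 2-tensor field `T` on `X`. -/
def components (T : ∀ p : X, TangentSpace (𝓡∂ d) p →L[ℝ] TangentSpace (𝓡∂ d) p →L[ℝ] ℝ)
    (Φ : OpenPartialHomeomorph X (EuclideanSpace ℝ (Fin d)))
    (x : EuclideanSpace ℝ (Fin d)) : Matrix (Fin d) (Fin d) ℝ :=
  Matrix.of fun i j =>
    T (Φ.symm x)
      (mfderiv 𝓘(ℝ, EuclideanSpace ℝ (Fin d)) (𝓡∂ d) Φ.symm x (EuclideanSpace.single i (1 : ℝ)))
      (mfderiv 𝓘(ℝ, EuclideanSpace ℝ (Fin d)) (𝓡∂ d) Φ.symm x (EuclideanSpace.single j (1 : ℝ)))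

/-- The spatial coordinates `x` of the spacetime point with coordinates `(t, x)`; the time index
is `Sum.inl ()`. -/
def spatial (z : EuclideanSpace ℝ (Unit ⊕ Fin d)) : EuclideanSpace ℝ (Fin d) :=
  WithLp.toLp 2 fun i => z (Sum.inr i)

/-- The components of the spacetime metric `-V² dt² + g` in the coordinates `(t, Φ)`. -/
def spacetimeMetric
    (g : ∀ p : X, TangentSpace (𝓡∂ d) p →L[ℝ] TangentSpace (𝓡∂ d) p →L[ℝ] ℝ) (V : X → ℝ)
    (Φ : OpenPartialHomeomorph X (EuclideanSpace ℝ (Fin d)))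
    (z : EuclideanSpace ℝ (Unit ⊕ Fin d)) : Matrix (Unit ⊕ Fin d) (Unit ⊕ Fin d) ℝ :=
  Matrix.fromBlocks (Matrix.of fun _ _ => -(V (Φ.symm (spatial z))) ^ 2) 0 0
    (components g Φ (spatial z))

/-- The components of the Maxwell field `F = dψ ∧ dt + B` in the coordinates `(t, Φ)`. -/
def maxwellField (ψ : X → ℝ)
    (B : ∀ p : X, TangentSpace (𝓡∂ d) p →L[ℝ] TangentSpace (𝓡∂ d) p →L[ℝ] ℝ)
    (Φ : OpenPartialHomeomorph X (EuclideanSpace ℝ (Fin d)))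
    (z : EuclideanSpace ℝ (Unit ⊕ Fin d)) : Matrix (Unit ⊕ Fin d) (Unit ⊕ Fin d) ℝ :=
  Matrix.fromBlocks 0
    (Matrix.of fun _ j => -partialDeriv j (fun y => ψ (Φ.symm y)) (spatial z))
    (Matrix.of fun i _ => partialDeriv i (fun y => ψ (Φ.symm y)) (spatial z))
    (components B Φ (spatial z))

/-- `(X, g, V, ψ, B)` is a static solution of the Einstein-Maxwell equations: the fields are
smooth up to the boundary, the lapse `V` is positive in the interior, the boundary is the zero
set of `V` and it is non-degenerate, and the metric `-V² dt² + g` with the Maxwell field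
`dψ ∧ dt + B` solves the Einstein-Maxwell equations on `ℝ × interior X`. -/
structure IsStaticSolution [IsManifold (𝓡∂ d) ∞ X]
    (g : ContMDiffRiemannianMetric (𝓡∂ d) ∞ (EuclideanSpace ℝ (Fin d))
      (fun p : X => TangentSpace (𝓡∂ d) p))
    (V ψ : X → ℝ)
    (B : ∀ p : X, TangentSpace (𝓡∂ d) p →L[ℝ] TangentSpace (𝓡∂ d) p →L[ℝ] ℝ) : Prop where
  smooth_lapse : ContMDiff (𝓡∂ d) 𝓘(ℝ, ℝ) ∞ V
  smooth_potential : ContMDiff (𝓡∂ d) 𝓘(ℝ, ℝ) ∞ ψ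
  /-- The magnetic field is antisymmetric, i.e. a 2-form. -/
  magnetic_antisymm : ∀ (p : X) (v w : TangentSpace (𝓡∂ d) p), B p v w = -B p w v
  smooth_magnetic : ContMDiff (𝓡∂ d)
    ((𝓡∂ d).prod 𝓘(ℝ, EuclideanSpace ℝ (Fin d) →L[ℝ] EuclideanSpace ℝ (Fin d) →L[ℝ] ℝ)) ∞
    (fun p : X => TotalSpace.mk'
      (EuclideanSpace ℝ (Fin d) →L[ℝ] EuclideanSpace ℝ (Fin d) →L[ℝ] ℝ)
      (E := fun p : X => TangentSpace (𝓡∂ d) p →L[ℝ] TangentSpace (𝓡∂ d) p →L[ℝ] ℝ) p (B p))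
  lapse_pos : ∀ p ∈ (𝓡∂ d).interior X, 0 < V p
  lapse_boundary : ∀ p ∈ (𝓡∂ d).boundary X, V p = 0
  nondegenerate : ∀ p ∈ (𝓡∂ d).boundary X, mfderiv (𝓡∂ d) 𝓘(ℝ, ℝ) V p ≠ 0
  field_equations : ∀ Φ : OpenPartialHomeomorph X (EuclideanSpace ℝ (Fin d)), IsSmoothChart Φ →
    ∀ z : EuclideanSpace ℝ (Unit ⊕ Fin d), spatial z ∈ Φ.target →
      EinsteinMaxwellAt (spacetimeMetric g.inner V Φ) (maxwellField ψ B Φ) z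

/-- The positive constant `C` with `C² = 2 (n - 3) / (n - 2)`, where `n = d + 1`. -/
def couplingC (d : ℕ) : ℝ := √(2 * ((d : ℝ) - 2) / ((d : ℝ) - 1))

/-- Asymptotic flatness with mass parameter `M` and charge parameter `Q`, for `d ≥ 3`: outside a
compact set, `X` is a single end with coordinates `|x| > R`, in which the fields have the stated
expansions (here `d - 2 = n - 3` and `d - 1 = n - 2`). The compactness condition says that
nothing but the points `|x| → ∞` is missing; in particular `(X, g)` is complete. -/
def IsAsymptoticallyFlat [IsManifold (𝓡∂ d) ∞ X]
    (g : ContMDiffRiemannianMetric (𝓡∂ d) ∞ (EuclideanSpace ℝ (Fin d))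
      (fun p : X => TangentSpace (𝓡∂ d) p))
    (V ψ : X → ℝ) (M Q : ℝ) : Prop :=
  ∃ (Φ : OpenPartialHomeomorph X (EuclideanSpace ℝ (Fin d))) (R : ℝ),
    0 < R ∧ IsSmoothChart Φ ∧ Φ.target = {x | R < ‖x‖} ∧
    (∀ r > R, IsCompact (Φ.source ∩ Φ ⁻¹' {x | r < ‖x‖})ᶜ) ∧
    (∀ i j, (fun x => components g.inner Φ x i j
        - (1 + 2 * M / ((d : ℝ) - 2) * (1 / ‖x‖ ^ (d - 2))) * (1 : Matrix (Fin d) (Fin d) ℝ) i j)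
      =O[Bornology.cobounded _] fun x => 1 / ‖x‖ ^ (d - 1)) ∧
    ((fun x => V (Φ.symm x) - (1 - M / ‖x‖ ^ (d - 2)))
      =O[Bornology.cobounded _] fun x => 1 / ‖x‖ ^ (d - 1)) ∧
    ((fun x => ψ (Φ.symm x) - Q / (couplingC d * ‖x‖ ^ (d - 2)))
      =O[Bornology.cobounded _] fun x => 1 / ‖x‖ ^ (d - 1))

end Static

end StaticEM

end

noncomputable section

namespace StaticEM

open Filter Topology

set_option linter.unusedSectionVars false

/-! ### Partial derivatives and divergence-form operators -/

section Calculus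

variable {ι : Type*} [Fintype ι] [DecidableEq ι]

local notation "𝔼" => EuclideanSpace ℝ ι

/-! Let d = n - 1, κ = ±C, and f = V² - (1 - κψ)² (`deficit`). Consider the weighted operator Lu =
∂_i(√det g V⁻¹ g^{ij} ∂_j u). The time component of Maxwell's equation says Lψ = 0
(`divForm_potential`). The time-time component of Einstein's equation computes L(V²) as 2√det g
V⁻¹(C²|dψ|² + V²|B|²/(d-1)) (`divForm_lapse_sq`). Since κ² = C², the electric terms cancel in Lf,
leaving Lf = 2√det g V|B|²/(d-1) ≥ 0 (`divForm_sq_sub_sq`).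

Mass bound: where V = 0, f = -(1 - κψ)² ≤ 0, and f tends to 0 at infinity. A positive maximum of f
would therefore lie in the interior, where L is elliptic, and the strong maximum principle with
connectedness would make f constant, contradicting its decay. So f ≤ 0. As r^{d-2} f tends to 2(κQ/C
- M), the two signs of κ give M ≥ |Q|.

Rigidity: if M = κQ/C then f = o(r^{2-d}). If f were negative on a whole exterior region, -f would
be a positive supersolution decaying faster than the fundamental solution, which an energy estimate
excludes (`false_of_fast_decay`); this is a Hopf lemma at infinity that needs only bounded
coefficients. Hence f attains its maximum 0 in the end, so f vanishes identically by the strong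
maximum principle. Then Lf = 0 forces B = 0, and V² = (1 - κψ)² with V > 0 in the connected interior
forces 1 - κψ = V, the sign being read off at infinity. The converse compares the 1/r^{d-2}
coefficients. -/

lemma partialDeriv_congr {f h : 𝔼 → ℝ} {x : 𝔼} (e : f =ᶠ[𝓝 x] h) (i : ι) :
    partialDeriv i f x = partialDeriv i h x := by
  rw [partialDeriv, partialDeriv, e.fderiv_eq]

@[simp] lemma partialDeriv_const (i : ι) (c : ℝ) (x : 𝔼) :
    partialDeriv i (fun _ => c) x = 0 := by
  simp [partialDeriv]

lemma partialDeriv_add {f h : 𝔼 → ℝ} {x : 𝔼} (hf : DifferentiableAt ℝ f x)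
    (hh : DifferentiableAt ℝ h x) (i : ι) :
    partialDeriv i (fun y => f y + h y) x = partialDeriv i f x + partialDeriv i h x := by
  simp only [partialDeriv]; rw [fderiv_fun_add hf hh]; rfl

lemma partialDeriv_neg {f : 𝔼 → ℝ} {x : 𝔼} (i : ι) :
    partialDeriv i (fun y => -f y) x = -partialDeriv i f x := by
  simp only [partialDeriv]; rw [fderiv_fun_neg]; rfl

lemma partialDeriv_mul {f h : 𝔼 → ℝ} {x : 𝔼} (hf : DifferentiableAt ℝ f x)
    (hh : DifferentiableAt ℝ h x) (i : ι) :
    partialDeriv i (fun y => f y * h y) x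
      = partialDeriv i f x * h x + f x * partialDeriv i h x := by
  simp only [partialDeriv]; rw [fderiv_fun_mul hf hh]; simp; ring

lemma partialDeriv_const_mul {h : 𝔼 → ℝ} {x : 𝔼} (c : ℝ)
    (hh : DifferentiableAt ℝ h x) (i : ι) :
    partialDeriv i (fun y => c * h y) x = c * partialDeriv i h x := by
  rw [partialDeriv_mul (by fun_prop) hh]; simp

lemma partialDeriv_sum {κ : Type*} (s : Finset κ) {f : κ → 𝔼 → ℝ} {x : 𝔼}
    (hf : ∀ k ∈ s, DifferentiableAt ℝ (f k) x) (i : ι) :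
    partialDeriv i (fun y => ∑ k ∈ s, f k y) x = ∑ k ∈ s, partialDeriv i (f k) x := by
  simp only [partialDeriv]; rw [fderiv_fun_sum hf]; simp

lemma partialDeriv_comp {θ : ℝ → ℝ} {f : 𝔼 → ℝ} {x : 𝔼} (hθ : DifferentiableAt ℝ θ (f x))
    (hf : DifferentiableAt ℝ f x) (i : ι) :
    partialDeriv i (fun y => θ (f y)) x = deriv θ (f x) * partialDeriv i f x := by
  have := (hθ.hasDerivAt.comp_hasFDerivAt x hf.hasFDerivAt).fderiv
  simp only [partialDeriv]
  rw [show (fun y => θ (f y)) = θ ∘ f from rfl, this]; simp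

lemma fderiv_eq_sum_partialDeriv (f : 𝔼 → ℝ) (x ξ : 𝔼) :
    fderiv ℝ f x ξ = ∑ i, ξ i * partialDeriv i f x := by
  conv_lhs => rw [← (EuclideanSpace.basisFun ι ℝ).sum_repr ξ]
  simp [partialDeriv]

lemma contDiffOn_partialDeriv {f : 𝔼 → ℝ} {s : Set 𝔼} (hs : IsOpen s)
    (hf : ContDiffOn ℝ ∞ f s) (i : ι) : ContDiffOn ℝ ∞ (partialDeriv i f) s :=
  (hf.fderiv_of_isOpen hs (by simp)).clm_apply contDiffOn_const

lemma _root_.ContDiffOn.differentiableAt_of_isOpen {f : 𝔼 → ℝ} {s : Set 𝔼} (hf : ContDiffOn ℝ ∞ f s)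
    (hs : IsOpen s) {x : 𝔼} (hx : x ∈ s) : DifferentiableAt ℝ f x :=
  (hf.contDiffAt (hs.mem_nhds hx)).differentiableAt (by simp)

/-- The vector field `a ∇u`. -/
def flux (a : 𝔼 → Matrix ι ι ℝ) (u : 𝔼 → ℝ) (i : ι) (x : 𝔼) : ℝ :=
  ∑ j, a x i j * partialDeriv j u x

/-- The divergence-form operator `∂_i (a^{ij} ∂_j u)`. -/
def divForm (a : 𝔼 → Matrix ι ι ℝ) (u : 𝔼 → ℝ) (x : 𝔼) : ℝ :=
  ∑ i, partialDeriv i (flux a u i) x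

/-- The bilinear form `a^{ij} ∂_i u ∂_j v`. -/
def carre (a : 𝔼 → Matrix ι ι ℝ) (u v : 𝔼 → ℝ) (x : 𝔼) : ℝ :=
  ∑ i, partialDeriv i u x * flux a v i x

variable {a : EuclideanSpace ℝ ι → Matrix ι ι ℝ} {u : EuclideanSpace ℝ ι → ℝ}
  {s : Set (EuclideanSpace ℝ ι)}

lemma contDiffOn_flux (hs : IsOpen s) (ha : ∀ i j, ContDiffOn ℝ ∞ (fun x => a x i j) s)
    (hu : ContDiffOn ℝ ∞ u s) (i : ι) : ContDiffOn ℝ ∞ (flux a u i) s :=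
  ContDiffOn.sum fun j _ => (ha i j).mul (contDiffOn_partialDeriv hs hu j)

lemma contDiffOn_divForm (hs : IsOpen s) (ha : ∀ i j, ContDiffOn ℝ ∞ (fun x => a x i j) s)
    (hu : ContDiffOn ℝ ∞ u s) : ContDiffOn ℝ ∞ (divForm a u) s :=
  ContDiffOn.sum fun i _ => contDiffOn_partialDeriv hs (contDiffOn_flux hs ha hu i) i

lemma contDiffOn_carre (hs : IsOpen s) (ha : ∀ i j, ContDiffOn ℝ ∞ (fun x => a x i j) s)
    {v : 𝔼 → ℝ} (hu : ContDiffOn ℝ ∞ u s) (hv : ContDiffOn ℝ ∞ v s) :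
    ContDiffOn ℝ ∞ (carre a u v) s :=
  ContDiffOn.sum fun i _ => (contDiffOn_partialDeriv hs hu i).mul (contDiffOn_flux hs ha hv i)

lemma flux_congr {v : 𝔼 → ℝ} {x : 𝔼} (e : u =ᶠ[𝓝 x] v) (i : ι) : flux a u i x = flux a v i x := by
  simp only [flux, partialDeriv_congr e]

lemma divForm_congr {v : 𝔼 → ℝ} {x : 𝔼} (e : u =ᶠ[𝓝 x] v) : divForm a u x = divForm a v x := by
  refine Finset.sum_congr rfl fun i _ => partialDeriv_congr ?_ i
  filter_upwards [e.eventually_nhds] with y hy using flux_congr hy i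

lemma flux_add {v : 𝔼 → ℝ} {x : 𝔼} (hu : DifferentiableAt ℝ u x) (hv : DifferentiableAt ℝ v x)
    (i : ι) : flux a (fun y => u y + v y) i x = flux a u i x + flux a v i x := by
  simp only [flux, partialDeriv_add hu hv, mul_add, Finset.sum_add_distrib]

lemma flux_const_mul {x : 𝔼} (c : ℝ) (hu : DifferentiableAt ℝ u x)
    (i : ι) : flux a (fun y => c * u y) i x = c * flux a u i x := by
  simp only [flux, partialDeriv_const_mul c hu, Finset.mul_sum]
  exact Finset.sum_congr rfl fun _ _ => by ring

lemma flux_comp {θ : ℝ → ℝ} {x : 𝔼} (hθ : DifferentiableAt ℝ θ (u x))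
    (hu : DifferentiableAt ℝ u x) (i : ι) :
    flux a (fun y => θ (u y)) i x = deriv θ (u x) * flux a u i x := by
  simp only [flux, partialDeriv_comp hθ hu, Finset.mul_sum]
  exact Finset.sum_congr rfl fun _ _ => by ring

lemma divForm_add (hs : IsOpen s) (ha : ∀ i j, ContDiffOn ℝ ∞ (fun x => a x i j) s)
    {v : 𝔼 → ℝ} (hu : ContDiffOn ℝ ∞ u s) (hv : ContDiffOn ℝ ∞ v s) {x : 𝔼} (hx : x ∈ s) :
    divForm a (fun y => u y + v y) x = divForm a u x + divForm a v x := by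
  simp only [divForm, ← Finset.sum_add_distrib]
  refine Finset.sum_congr rfl fun i _ => ?_
  rw [← partialDeriv_add ((contDiffOn_flux hs ha hu i).differentiableAt_of_isOpen hs hx)
    ((contDiffOn_flux hs ha hv i).differentiableAt_of_isOpen hs hx)]
  refine partialDeriv_congr ?_ i
  filter_upwards [hs.mem_nhds hx] with y hy using
    flux_add (hu.differentiableAt_of_isOpen hs hy) (hv.differentiableAt_of_isOpen hs hy) i

/-- The product rule `div (c a∇u) = ∇c · a∇u + c div (a∇u)`. -/
lemma sum_partialDeriv_mul_flux (hs : IsOpen s)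
    (ha : ∀ i j, ContDiffOn ℝ ∞ (fun x => a x i j) s) (hu : ContDiffOn ℝ ∞ u s)
    {c : 𝔼 → ℝ} {x : 𝔼} (hc : DifferentiableAt ℝ c x) (hx : x ∈ s) :
    ∑ i, partialDeriv i (fun y => c y * flux a u i y) x
      = carre a c u x + c x * divForm a u x := by
  simp only [divForm, carre, Finset.mul_sum, ← Finset.sum_add_distrib]
  exact Finset.sum_congr rfl fun i _ => partialDeriv_mul hc
    ((contDiffOn_flux hs ha hu i).differentiableAt_of_isOpen hs hx) i

lemma divForm_const_mul (hs : IsOpen s) (ha : ∀ i j, ContDiffOn ℝ ∞ (fun x => a x i j) s)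
    (hu : ContDiffOn ℝ ∞ u s) (c : ℝ) {x : 𝔼} (hx : x ∈ s) :
    divForm a (fun y => c * u y) x = c * divForm a u x := by
  have := sum_partialDeriv_mul_flux hs ha hu (c := fun _ => c) (by fun_prop) hx
  simp only [carre, partialDeriv_const, zero_mul, Finset.sum_const_zero, zero_add] at this
  rw [← this]
  refine Finset.sum_congr rfl fun i _ => partialDeriv_congr ?_ i
  filter_upwards [hs.mem_nhds hx] with y hy using
    flux_const_mul c (hu.differentiableAt_of_isOpen hs hy) i

/-- The chain rule `div (a∇θ(u)) = θ''(u) a∇u·∇u + θ'(u) div (a∇u)`. -/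
lemma divForm_comp (hs : IsOpen s) (ha : ∀ i j, ContDiffOn ℝ ∞ (fun x => a x i j) s)
    (hu : ContDiffOn ℝ ∞ u s) {θ : ℝ → ℝ} (hθ : ContDiff ℝ ∞ θ) {x : 𝔼} (hx : x ∈ s) :
    divForm a (fun y => θ (u y)) x
      = deriv (deriv θ) (u x) * carre a u u x + deriv θ (u x) * divForm a u x := by
  have hθ' : ContDiff ℝ ∞ (deriv θ) := (contDiff_infty_iff_deriv.1 hθ).2
  have hux := hu.differentiableAt_of_isOpen hs hx
  have hd : DifferentiableAt ℝ (deriv θ) (u x) := hθ'.differentiable (by simp) _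
  have := sum_partialDeriv_mul_flux hs ha hu (c := fun y => deriv θ (u y)) (hd.fun_comp' x hux) hx
  have h2 : carre a (fun y => deriv θ (u y)) u x = deriv (deriv θ) (u x) * carre a u u x := by
    simp only [carre, partialDeriv_comp hd hux, Finset.mul_sum]
    exact Finset.sum_congr rfl fun _ _ => by ring
  rw [h2] at this
  rw [← this]
  refine Finset.sum_congr rfl fun i _ => partialDeriv_congr ?_ i
  filter_upwards [hs.mem_nhds hx] with y hy using
    flux_comp (hθ.differentiable (by simp) _) (hu.differentiableAt_of_isOpen hs hy) i

lemma carre_nonneg {x : 𝔼} (ha : (a x).PosSemidef) : 0 ≤ carre a u u x := by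
  have := ha.dotProduct_mulVec_nonneg (fun i => partialDeriv i u x)
  simpa [dotProduct, Matrix.mulVec, carre, flux] using this

end Calculus

/-! ### The strong maximum principle -/

section StrongMaximum

variable {ι : Type*} [Fintype ι] [DecidableEq ι]

local notation "𝔼" => EuclideanSpace ℝ ι

variable {a : EuclideanSpace ℝ ι → Matrix ι ι ℝ} {u : EuclideanSpace ℝ ι → ℝ}
  {s : Set (EuclideanSpace ℝ ι)}

/-- If the second derivative were positive, the point would be a local minimum as well, so `f` would
be locally constant and its second derivative zero. -/
lemma deriv_deriv_nonpos_of_isLocalMax {f : ℝ → ℝ} {t : ℝ} (hf : IsLocalMax f t)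
    (hc : ContinuousAt f t) : deriv (deriv f) t ≤ 0 := by
  by_contra! h
  have hmin := isLocalMin_of_deriv_deriv_pos h hf.deriv_eq_zero hc
  have hconst : f =ᶠ[𝓝 t] fun _ => f t := by
    filter_upwards [hf, hmin] with y h1 h2 using le_antisymm h1 h2
  have : deriv f =ᶠ[𝓝 t] fun _ => 0 := by
    filter_upwards [eventually_eventually_nhds.2 hconst] with y (hy : f =ᶠ[𝓝 y] fun _ => f t)
    rw [hy.deriv_eq]; simp
  rw [this.deriv_eq] at h
  simp at h

/-- The double sum is the second derivative at 0 of t ↦ u(p + tξ), which has a local maximum there.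
-/
lemma sum_hessian_nonpos_of_isLocalMax (hs : IsOpen s) (hu : ContDiffOn ℝ ∞ u s) {p : 𝔼}
    (hp : p ∈ s) (hmax : IsLocalMax u p) (ξ : ι → ℝ) :
    ∑ i, ∑ j, ξ i * ξ j * partialDeriv i (partialDeriv j u) p ≤ 0 := by
  set v : 𝔼 := WithLp.toLp 2 ξ
  have hγ : ∀ t : ℝ, HasDerivAt (fun t : ℝ => p + t • v) v t := fun t => by
    simpa using ((hasDerivAt_id t).smul_const v).const_add p
  have hγ0 : Tendsto (fun t : ℝ => p + t • v) (𝓝 0) (𝓝 p) := by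
    have := (hγ 0).continuousAt.tendsto; simpa using this
  have hd : ∀ w : 𝔼 → ℝ, ∀ t : ℝ, DifferentiableAt ℝ w (p + t • v) →
      HasDerivAt (fun t : ℝ => w (p + t • v)) (∑ i, ξ i * partialDeriv i w (p + t • v)) t := by
    intro w t hw
    have := hw.hasFDerivAt.comp_hasDerivAt t (hγ t)
    rwa [fderiv_eq_sum_partialDeriv] at this
  have hev : ∀ᶠ t in 𝓝 (0 : ℝ), p + t • v ∈ s := hγ0 (hs.mem_nhds hp)
  have h1 : deriv (fun t : ℝ => u (p + t • v)) =ᶠ[𝓝 0]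
      fun t => ∑ j, ξ j * partialDeriv j u (p + t • v) := by
    filter_upwards [hev] with t ht using (hd u t (hu.differentiableAt_of_isOpen hs ht)).deriv
  have h2 : deriv (deriv (fun t : ℝ => u (p + t • v))) 0
      = ∑ i, ∑ j, ξ i * ξ j * partialDeriv i (partialDeriv j u) p := by
    rw [h1.deriv_eq]
    have : HasDerivAt (fun t : ℝ => ∑ j, ξ j * partialDeriv j u (p + t • v))
        (∑ j, ξ j * ∑ i, ξ i * partialDeriv i (partialDeriv j u) (p + (0 : ℝ) • v)) 0 := by
      refine HasDerivAt.fun_sum fun j _ => HasDerivAt.const_mul _ (hd _ 0 ?_)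
      simpa using (contDiffOn_partialDeriv hs hu j).differentiableAt_of_isOpen hs hp
    rw [this.deriv, Finset.sum_comm]
    simp only [zero_smul, add_zero, Finset.mul_sum]
    exact Finset.sum_congr rfl fun _ _ => Finset.sum_congr rfl fun _ _ => by ring
  rw [← h2]
  refine deriv_deriv_nonpos_of_isLocalMax ?_ ?_
  · have : ∀ᶠ t in 𝓝 (0 : ℝ), u (p + t • v) ≤ u p := hγ0 hmax
    simpa [IsLocalMax, IsMaxFilter] using this
  · have : DifferentiableAt ℝ u (p + (0 : ℝ) • v) := by
      simpa using hu.differentiableAt_of_isOpen hs hp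
    exact (hd u 0 this).continuousAt

/-- At a maximum the gradient vanishes, so derivatives of the coefficients drop out and only a^{ij}
∂_i∂_j u remains. Factoring a = bᵀb turns this into a sum of Hessian quadratic forms in the rows of
b, each nonpositive. -/
lemma divForm_nonpos_of_isLocalMax (hs : IsOpen s)
    (ha : ∀ i j, ContDiffOn ℝ ∞ (fun x => a x i j) s) (hu : ContDiffOn ℝ ∞ u s) {p : 𝔼}
    (hp : p ∈ s) (hmax : IsLocalMax u p) (hpos : (a p).PosSemidef) : divForm a u p ≤ 0 := by
  have h0 : ∀ j, partialDeriv j u p = 0 := fun j => by simp [partialDeriv, hmax.fderiv_eq_zero]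
  have hd : divForm a u p = ∑ i, ∑ j, a p i j * partialDeriv i (partialDeriv j u) p := by
    refine Finset.sum_congr rfl fun i _ => ?_
    have hda : ∀ j, DifferentiableAt ℝ (fun x => a x i j) p := fun j =>
      (ha i j).differentiableAt_of_isOpen hs hp
    have hdu : ∀ j, DifferentiableAt ℝ (partialDeriv j u) p := fun j =>
      (contDiffOn_partialDeriv hs hu j).differentiableAt_of_isOpen hs hp
    refine (partialDeriv_sum Finset.univ (f := fun j y => a y i j * partialDeriv j u y)
      (fun j _ => (hda j).mul (hdu j)) i).trans ?_
    refine Finset.sum_congr rfl fun j _ => ?_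
    rw [partialDeriv_mul (hda j) (hdu j), h0, mul_zero, zero_add]
  obtain ⟨b, hb⟩ : ∃ b : Matrix ι ι ℝ, a p = bᴴ * b := by
    open scoped MatrixOrder in
    exact CStarAlgebra.nonneg_iff_eq_star_mul_self.mp hpos.nonneg
  have : divForm a u p
      = ∑ k, ∑ i, ∑ j, b k i * b k j * partialDeriv i (partialDeriv j u) p := by
    rw [hd, hb]
    simp only [Matrix.mul_apply, Matrix.conjTranspose_apply, star_trivial, Finset.sum_mul]
    rw [Finset.sum_comm]
    conv_rhs => rw [Finset.sum_comm]
    rw [Finset.sum_comm]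
    refine Finset.sum_congr rfl fun i _ => ?_
    rw [Finset.sum_comm]
  rw [this]
  exact Finset.sum_nonpos fun k _ => sum_hessian_nonpos_of_isLocalMax hs hu hp hmax (b k)

end StrongMaximum

/-! ### Hopf's barrier and the touching-ball argument. -/

section StrongMaximum

variable {ι : Type*} [Fintype ι] [DecidableEq ι]

local notation "𝔼" => EuclideanSpace ℝ ι

variable {a : EuclideanSpace ℝ ι → Matrix ι ι ℝ} {u : EuclideanSpace ℝ ι → ℝ}
  {s : Set (EuclideanSpace ℝ ι)}

lemma partialDeriv_norm_sub_sq (y x : 𝔼) (i : ι) :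
    partialDeriv i (fun z => ‖z - y‖ ^ 2) x = 2 * (x i - y i) := by
  have := ((hasStrictFDerivAt_norm_sq (x - y)).hasFDerivAt.comp x
    ((hasFDerivAt_id x).sub_const y)).fderiv
  rw [partialDeriv, show (fun z : 𝔼 => ‖z - y‖ ^ 2) = (fun z => ‖z‖ ^ 2) ∘ fun z => id z - y from rfl,
    this]
  simp [EuclideanSpace.inner_single_right]

/-- Hopf's barrier: `exp (-α |x - y|²)` is strictly subharmonic away from `y` for large `α`. -/
lemma exists_pos_divForm_exp (hs : IsOpen s) (ha : ∀ i j, ContDiffOn ℝ ∞ (fun x => a x i j) s)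
    (hpos : ∀ x ∈ s, (a x).PosDef) {y : 𝔼} {K : Set 𝔼} (hK : IsCompact K) (hKs : K ⊆ s)
    (hy : y ∉ K) : ∃ α : ℝ, 0 < α ∧
      ∀ x ∈ K, 0 < divForm a (fun x => Real.exp (-α * ‖x - y‖ ^ 2)) x := by
  have hN : ContDiff ℝ ∞ fun x : 𝔼 => ‖x - y‖ ^ 2 := (contDiff_id.sub contDiff_const).norm_sq ℝ
  set N : 𝔼 → ℝ := fun x => ‖x - y‖ ^ 2 with hNdef
  have hq : ContinuousOn (carre a N N) K :=
    ((contDiffOn_carre hs ha hN.contDiffOn hN.contDiffOn).continuousOn).mono hKs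
  have hτ : ContinuousOn (divForm a N) K :=
    ((contDiffOn_divForm hs ha hN.contDiffOn).continuousOn).mono hKs
  have hqpos : ∀ x ∈ K, 0 < carre a N N x := by
    intro x hx
    have hne : (fun i => partialDeriv i N x) ≠ 0 := by
      intro h0
      apply hy
      have : x = y := by
        ext i
        have := congrFun h0 i
        simp only [hNdef, partialDeriv_norm_sub_sq, Pi.zero_apply] at this
        linarith
      rwa [← this]
    have := (hpos x (hKs hx)).dotProduct_mulVec_pos hne
    simpa [dotProduct, Matrix.mulVec, carre, flux] using this
  -- For N = |x - y|², the chain rule gives L e^{-αN} = α e^{-αN}(α a∇N·∇N - LN). Since a∇N·∇N > 0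
  -- on the compact set `K`, any α above the supremum of LN / (a∇N·∇N) works.
  obtain ⟨T, hT⟩ := hK.exists_bound_of_continuousOn (hτ.div hq fun x hx => (hqpos x hx).ne')
  refine ⟨|T| + 1, by positivity, fun x hx => ?_⟩
  set α := |T| + 1
  have hchain := divForm_comp hs ha hN.contDiffOn
    (θ := fun t => Real.exp (-α * t)) (by fun_prop) (hKs hx)
  have hd1 : deriv (fun t => Real.exp (-α * t)) = fun t => -α * Real.exp (-α * t) := by
    ext t
    have := ((hasDerivAt_id t).const_mul (-α)).exp.deriv
    simp only [id, mul_one] at this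
    rw [this]; ring
  have hd2 : ∀ t, deriv (fun t => -α * Real.exp (-α * t)) t = α ^ 2 * Real.exp (-α * t) := by
    intro t
    have := (((hasDerivAt_id t).const_mul (-α)).exp.const_mul (-α)).deriv
    simp only [id, mul_one] at this
    rw [this]; ring
  rw [hchain, hd1, hd2]
  have h1 := hT x hx
  have hqx := hqpos x hx
  rw [Pi.div_apply, Real.norm_eq_abs, abs_div, abs_of_pos hqx, div_le_iff₀ hqx] at h1
  have h2 : divForm a N x < α * carre a N N x := by
    calc divForm a N x ≤ |divForm a N x| := le_abs_self _
      _ ≤ T * carre a N N x := h1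
      _ < α * carre a N N x := by
        gcongr
        exact (le_abs_self T).trans_lt (lt_add_one _)
  have h3 : 0 < α := by positivity
  have h4 := Real.exp_pos (-α * N x)
  have : α ^ 2 * Real.exp (-α * N x) * carre a N N x + -α * Real.exp (-α * N x) * divForm a N x
    = α * Real.exp (-α * N x) * (α * carre a N N x - divForm a N x) := by ring
  rw [this]
  exact mul_pos (mul_pos h3 h4) (by linarith)

/-- The touching-sphere step of Hopf's maximum principle: a subsolution that is smaller than its
maximum `m` on a closed ball except for one boundary point cannot attain `m` there. -/
lemma false_of_touching_ball (hs : IsOpen s) (ha : ∀ i j, ContDiffOn ℝ ∞ (fun x => a x i j) s)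
    (hpos : ∀ x ∈ s, (a x).PosDef) (hu : ContDiffOn ℝ ∞ u s) (hL : ∀ x ∈ s, 0 ≤ divForm a u x)
    {m : ℝ} (hm : ∀ x ∈ s, u x ≤ m) {y z : 𝔼} (hyz : y ≠ z) (hz : z ∈ s) (huz : u z = m)
    (hlt : ∀ x ∈ s, ‖x - y‖ ≤ ‖z - y‖ → x ≠ z → u x < m) : False := by
  obtain ⟨δ, hδ, hδs⟩ := Metric.isOpen_iff.1 hs z hz
  have hr : 0 < ‖z - y‖ := norm_pos_iff.2 (sub_ne_zero.2 hyz.symm)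
  -- The closed ball about `z` must stay inside `s` and also miss `y`, where the gradient of the
  -- barrier vanishes.
  set t := min (δ / 2) (‖z - y‖ / 2)
  have ht : 0 < t := by positivity
  have hKs : Metric.closedBall z t ⊆ s := fun x hx => hδs <| by
    have : t ≤ δ / 2 := min_le_left _ _
    rw [Metric.mem_closedBall] at hx; rw [Metric.mem_ball]; linarith
  have hK := isCompact_closedBall z t
  have hyK : y ∉ Metric.closedBall z t := by
    have : t ≤ ‖z - y‖ / 2 := min_le_right _ _
    rw [Metric.mem_closedBall, dist_comm, dist_eq_norm]; linarith
  obtain ⟨α, hα, hv⟩ := exists_pos_divForm_exp hs ha hpos hK hKs hyK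
  set v : 𝔼 → ℝ := fun x => Real.exp (-α * ‖x - y‖ ^ 2) with hvdef
  have hvs : ContDiff ℝ ∞ v :=
    (contDiff_const.mul ((contDiff_id.sub contDiff_const).norm_sq ℝ)).exp
  -- the part of the sphere around `z` on which the barrier is not negative
  set P := Metric.sphere z t ∩ {x | ‖x - y‖ ≤ ‖z - y‖}
  have hP : IsCompact P := (isCompact_sphere z t).inter_right
    (isClosed_le (by fun_prop) continuous_const)
  have hPs : P ⊆ s := fun x hx => hKs (Metric.sphere_subset_closedBall hx.1)
  -- On the compact set `P` the subsolution stays below `m` by a definite gap `c`. With v ≤ 1 this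
  -- makes u + cv at most m there, hence less than its value at `z`.
  obtain ⟨c, hc, hcP⟩ : ∃ c > 0, ∀ x ∈ P, u x ≤ m - c := by
    rcases P.eq_empty_or_nonempty with h | h
    · exact ⟨1, one_pos, by simp [h]⟩
    · obtain ⟨x, hx, hxmax⟩ := hP.exists_isMaxOn h (hu.continuousOn.mono hPs)
      refine ⟨m - u x, ?_, fun w hw => by
        have := hxmax hw
        simp only [Set.mem_ofPred_eq] at this
        linarith⟩
      have hxz : x ≠ z := by
        rintro rfl
        have := hx.1
        simp only [Metric.mem_sphere, dist_self] at this
        exact ht.ne this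
      linarith [hlt x (hPs hx) hx.2 hxz]
  -- perturbed function
  set w : 𝔼 → ℝ := fun x => u x + c * v x
  have hws : ContDiffOn ℝ ∞ w s := hu.add (contDiffOn_const.mul hvs.contDiffOn)
  have hv1 : ∀ x, 0 < v x ∧ v x ≤ 1 := fun x => ⟨Real.exp_pos _, Real.exp_le_one_iff.2 (by
    have : 0 ≤ α * ‖x - y‖ ^ 2 := by positivity
    linarith)⟩
  obtain ⟨p, hpK, hpmax⟩ := hK.exists_isMaxOn ⟨z, Metric.mem_closedBall_self ht.le⟩
    (hws.continuousOn.mono hKs)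
  -- If the maximum of `w` is on the sphere, the centre `z` does at least as well: on `P` by the gap
  -- `c`, off `P` because the barrier is smaller farther from `y`. So there is always an interior
  -- maximum, where Lw > 0 is impossible.
  obtain ⟨q, hqB, hqmax⟩ : ∃ q ∈ Metric.ball z t, IsMaxOn w (Metric.closedBall z t) q := by
    by_cases hpb : p ∈ Metric.ball z t
    · exact ⟨p, hpb, hpmax⟩
    refine ⟨z, Metric.mem_ball_self ht, fun x hx => ?_⟩
    refine le_trans (show w x ≤ w p from hpmax hx) ?_
    have hps : p ∈ Metric.sphere z t := by
      rw [Metric.mem_closedBall] at hpK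
      rw [Metric.mem_ball, not_lt] at hpb
      exact le_antisymm hpK hpb
    change u p + c * v p ≤ u z + c * v z
    by_cases hpP : ‖p - y‖ ≤ ‖z - y‖
    · have h1 := hcP p ⟨hps, hpP⟩
      have h2 := mul_le_mul_of_nonneg_left (hv1 p).2 hc.le
      have h3 := mul_pos hc (hv1 z).1
      linarith
    · have h1 := hm p (hKs hpK)
      have h2 : v p ≤ v z := by
        simp only [hvdef]
        rw [Real.exp_le_exp]
        push Not at hpP
        have := pow_le_pow_left₀ (norm_nonneg _) hpP.le 2
        nlinarith
      have := mul_le_mul_of_nonneg_left h2 hc.le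
      linarith
  have hqs : q ∈ s := hKs (Metric.ball_subset_closedBall hqB)
  have hqloc : IsLocalMax w q := hqmax.isLocalMax
    (Filter.mem_of_superset (Metric.isOpen_ball.mem_nhds hqB) Metric.ball_subset_closedBall)
  have h1 := divForm_nonpos_of_isLocalMax hs ha hws hqs hqloc (hpos q hqs).posSemidef
  have h2 : divForm a w q = divForm a u q + c * divForm a v q := by
    rw [divForm_add hs ha hu (contDiffOn_const.mul hvs.contDiffOn) hqs,
      divForm_const_mul hs ha hvs.contDiffOn c hqs]
  have h3 := hv q (Metric.ball_subset_closedBall hqB)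
  have h4 := hL q hqs
  have := mul_pos hc h3
  linarith

/-- **Strong maximum principle**: near an interior maximum a subsolution is constant. -/
theorem eventually_eq_of_subsolution (hs : IsOpen s)
    (ha : ∀ i j, ContDiffOn ℝ ∞ (fun x => a x i j) s)
    (hpos : ∀ x ∈ s, (a x).PosDef) (hu : ContDiffOn ℝ ∞ u s) (hL : ∀ x ∈ s, 0 ≤ divForm a u x)
    {m : ℝ} (hm : ∀ x ∈ s, u x ≤ m) {x₀ : 𝔼} (hx₀ : x₀ ∈ s) (hux₀ : u x₀ = m) :
    ∀ᶠ x in 𝓝 x₀, u x = m := by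
  obtain ⟨δ, hδ, hδs⟩ := Metric.isOpen_iff.1 hs x₀ hx₀
  -- With `y` within δ/4 of `x₀`, the nearest contact point `z` is within δ/4 of `y`, so the open
  -- ball about `y` that touches at `z` lies within δ/2 of `x₀`, where `S` records every contact
  -- point.
  refine Metric.eventually_nhds_iff.2 ⟨δ / 4, by positivity, fun y hy => ?_⟩
  by_contra hne
  have hball : ∀ x, dist x x₀ ≤ δ / 2 → x ∈ s := fun x hx => hδs (by
    rw [Metric.mem_ball]; linarith)
  set S := Metric.closedBall x₀ (δ / 2) ∩ {x | u x = m}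
  have hScl : IsClosed S := by
    have : ContinuousOn u (Metric.closedBall x₀ (δ / 2)) :=
      hu.continuousOn.mono fun x hx => hball x hx
    exact this.preimage_isClosed_of_isClosed Metric.isClosed_closedBall isClosed_singleton
  have hSc : IsCompact S := (isCompact_closedBall x₀ (δ / 2)).of_isClosed_subset hScl
    Set.inter_subset_left
  have hx₀S : x₀ ∈ S := ⟨Metric.mem_closedBall_self (by positivity), hux₀⟩
  obtain ⟨z, hzS, hz⟩ := hSc.exists_infDist_eq_dist ⟨x₀, hx₀S⟩ y
  have hzmin : ∀ x ∈ S, dist y z ≤ dist y x := fun x hx => hz ▸ Metric.infDist_le_dist_of_mem hx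
  have hyz : dist y z < δ / 4 := (hzmin x₀ hx₀S).trans_lt hy
  have hyS : ∀ x ∈ s, dist y x < dist y z → u x < m := by
    intro x hx hxy
    refine lt_of_le_of_ne (hm x hx) fun h => ?_
    refine absurd (hzmin x ⟨?_, h⟩) (not_le.2 hxy)
    rw [Metric.mem_closedBall]
    have := dist_triangle x y x₀
    rw [dist_comm x y] at this
    linarith
  have hyz0 : y ≠ z := by
    rintro rfl
    exact hne hzS.2
  -- shrink the ball so that it touches only at `z`
  set y' := midpoint ℝ y z
  have hy'z : y' ≠ z := fun h => hyz0 (by simpa [y'] using h)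
  have hy'd : dist y' z = dist y z / 2 := by
    simp only [y', dist_midpoint_right, Real.norm_ofNat]; ring
  have hyy' : dist y y' = dist y z / 2 := by
    simp only [y', dist_left_midpoint, Real.norm_ofNat]; ring
  refine false_of_touching_ball hs ha hpos hu hL hm hy'z (hball z hzS.1) hzS.2
    fun x hx hxle hxz => ?_
  rw [← dist_eq_norm, ← dist_eq_norm, dist_comm z, hy'd] at hxle
  rw [dist_comm] at hxle
  refine hyS x hx ?_
  by_contra! hge
  have htri := dist_triangle y y' x
  have h1 : dist y y' = dist y z / 2 := hyy'
  have h2 : dist y' x = dist y z / 2 := by linarith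
  have h3 : dist y x = dist y z := by linarith
  -- equality in the triangle inequality
  have h4 : ‖(y' - y) + (x - y')‖ = ‖y' - y‖ + ‖x - y'‖ := by
    rw [show (y' - y) + (x - y') = x - y by abel, ← dist_eq_norm, ← dist_eq_norm, ← dist_eq_norm,
      dist_comm x y, dist_comm y' y, dist_comm x y']
    linarith
  have h5 : y' - y = x - y' := by
    have := (sameRay_iff_norm_add.2 h4).norm_smul_eq
    have e : ‖y' - y‖ = ‖x - y'‖ := by
      rw [← dist_eq_norm, ← dist_eq_norm, dist_comm y' y, dist_comm x y', h1, h2]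
    have hne0 : ‖x - y'‖ ≠ 0 := by
      rw [← dist_eq_norm, dist_comm, h2]
      have := dist_pos.2 hyz0
      positivity
    rw [e] at this
    exact (smul_right_injective _ hne0 this).symm
  apply hxz
  have h6 : z - y' = y' - y := by
    simp only [y', midpoint_eq_smul_add, invOf_eq_inv]
    module
  have : x - y' = z - y' := by rw [h6, h5]
  simpa using this

end StrongMaximum

/-! ### A supersolution on an exterior domain cannot decay too fast -/

section Cutoff

/-- A smooth antitone function that is `1` on `(-∞, 1]` and `0` on `[2, ∞)`. -/
def cutoff (t : ℝ) : ℝ := 1 - Real.smoothTransition (t - 1)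

lemma contDiff_cutoff : ContDiff ℝ ∞ cutoff :=
  contDiff_const.sub (Real.smoothTransition.contDiff.comp (contDiff_id.sub contDiff_const))

lemma cutoff_nonneg (t : ℝ) : 0 ≤ cutoff t := sub_nonneg.2 (Real.smoothTransition.le_one _)

lemma cutoff_le_one (t : ℝ) : cutoff t ≤ 1 := sub_le_self _ (Real.smoothTransition.nonneg _)

lemma cutoff_of_le_one {t : ℝ} (h : t ≤ 1) : cutoff t = 1 := by
  rw [cutoff, Real.smoothTransition.zero_of_nonpos (by linarith), sub_zero]

lemma cutoff_of_two_le {t : ℝ} (h : 2 ≤ t) : cutoff t = 0 := by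
  rw [cutoff, Real.smoothTransition.one_of_one_le (by linarith), sub_self]

lemma antitone_cutoff : Antitone cutoff := fun _ _ h =>
  sub_le_sub_left (Real.smoothTransition.monotone (sub_le_sub_right h 1)) 1

lemma deriv_cutoff_nonpos (t : ℝ) : deriv cutoff t ≤ 0 := antitone_cutoff.deriv_nonpos

lemma deriv_cutoff_of_le_one {t : ℝ} (h : t ≤ 1) : deriv cutoff t = 0 :=
  IsLocalMax.deriv_eq_zero (Filter.Eventually.of_forall fun s => by
    simpa [cutoff_of_le_one h] using cutoff_le_one s)

lemma deriv_cutoff_of_two_le {t : ℝ} (h : 2 ≤ t) : deriv cutoff t = 0 :=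
  IsLocalMin.deriv_eq_zero (Filter.Eventually.of_forall fun s => by
    simpa [cutoff_of_two_le h] using cutoff_nonneg s)

lemma contDiff_deriv_cutoff : ContDiff ℝ ∞ (deriv cutoff) :=
  (contDiff_infty_iff_deriv.1 contDiff_cutoff).2

lemma exists_deriv_cutoff_bound : ∃ D : ℝ, ∀ t, |deriv cutoff t| ≤ D := by
  obtain ⟨D, hD⟩ := isCompact_Icc.exists_bound_of_continuousOn
    (s := Set.Icc (1 : ℝ) 2) contDiff_deriv_cutoff.continuous.continuousOn
  refine ⟨D, fun t => ?_⟩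
  have h0 : 0 ≤ D := (norm_nonneg _).trans (hD 1 (by simp))
  rcases le_total t 1 with h | h
  · simpa [deriv_cutoff_of_le_one h]
  rcases le_total 2 t with h' | h'
  · simpa [deriv_cutoff_of_two_le h']
  · exact hD t ⟨h, h'⟩

/-- A decreasing profile that vanishes above `2m` and decays at scale `k` near `0`. -/
def profile (m k t : ℝ) : ℝ := cutoff (t / m) * (1 + Real.exp (-(t / k)))

variable {m k t : ℝ}

lemma contDiff_profile : ContDiff ℝ ∞ (profile m k) :=
  (contDiff_cutoff.comp (contDiff_id.div_const m)).mul
    (contDiff_const.add (contDiff_id.div_const k).neg.exp)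

lemma deriv_profile : deriv (profile m k) t
    = deriv cutoff (t / m) / m * (1 + Real.exp (-(t / k)))
      - cutoff (t / m) * (Real.exp (-(t / k)) / k) := by
  have h1 : HasDerivAt (fun t => cutoff (t / m)) (deriv cutoff (t / m) * (1 / m)) t :=
    ((contDiff_cutoff.differentiable (by simp)) (t / m)).hasDerivAt.comp (h₂ := cutoff) (h := fun t => t / m) t
      ((hasDerivAt_id t).div_const m)
  have h2 : HasDerivAt (fun t => 1 + Real.exp (-(t / k)))
      (Real.exp (-(t / k)) * (-(1 / k))) t :=
    (((hasDerivAt_id t).div_const k).neg.exp).const_add 1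
  have := (h1.mul h2).deriv
  change deriv ((fun t => cutoff (t / m)) * fun t => 1 + Real.exp (-(t / k))) t = _
  rw [this]
  ring

lemma profile_of_le (hm : 0 < m) (h : 2 * m ≤ t) : profile m k t = 0 := by
  rw [profile, cutoff_of_two_le (by rwa [le_div_iff₀ hm]), zero_mul]

/-- The constant term 1 in `profile` is what makes this lower bound independent of `k`; it therefore
survives the limit k → 0. -/
lemma deriv_cutoff_le_neg_deriv_profile (hm : 0 < m) (hk : 0 < k) :
    -(deriv cutoff (t / m) / m) ≤ -deriv (profile m k) t := by
  rw [deriv_profile]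
  have h1 : 0 ≤ cutoff (t / m) * (Real.exp (-(t / k)) / k) :=
    mul_nonneg (cutoff_nonneg _) (by positivity)
  have h2 : 0 ≤ -(deriv cutoff (t / m) / m) * Real.exp (-(t / k)) := by
    refine mul_nonneg ?_ (Real.exp_pos _).le
    rw [← neg_div]
    exact div_nonneg (neg_nonneg.2 (deriv_cutoff_nonpos _)) hm.le
  linarith

/-- On [0, k] the profile is 1 + e with e = exp(-t/k) between 1/3 and 1, and minus its derivative is
e/k. Thus (1 + e)² ≤ 4 ≤ 12e. This allows the cross term of the energy estimate to be absorbed at a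
cost proportional to `k`. -/
lemma profile_sq_le (hm : 0 < m) (hk : 0 < k) (hkm : k ≤ m) (ht : 0 ≤ t) (htk : t ≤ k) :
    profile m k t ^ 2 ≤ 12 * k * -deriv (profile m k) t := by
  have htm : t / m ≤ 1 := by rw [div_le_one hm]; linarith
  have h1 : t / k ≤ 1 := by rwa [div_le_one hk]
  have he1 : Real.exp (-(t / k)) ≤ 1 := Real.exp_le_one_iff.2 (by
    have : 0 ≤ t / k := by positivity
    linarith)
  have he2 : 1 / 3 ≤ Real.exp (-(t / k)) := by
    have h3 : Real.exp (-1) ≤ Real.exp (-(t / k)) := Real.exp_le_exp.2 (by linarith)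
    have h4 : 1 / 3 ≤ Real.exp (-1) := by
      rw [Real.exp_neg, one_div]
      exact inv_anti₀ (Real.exp_pos _) (by linarith [Real.exp_one_lt_d9])
    linarith
  rw [deriv_profile, profile, cutoff_of_le_one htm, deriv_cutoff_of_le_one htm]
  have : 12 * k * -(0 / m * (1 + Real.exp (-(t / k))) - 1 * (Real.exp (-(t / k)) / k))
      = 12 * Real.exp (-(t / k)) := by field_simp; ring
  rw [this]
  nlinarith

end Cutoff

/-! ### Estimates for the quadratic form, extension by zero, and integration by parts. -/

section Exterior

variable {ι : Type*} [Fintype ι] [DecidableEq ι]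

local notation "𝔼" => EuclideanSpace ℝ ι

variable {a : EuclideanSpace ℝ ι → Matrix ι ι ℝ} {u : EuclideanSpace ℝ ι → ℝ}
  {s : Set (EuclideanSpace ℝ ι)}

/-- Young's inequality for the form `carre`. -/
lemma carre_young {v : 𝔼 → ℝ} {x : 𝔼} (ha : (a x).PosSemidef) (p q : ℝ) :
    2 * (p * q) * carre a v u x ≤ p ^ 2 * carre a v v x + q ^ 2 * carre a u u x := by
  have h0 := ha.dotProduct_mulVec_nonneg
    (fun i => p * partialDeriv i v x - q * partialDeriv i u x)
  have hsymm : carre a u v x = carre a v u x := by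
    simp only [carre, flux, Finset.mul_sum]
    rw [Finset.sum_comm]
    refine Finset.sum_congr rfl fun i _ => Finset.sum_congr rfl fun j _ => ?_
    have : a x j i = a x i j := by simpa using (congrFun (congrFun ha.isHermitian i) j)
    rw [this]; ring
  have h1 : (star fun i => p * partialDeriv i v x - q * partialDeriv i u x) ⬝ᵥ
      (a x *ᵥ fun i => p * partialDeriv i v x - q * partialDeriv i u x)
      = p ^ 2 * carre a v v x + q ^ 2 * carre a u u x - p * q * carre a v u x
        - p * q * carre a u v x := by
    simp only [dotProduct, Matrix.mulVec, carre, flux, Finset.mul_sum, star_trivial, Pi.star_apply,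
      ← Finset.sum_add_distrib, ← Finset.sum_sub_distrib]
    exact Finset.sum_congr rfl fun _ _ => Finset.sum_congr rfl fun _ _ => by ring
  rw [h1, hsymm] at h0
  linarith

lemma carre_le_of_bound {v : 𝔼 → ℝ} {x : 𝔼} {Λ b : ℝ} (hb : 0 ≤ b) (hΛ : ∀ i j, |a x i j| ≤ Λ)
    (hv : ∀ i, |partialDeriv i v x| ≤ b) :
    carre a v v x ≤ (Fintype.card ι : ℝ) ^ 2 * (Λ * b ^ 2) := by
  have : ∀ i ∈ Finset.univ, ∀ j ∈ Finset.univ,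
      partialDeriv i v x * (a x i j * partialDeriv j v x) ≤ Λ * b ^ 2 := by
    intro i _ j _
    have hΛ0 : 0 ≤ Λ := (abs_nonneg _).trans (hΛ i j)
    refine (le_abs_self _).trans ?_
    rw [abs_mul, abs_mul]
    calc |partialDeriv i v x| * (|a x i j| * |partialDeriv j v x|) ≤ b * (Λ * b) := by
          gcongr
          exacts [hv i, hΛ i j, hv j]
      _ = Λ * b ^ 2 := by ring
  simp only [carre, flux, Finset.mul_sum]
  refine (Finset.sum_le_sum fun i hi => Finset.sum_le_sum fun j hj => this i hi j hj).trans ?_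
  simp only [Finset.sum_const, Finset.card_univ, nsmul_eq_mul]
  apply le_of_eq; ring

/-- The function that is `f` outside the ball of radius `r` and `0` inside. -/
def outside (r : ℝ) (f : 𝔼 → ℝ) (x : 𝔼) : ℝ := if r < ‖x‖ then f x else 0

lemma outside_eventuallyEq_of_lt {r : ℝ} {f : 𝔼 → ℝ} {x : 𝔼} (hx : r < ‖x‖) :
    outside r f =ᶠ[𝓝 x] f := by
  filter_upwards [(isOpen_lt continuous_const continuous_norm).mem_nhds hx] with y hy
  exact if_pos hy

lemma outside_eventuallyEq_of_le {r : ℝ} {f : 𝔼 → ℝ} {N : Set 𝔼} (hN : IsOpen N)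
    (hsN : ∀ x, ‖x‖ = r → x ∈ N) (hf : ∀ x ∈ N, f x = 0) {x : 𝔼} (hx : ‖x‖ ≤ r) :
    outside r f =ᶠ[𝓝 x] fun _ => 0 := by
  rcases hx.lt_or_eq with h | h
  · filter_upwards [(isOpen_lt continuous_norm continuous_const).mem_nhds h] with y hy
    exact if_neg (not_lt.2 (le_of_lt hy))
  · filter_upwards [hN.mem_nhds (hsN x h)] with y hy
    simp [outside, hf y hy]

/-- Since `f` vanishes near the sphere of radius `r`, extension by zero is smooth across it. Test
fields on the exterior domain thereby become globally smooth and integrate by parts without a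
boundary term. -/
lemma contDiff_outside {r R : ℝ} (hr : R < r) {f : 𝔼 → ℝ}
    (hfd : ContDiffOn ℝ ∞ f {x | R < ‖x‖}) {N : Set 𝔼} (hN : IsOpen N)
    (hsN : ∀ x, ‖x‖ = r → x ∈ N) (hf : ∀ x ∈ N, f x = 0) : ContDiff ℝ ∞ (outside r f) := by
  refine contDiff_iff_contDiffAt.2 fun x => ?_
  rcases lt_or_ge r ‖x‖ with h | h
  · refine ContDiffAt.congr_of_eventuallyEq ?_ (outside_eventuallyEq_of_lt h)
    exact hfd.contDiffAt ((isOpen_lt continuous_const continuous_norm).mem_nhds (hr.trans h))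
  · exact contDiffAt_const.congr_of_eventuallyEq (outside_eventuallyEq_of_le hN hsN hf h)

/-- The integral of a partial derivative of a compactly supported function vanishes. -/
lemma integral_partialDeriv_eq_zero {f : 𝔼 → ℝ} (hf : ContDiff ℝ ∞ f) (hc : HasCompactSupport f)
    (i : ι) : MeasureTheory.Integrable (partialDeriv i f) ∧ ∫ x, partialDeriv i f x = 0 := by
  have h1 : Continuous (partialDeriv i f) :=
    (hf.continuous_fderiv (by simp)).clm_apply continuous_const
  have h2 : HasCompactSupport (partialDeriv i f) := hc.fderiv_apply ℝ _
  have h3 := h1.integrable_of_hasCompactSupport (μ := MeasureTheory.volume) h2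
  refine ⟨h3, ?_⟩
  have := integral_mul_fderiv_eq_neg_fderiv_mul_of_integrable (𝕜 := ℝ)
    (μ := (MeasureTheory.volume : MeasureTheory.Measure 𝔼)) (f := f)
    (g := fun _ => (1 : ℝ)) (v := EuclideanSpace.single i 1) (by simpa [partialDeriv] using! h3)
    (by simp) (by simpa using hf.continuous.integrable_of_hasCompactSupport hc)
    (fun x _ => hf.differentiable (by simp) x) (fun x _ => by fun_prop)
  simpa [partialDeriv] using! this.symm

end Exterior

/-! ### The weighted energy estimate and the lower bound on decay. -/

section Exterior

variable {ι : Type*} [Fintype ι] [DecidableEq ι]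

local notation "𝔼" => EuclideanSpace ℝ ι

variable {a : EuclideanSpace ℝ ι → Matrix ι ι ℝ} {u : EuclideanSpace ℝ ι → ℝ}
  {s : Set (EuclideanSpace ℝ ι)}

/-- A smooth cutoff, equal to `1` on the ball of radius `ρ` and `0` outside that of radius `2ρ`. -/
def ballCutoff (ρ : ℝ) (x : 𝔼) : ℝ := cutoff (‖x‖ ^ 2 / ρ ^ 2)

lemma contDiff_ballCutoff (ρ : ℝ) : ContDiff ℝ ∞ (ballCutoff ρ : 𝔼 → ℝ) :=
  contDiff_cutoff.comp ((contDiff_norm_sq ℝ).div_const _)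

lemma ballCutoff_eq_one {ρ : ℝ} (hρ : 0 < ρ) {x : 𝔼} (hx : ‖x‖ ≤ ρ) : ballCutoff ρ x = 1 :=
  cutoff_of_le_one <| by
    rw [div_le_one (by positivity)]
    exact pow_le_pow_left₀ (norm_nonneg _) hx 2

lemma ballCutoff_eq_zero {ρ : ℝ} (hρ : 0 < ρ) {x : 𝔼} (hx : 2 * ρ ≤ ‖x‖) : ballCutoff ρ x = 0 :=
  cutoff_of_two_le <| by
    rw [le_div_iff₀ (by positivity)]
    have := pow_le_pow_left₀ (by positivity) hx 2
    nlinarith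

lemma hasCompactSupport_ballCutoff {ρ : ℝ} (hρ : 0 < ρ) :
    HasCompactSupport (ballCutoff ρ : 𝔼 → ℝ) :=
  HasCompactSupport.of_support_subset_isCompact (isCompact_closedBall 0 (2 * ρ)) fun x hx => by
    by_contra h
    rw [mem_closedBall_zero_iff, not_le] at h
    exact hx (ballCutoff_eq_zero hρ h.le)

lemma partialDeriv_ballCutoff (ρ : ℝ) (x : 𝔼) (i : ι) :
    partialDeriv i (ballCutoff ρ) x = deriv cutoff (‖x‖ ^ 2 / ρ ^ 2) * (2 * x i / ρ ^ 2) := by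
  have h1 : DifferentiableAt ℝ (fun y : 𝔼 => ‖y‖ ^ 2) x :=
    ((contDiff_norm_sq ℝ (n := ∞)).differentiable (by simp)) x
  have h2 : partialDeriv i (fun y : 𝔼 => ‖y‖ ^ 2 / ρ ^ 2) x = 2 * x i / ρ ^ 2 := by
    have h3 := partialDeriv_norm_sub_sq (0 : 𝔼) x i
    simp only [sub_zero, PiLp.zero_apply] at h3
    have := partialDeriv_const_mul (ρ ^ 2)⁻¹ h1 i
    rw [h3] at this
    simp only [div_eq_inv_mul]
    exact this
  rw [← h2]
  exact partialDeriv_comp (θ := cutoff) (f := fun y : 𝔼 => ‖y‖ ^ 2 / ρ ^ 2)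
    (contDiff_cutoff.differentiable (by simp) _)
    (by simpa only [div_eq_mul_inv] using h1.mul_const (ρ ^ 2)⁻¹) i

lemma partialDeriv_ballCutoff_eq_zero {ρ : ℝ} (hρ : 0 < ρ) {x : 𝔼}
    (hx : ‖x‖ ≤ ρ ∨ 2 * ρ ≤ ‖x‖) (i : ι) : partialDeriv i (ballCutoff ρ) x = 0 := by
  rw [partialDeriv_ballCutoff]
  rcases hx with h | h
  · rw [deriv_cutoff_of_le_one, zero_mul]
    rw [div_le_one (by positivity)]
    exact pow_le_pow_left₀ (norm_nonneg _) h 2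
  · rw [deriv_cutoff_of_two_le, zero_mul]
    rw [le_div_iff₀ (by positivity)]
    have := pow_le_pow_left₀ (by positivity) h 2
    nlinarith

lemma abs_partialDeriv_ballCutoff_le {D : ℝ} (hD : ∀ t, |deriv cutoff t| ≤ D) {ρ : ℝ}
    (hρ : 0 < ρ) (x : 𝔼) (i : ι) : |partialDeriv i (ballCutoff ρ) x| ≤ 4 * D / ρ := by
  have hD0 : 0 ≤ D := (abs_nonneg _).trans (hD 0)
  rcases le_total (2 * ρ) ‖x‖ with h | h
  · rw [partialDeriv_ballCutoff_eq_zero hρ (Or.inr h), abs_zero]; positivity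
  · rw [partialDeriv_ballCutoff, abs_mul]
    have h1 : |x i| ≤ ‖x‖ := by simpa using PiLp.norm_apply_le x i
    have h2 : |2 * x i / ρ ^ 2| ≤ 4 / ρ := by
      rw [abs_div, abs_mul, abs_of_pos (show (0 : ℝ) < 2 by norm_num),
        abs_of_pos (show 0 < ρ ^ 2 by positivity), div_le_div_iff₀ (by positivity) hρ]
      have : |x i| ≤ 2 * ρ := h1.trans h
      nlinarith
    calc |deriv cutoff (‖x‖ ^ 2 / ρ ^ 2)| * |2 * x i / ρ ^ 2| ≤ D * (4 / ρ) := by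
          gcongr; exact hD _
      _ = 4 * D / ρ := by ring

/-- Weighted energy inequality, pointwise form: here `-div (ζ² h(u) a∇u)` is bounded below. -/
lemma energy_pointwise {m k : ℝ} (hm : 0 < m) (hk : 0 < k) (hkm : k ≤ m) {ζ : 𝔼 → ℝ} {x : 𝔼}
    (ha : (a x).PosSemidef) (hL : divForm a u x ≤ 0) (hu : 0 < u x)
    (hζ : (∀ i, partialDeriv i ζ x = 0) ∨ u x ≤ k) :
    ζ x ^ 2 * (-(deriv cutoff (u x / m) / m) * carre a u u x)
      ≤ 2 * (-(2 * ζ x * profile m k (u x) * carre a ζ u x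
          + ζ x ^ 2 * deriv (profile m k) (u x) * carre a u u x
          + ζ x ^ 2 * profile m k (u x) * divForm a u x))
        + 48 * k * carre a ζ ζ x := by
  set c := carre a u u x
  set h := profile m k (u x)
  set h' := deriv (profile m k) (u x)
  have hc : 0 ≤ c := carre_nonneg ha
  have hh : 0 ≤ h := mul_nonneg (cutoff_nonneg _) (by positivity)
  have h1 : ζ x ^ 2 * (-(deriv cutoff (u x / m) / m) * c) ≤ ζ x ^ 2 * (-h' * c) :=
    mul_le_mul_of_nonneg_left
      (mul_le_mul_of_nonneg_right (deriv_cutoff_le_neg_deriv_profile hm hk) hc) (by positivity)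
  have h2 : ζ x ^ 2 * h * divForm a u x ≤ 0 := mul_nonpos_of_nonneg_of_nonpos (by positivity) hL
  have hζζ : 0 ≤ carre a ζ ζ x := carre_nonneg ha
  have h3 : 4 * (ζ x * h * carre a ζ u x) ≤ ζ x ^ 2 * (-h' * c) + 48 * k * carre a ζ ζ x := by
    rcases hζ with hz | huk
    · have e1 : carre a ζ u x = 0 := by simp [carre, hz]
      have e2 : 0 ≤ -(deriv cutoff (u x / m) / m) := by
        rw [← neg_div]
        exact div_nonneg (neg_nonneg.2 (deriv_cutoff_nonpos _)) hm.le
      have e3 : 0 ≤ -h' := e2.trans (deriv_cutoff_le_neg_deriv_profile hm hk)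
      rw [e1]
      have : 0 ≤ ζ x ^ 2 * (-h' * c) := by positivity
      have : 0 ≤ 48 * k * carre a ζ ζ x := by positivity
      linarith
    -- The weight 24k makes Young's inequality, after division by 12k, bound four times the cross
    -- term by 48k a∇ζ·∇ζ plus ζ²h² a∇u·∇u / (12k); the latter is controlled by `profile_sq_le`,
    -- since u ≤ k here.
    · have hY := carre_young (u := u) (v := ζ) ha (24 * k) (ζ x * h)
      have hp : h ^ 2 ≤ 12 * k * -h' := profile_sq_le hm hk hkm hu.le huk
      have e1 : (ζ x * h) ^ 2 * c ≤ 12 * k * (ζ x ^ 2 * (-h' * c)) := by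
        have := mul_le_mul_of_nonneg_left hp (show 0 ≤ ζ x ^ 2 * c by positivity)
        nlinarith
      have e2 : 12 * k * (4 * (ζ x * h * carre a ζ u x))
          ≤ 12 * k * (ζ x ^ 2 * (-h' * c) + 48 * k * carre a ζ ζ x) := by
        nlinarith
      exact le_of_mul_le_mul_left e2 (by positivity)
  nlinarith

variable {R : ℝ}

/-- The integrated energy inequality at scale `ρ`. -/
lemma energy_integral (ha : ∀ i j, ContDiffOn ℝ ∞ (fun x => a x i j) {x | R < ‖x‖})
    (hpos : ∀ x, R < ‖x‖ → (a x).PosDef)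
    {Λ : ℝ} (hΛ0 : 0 ≤ Λ) (hΛ : ∀ x, R < ‖x‖ → ∀ i j, |a x i j| ≤ Λ)
    (hu : ContDiffOn ℝ ∞ u {x | R < ‖x‖}) (hupos : ∀ x, R < ‖x‖ → 0 < u x)
    (hL : ∀ x, R < ‖x‖ → divForm a u x ≤ 0)
    {r m k ρ D : ℝ} (hr : R < r) (hm : 0 < m) (hk : 0 < k) (hkm : k ≤ m) (hρ : 0 < ρ)
    (hsphere : ∀ x, ‖x‖ = r → 2 * m < u x) (huk : ∀ x, ρ ≤ ‖x‖ → R < ‖x‖ → u x ≤ k)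
    (hD : ∀ t, |deriv cutoff t| ≤ D) {G : 𝔼 → ℝ} (hG : MeasureTheory.Integrable G)
    (hGle : ∀ x, G x ≤ ballCutoff ρ x ^ 2 *
      outside r (fun x => -(deriv cutoff (u x / m) / m) * carre a u u x) x) :
    ∫ x, G x ≤ 48 * k * ((Fintype.card ι : ℝ) ^ 2 * (Λ * (4 * D / ρ) ^ 2))
      * ((2 * ρ) ^ Fintype.card ι * MeasureTheory.volume.real (Metric.ball (0 : 𝔼) 1)) := by
  have hΩ : IsOpen {x : 𝔼 | R < ‖x‖} := isOpen_lt continuous_const continuous_norm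
  -- `N` is an open neighbourhood of the inner sphere on which u > 2m, so `profile m k (u x)`
  -- vanishes there and the test field can be cut off at the sphere.
  set N : Set 𝔼 := {x | R < ‖x‖} ∩ u ⁻¹' Set.Ioi (2 * m)
  have hN : IsOpen N := hu.continuousOn.isOpen_inter_preimage hΩ isOpen_Ioi
  have hsN : ∀ x : 𝔼, ‖x‖ = r → x ∈ N := fun x hx => ⟨by simpa [hx] using hr, hsphere x hx⟩
  set c : 𝔼 → ℝ := fun x => ballCutoff ρ x ^ 2 * profile m k (u x)
  have hprof : ContDiffOn ℝ ∞ (fun x => profile m k (u x)) {x | R < ‖x‖} :=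
    contDiff_profile.comp_contDiffOn hu
  have hc : ContDiffOn ℝ ∞ c {x | R < ‖x‖} :=
    ((contDiff_ballCutoff ρ).pow 2).contDiffOn.mul hprof
  have hcN : ∀ x ∈ N, c x = 0 := fun x hx => by
    simp only [c, profile_of_le hm hx.2.le, mul_zero]
  -- The test field ζ² h(u) a∇u, extended by zero inside the sphere: smooth, compactly supported,
  -- and so of total divergence zero.
  set J : ι → 𝔼 → ℝ := fun i => outside r (fun y => c y * flux a u i y)
  have hJ : ∀ i, ContDiff ℝ ∞ (J i) := fun i =>
    contDiff_outside hr (hc.mul (contDiffOn_flux hΩ ha hu i)) hN hsN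
      fun x hx => by rw [hcN x hx, zero_mul]
  have hJc : ∀ i, HasCompactSupport (J i) := fun i =>
    HasCompactSupport.of_support_subset_isCompact (isCompact_closedBall 0 (2 * ρ)) fun x hx => by
      by_contra h
      rw [mem_closedBall_zero_iff, not_le] at h
      apply hx
      simp only [J, outside, c, ballCutoff_eq_zero hρ h.le]
      simp
  set B : Set 𝔼 := Metric.closedBall 0 (2 * ρ)
  set C := 48 * k * ((Fintype.card ι : ℝ) ^ 2 * (Λ * (4 * D / ρ) ^ 2)) with hC
  have hD0 : 0 ≤ D := (abs_nonneg _).trans (hD 0)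
  -- The pointwise energy inequality with its error replaced by the constant `C` on the support of
  -- the cutoff. On integration the divergence disappears and only `C` times the volume of the ball
  -- remains.
  have key : ∀ x, G x ≤ -2 * ∑ i, partialDeriv i (J i) x + B.indicator (fun _ => C) x := by
    intro x
    rcases lt_or_ge r ‖x‖ with hx | hx
    · have hxR : R < ‖x‖ := hr.trans hx
      have hxs : x ∈ {x : 𝔼 | R < ‖x‖} := hxR
      have e1 : ∑ i, partialDeriv i (J i) x = carre a c u x + c x * divForm a u x := by
        rw [← sum_partialDeriv_mul_flux hΩ ha hu (hc.differentiableAt_of_isOpen hΩ hxs) hxs]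
        exact Finset.sum_congr rfl fun i _ => partialDeriv_congr (outside_eventuallyEq_of_lt hx) i
      have dζ : DifferentiableAt ℝ (ballCutoff ρ) x :=
        (contDiff_ballCutoff ρ).differentiable (by simp) x
      have du := hu.differentiableAt_of_isOpen hΩ hxs
      have e2 : ∀ i, partialDeriv i c x
          = 2 * ballCutoff ρ x * profile m k (u x) * partialDeriv i (ballCutoff ρ) x
            + ballCutoff ρ x ^ 2 * deriv (profile m k) (u x) * partialDeriv i u x := by
        intro i
        have e3 : c = fun y => (ballCutoff ρ y * ballCutoff ρ y) * profile m k (u y) := by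
          ext y; simp only [c]; ring
        rw [e3, partialDeriv_mul (dζ.fun_mul dζ) (hprof.differentiableAt_of_isOpen hΩ hxs),
          partialDeriv_mul dζ dζ, partialDeriv_comp (contDiff_profile.differentiable (by simp) _) du]
        ring
      have e3 : carre a c u x = 2 * ballCutoff ρ x * profile m k (u x) * carre a (ballCutoff ρ) u x
            + ballCutoff ρ x ^ 2 * deriv (profile m k) (u x) * carre a u u x := by
        simp only [carre, e2, Finset.mul_sum, ← Finset.sum_add_distrib]
        exact Finset.sum_congr rfl fun _ _ => by ring
      have hE := energy_pointwise (ζ := ballCutoff ρ) hm hk hkm (hpos x hxR).posSemidef (hL x hxR)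
        (hupos x hxR) ((le_total ‖x‖ ρ).imp
          (fun h => partialDeriv_ballCutoff_eq_zero hρ (Or.inl h)) fun h => huk x h hxR)
      have hG1 := hGle x
      have e4 : outside r (fun x => -(deriv cutoff (u x / m) / m) * carre a u u x) x
        = -(deriv cutoff (u x / m) / m) * carre a u u x := if_pos hx
      rw [e4] at hG1
      have e5 : 48 * k * carre a (ballCutoff ρ) (ballCutoff ρ) x ≤ B.indicator (fun _ => C) x := by
        by_cases hxB : x ∈ B
        · rw [Set.indicator_of_mem hxB, hC]
          gcongr
          exact carre_le_of_bound (by positivity) (hΛ x hxR)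
            fun i => abs_partialDeriv_ballCutoff_le hD hρ x i
        · rw [Set.indicator_of_notMem hxB]
          rw [mem_closedBall_zero_iff, not_le] at hxB
          simp [carre, partialDeriv_ballCutoff_eq_zero hρ (Or.inr hxB.le)]
      rw [e1, e3]
      simp only [c]
      linarith
    · have e1 : ∀ i, partialDeriv i (J i) x = 0 := fun i => by
        rw [partialDeriv_congr (outside_eventuallyEq_of_le hN hsN
          (fun x hx => by rw [hcN x hx, zero_mul]) hx), partialDeriv_const]
      have e2 := hGle x
      rw [outside, if_neg (not_lt.2 hx), mul_zero] at e2
      refine e2.trans ?_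
      simp only [e1, Finset.sum_const_zero, mul_zero, zero_add]
      refine Set.indicator_nonneg (fun y _ => ?_) x
      rw [hC]
      positivity
  have hint : ∀ i, MeasureTheory.Integrable (partialDeriv i (J i)) ∧
      ∫ x, partialDeriv i (J i) x = 0 := fun i => integral_partialDeriv_eq_zero (hJ i) (hJc i) i
  have hBfin : MeasureTheory.volume B ≠ ⊤ := (isCompact_closedBall _ _).measure_ne_top
  have hI1 : MeasureTheory.Integrable fun x => -2 * ∑ i, partialDeriv i (J i) x :=
    (MeasureTheory.integrable_finsetSum _ fun i _ => (hint i).1).const_mul _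
  have hI2 : MeasureTheory.Integrable (B.indicator fun _ => C) :=
    (MeasureTheory.integrable_indicator_iff Metric.isClosed_closedBall.measurableSet).2
      (MeasureTheory.integrableOn_const hBfin)
  calc ∫ x, G x ≤ ∫ x, (-2 * ∑ i, partialDeriv i (J i) x + B.indicator (fun _ => C) x) :=
        MeasureTheory.integral_mono hG (hI1.add hI2) key
    _ = C * MeasureTheory.volume.real B := by
        rw [MeasureTheory.integral_add hI1 hI2, MeasureTheory.integral_const_mul,
          MeasureTheory.integral_finsetSum _ fun i _ => (hint i).1,
          MeasureTheory.integral_indicator Metric.isClosed_closedBall.measurableSet]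
        simp only [(hint _).2, Finset.sum_const_zero, mul_zero, zero_add,
          MeasureTheory.setIntegral_const, smul_eq_mul]
        ring
    _ = _ := by
        rw [MeasureTheory.Measure.addHaar_real_closedBall _ _ (by positivity)]
        simp

set_option maxHeartbeats 400000 in
/-- A positive supersolution of a divergence-form equation with bounded coefficients on an exterior
domain of `ℝⁿ` cannot decay faster than `‖x‖ ^ (2 - n)`. -/
theorem false_of_fast_decay [Nonempty ι] (hn : 2 ≤ Fintype.card ι)
    (ha : ∀ i j, ContDiffOn ℝ ∞ (fun x => a x i j) {x | R < ‖x‖})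
    (hpos : ∀ x, R < ‖x‖ → (a x).PosDef)
    {Λ : ℝ} (hΛ0 : 0 ≤ Λ) (hΛ : ∀ x, R < ‖x‖ → ∀ i j, |a x i j| ≤ Λ)
    (hu : ContDiffOn ℝ ∞ u {x | R < ‖x‖}) (hupos : ∀ x, R < ‖x‖ → 0 < u x)
    (hL : ∀ x, R < ‖x‖ → divForm a u x ≤ 0)
    (hdecay : ∀ ε > 0, ∃ ρ : ℝ, ∀ x, ρ ≤ ‖x‖ → ‖x‖ ^ (Fintype.card ι - 2) * u x ≤ ε) :
    False := by
  have hΩ : IsOpen {x : 𝔼 | R < ‖x‖} := isOpen_lt continuous_const continuous_norm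
  set n := Fintype.card ι
  set r := |R| + 1
  have hr : R < r := (le_abs_self R).trans_lt (lt_add_one _)
  have hr0 : 0 < r := by positivity
  obtain ⟨e, he⟩ : ∃ e : 𝔼, ‖e‖ = 1 :=
    ⟨EuclideanSpace.single (Classical.arbitrary ι) 1, by simp⟩
  obtain ⟨m, hm, hsphere⟩ : ∃ m > 0, ∀ x : 𝔼, ‖x‖ = r → 2 * m < u x := by
    obtain ⟨x, hx, hmin⟩ := (isCompact_sphere (0 : 𝔼) r).exists_isMinOn
      ⟨r • e, by simp [norm_smul, he, abs_of_pos hr0]⟩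
      (hu.continuousOn.mono fun x hx => by
        rw [mem_sphere_zero_iff_norm] at hx; simpa [hx] using hr)
    rw [mem_sphere_zero_iff_norm] at hx
    have hux := hupos x (by rw [hx]; exact hr)
    -- A third of the minimum of `u` on the inner sphere leaves 2m strictly below that minimum.
    refine ⟨u x / 3, by positivity, fun y hy => ?_⟩
    have : u x ≤ u y := hmin (by simpa using hy)
    linarith
  obtain ⟨D, hD⟩ := exists_deriv_cutoff_bound
  set f : 𝔼 → ℝ := fun x => -(deriv cutoff (u x / m) / m) * carre a u u x with hf
  set N : Set 𝔼 := {x | R < ‖x‖} ∩ u ⁻¹' Set.Ioi (2 * m)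
  have hN : IsOpen N := hu.continuousOn.isOpen_inter_preimage hΩ isOpen_Ioi
  have hsN : ∀ x : 𝔼, ‖x‖ = r → x ∈ N := fun x hx => ⟨by simpa [hx] using hr, hsphere x hx⟩
  have hfN : ∀ x ∈ N, f x = 0 := fun x hx => by
    have : 2 ≤ u x / m := by rw [le_div_iff₀ hm]; exact hx.2.le
    simp [hf, deriv_cutoff_of_two_le this]
  set F : 𝔼 → ℝ := outside r f
  have hF : ContDiff ℝ ∞ F := by
    refine contDiff_outside hr ?_ hN hsN hfN
    exact ((contDiff_deriv_cutoff.comp_contDiffOn (hu.div_const m)).div_const m).neg.mul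
      (contDiffOn_carre hΩ ha hu hu)
  have hF0 : ∀ x, 0 ≤ F x := by
    intro x
    simp only [F, outside]
    split_ifs with h
    · refine mul_nonneg ?_ (carre_nonneg (hpos x (hr.trans h)).posSemidef)
      rw [← neg_div]
      exact div_nonneg (neg_nonneg.2 (deriv_cutoff_nonpos _)) hm.le
    · exact le_rfl
  -- the weight `F` vanishes identically
  have hFzero : ∀ x, F x = 0 := by
    intro x₀
    by_contra hx₀
    set ρ₀ := ‖x₀‖ + 1
    have hρ₀ : 0 < ρ₀ := by positivity
    -- The scale ρ₀ is fixed, so the positive integral of `G` is independent of the scale ρ that is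
    -- sent to infinity.
    set G : 𝔼 → ℝ := fun x => ballCutoff ρ₀ x ^ 2 * F x
    have hGc : Continuous G := ((contDiff_ballCutoff ρ₀).continuous.pow 2).mul hF.continuous
    have hGs : HasCompactSupport G :=
      ((hasCompactSupport_ballCutoff hρ₀).comp_left (g := fun t : ℝ => t ^ 2) (by simp)).mul_right
    have hGx : G x₀ ≠ 0 := by
      simp only [G, ballCutoff_eq_one hρ₀ (le_add_of_nonneg_right zero_le_one : ‖x₀‖ ≤ ρ₀)]
      simpa using hx₀
    have hGint := hGc.integrable_of_hasCompactSupport (μ := MeasureTheory.volume) hGs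
    have hGpos : 0 < ∫ x, G x := hGc.integral_pos_of_hasCompactSupport_nonneg_nonzero hGs
      (fun x => mul_nonneg (sq_nonneg _) (hF0 x)) hGx
    set v := MeasureTheory.volume.real (Metric.ball (0 : 𝔼) 1)
    set K := 48 * ((n : ℝ) ^ 2 * (Λ * (4 * D) ^ 2)) * (2 ^ n * v)
    have hv : 0 ≤ v := MeasureTheory.measureReal_nonneg
    have hK : 0 ≤ K := by positivity
    have hK1 : 0 < K + 1 := by linarith
    -- The energy estimate will give ∫ G ≤ Kε, contradicting ε(K + 1) ≤ ∫ G. The bound ε ≤ m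
    -- supplies the condition k ≤ m on the profile.
    obtain ⟨ε, hε, hεm, hεK⟩ : ∃ ε > 0, ε ≤ m ∧ ε * (K + 1) ≤ ∫ x, G x :=
      ⟨min m ((∫ x, G x) / (K + 1)), lt_min hm (div_pos hGpos hK1), min_le_left _ _, by
        rw [← le_div_iff₀ hK1]; exact min_le_right _ _⟩
    obtain ⟨ρ₁, hρ₁⟩ := hdecay ε hε
    -- Beyond ρ₁ the decay hypothesis gives u ≤ k = ε/ρ^{n-2}; 2ρ₀ ≤ ρ makes the cutoff at scale ρ
    -- equal to 1 on the support of that at scale ρ₀.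
    obtain ⟨ρ, hρρ₁, hρ1, hρρ₀⟩ : ∃ ρ, ρ₁ ≤ ρ ∧ 1 ≤ ρ ∧ 2 * ρ₀ ≤ ρ :=
      ⟨max (max ρ₁ 1) (2 * ρ₀), (le_max_left _ _).trans (le_max_left _ _),
        (le_max_right _ _).trans (le_max_left _ _), le_max_right _ _⟩
    have hρ : 0 < ρ := by linarith
    have hpow : 1 ≤ ρ ^ (n - 2) := one_le_pow₀ hρ1
    have hint := energy_integral (k := ε / ρ ^ (n - 2)) (ρ := ρ) ha hpos hΛ0 hΛ hu hupos hL hr hm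
      (by positivity) ((div_le_self hε.le hpow).trans hεm) hρ hsphere
      (fun x hx hxR => by
        have h1 := hρ₁ x (hρρ₁.trans hx)
        rw [le_div_iff₀ (by positivity), mul_comm]
        refine le_trans ?_ h1
        have := hupos x hxR
        gcongr) hD hGint (fun x => by
        change ballCutoff ρ₀ x ^ 2 * F x ≤ ballCutoff ρ x ^ 2 * F x
        refine mul_le_mul_of_nonneg_right ?_ (hF0 x)
        rcases le_total ‖x‖ ρ with h | h
        · rw [ballCutoff_eq_one hρ h]
          exact pow_le_pow_left₀ (cutoff_nonneg _) (cutoff_le_one _) 2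
        · rw [ballCutoff_eq_zero hρ₀ (hρρ₀.trans h), zero_pow two_ne_zero]
          exact sq_nonneg _)
    -- The critical scaling: k ∼ ε ρ^{2-n}, |∇ζ|² ∼ ρ^{-2} and volume ∼ ρ^n multiply to a constant
    -- times ε.
    have hsimp : 48 * (ε / ρ ^ (n - 2)) * ((n : ℝ) ^ 2 * (Λ * (4 * D / ρ) ^ 2)) * ((2 * ρ) ^ n * v)
        = K * ε := by
      have : ρ ^ n = ρ ^ (n - 2) * ρ ^ 2 := by rw [← pow_add, Nat.sub_add_cancel hn]
      simp only [K]
      rw [mul_pow, this]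
      field_simp
    rw [hsimp] at hint
    linarith
  -- hence `cutoff (u / m)` is constant along a ray
  have hray : ∀ t : ℝ, r ≤ t → ‖t • e‖ = t := fun t ht => by
    rw [norm_smul, he, mul_one, Real.norm_of_nonneg (hr0.le.trans ht)]
  have hderiv : ∀ t : ℝ, r ≤ t → HasDerivAt (fun t : ℝ => cutoff (u (t • e) / m)) 0 t := by
    intro t ht
    have hxR : R < ‖t • e‖ := by rw [hray t ht]; linarith
    have h1 : HasDerivAt (fun t : ℝ => u (t • e)) (fderiv ℝ u (t • e) e) t := by
      have := (hu.differentiableAt_of_isOpen hΩ hxR).hasFDerivAt.comp_hasDerivAt t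
        ((hasDerivAt_id t).smul_const e)
      simpa using! this
    have h2 := ((contDiff_cutoff.differentiable (by simp)) (u (t • e) / m)).hasDerivAt.comp
      (h₂ := cutoff) (h := fun t : ℝ => u (t • e) / m) t (h1.div_const m)
    have h3 : deriv cutoff (u (t • e) / m) * (fderiv ℝ u (t • e) e / m) = 0 := by
      rcases ht.lt_or_eq with hlt | heq
      · have h4 := hFzero (t • e)
        simp only [F, outside, hray t ht, if_pos hlt, hf] at h4
        rcases mul_eq_zero.1 h4 with h5 | h5
        · have : deriv cutoff (u (t • e) / m) = 0 := by
            rw [neg_eq_zero, div_eq_zero_iff] at h5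
            exact h5.resolve_right hm.ne'
          rw [this, zero_mul]
        · have h6 : (fun i => partialDeriv i u (t • e)) = 0 := by
            by_contra hne
            have := (hpos _ hxR).dotProduct_mulVec_pos hne
            refine this.ne' ?_
            simpa [dotProduct, Matrix.mulVec, carre, flux] using h5
          have h7 : fderiv ℝ u (t • e) e = 0 := by
            rw [fderiv_eq_sum_partialDeriv]
            exact Finset.sum_eq_zero fun i _ => by rw [congrFun h6 i]; simp
          rw [h7]; simp
      -- At t = r, `outside` is zero by definition and gives no information. Instead u > 2m makes
      -- the derivative of the cutoff vanish.
      · have := hsphere (t • e) (by rw [hray t ht, heq])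
        rw [deriv_cutoff_of_two_le, zero_mul]
        rw [le_div_iff₀ hm]; exact this.le
    rw [h3] at h2
    exact h2
  obtain ⟨ρ₁, hρ₁⟩ := hdecay m hm
  set t₁ := max (max ρ₁ 1) r
  have ht₁ : r ≤ t₁ := le_max_right _ _
  -- On the ray the cutoff is 0 at the inner sphere, where u > 2m, and 1 far out, where u ≤ m,
  -- although it is constant.
  have hconst := constant_of_has_deriv_right_zero (f := fun t : ℝ => cutoff (u (t • e) / m))
    (a := r) (b := t₁) (fun t ht => (hderiv t ht.1).continuousAt.continuousWithinAt)
    (fun t ht => (hderiv t ht.1).hasDerivWithinAt) t₁ ⟨ht₁, le_rfl⟩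
  have h1 : cutoff (u (r • e) / m) = 0 := cutoff_of_two_le <| by
    rw [le_div_iff₀ hm]; exact (hsphere _ (hray r le_rfl)).le
  have h2 : cutoff (u (t₁ • e) / m) = 1 := cutoff_of_le_one <| by
    rw [div_le_one hm]
    have h3 := hρ₁ (t₁ • e) (by
      rw [hray _ ht₁]; exact (le_max_left _ _).trans (le_max_left _ _))
    rw [hray _ ht₁] at h3
    have h4 : 1 ≤ t₁ ^ (n - 2) := one_le_pow₀ ((le_max_right _ _).trans (le_max_left _ _))
    have h5 := hupos (t₁ • e) (by rw [hray _ ht₁]; linarith)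
    nlinarith
  simp only [h1, h2] at hconst
  exact one_ne_zero hconst

end Exterior

/-! ### Determinants and inverses of matrix-valued functions -/

section MatrixCalculus

variable {κ : Type*} [Fintype κ] [DecidableEq κ]

lemma contDiffOn_det {E : Type*} [NormedAddCommGroup E] [NormedSpace ℝ E] {s : Set E}
    {A : E → Matrix κ κ ℝ} (hA : ∀ i j, ContDiffOn ℝ ∞ (fun x => A x i j) s) :
    ContDiffOn ℝ ∞ (fun x => (A x).det) s := by
  simp only [Matrix.det_apply']
  exact ContDiffOn.sum fun σ _ => contDiffOn_const.mul (contDiffOn_prod fun i _ => hA _ _)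

lemma contDiffOn_inv_apply {E : Type*} [NormedAddCommGroup E] [NormedSpace ℝ E] {s : Set E}
    {A : E → Matrix κ κ ℝ} (hA : ∀ i j, ContDiffOn ℝ ∞ (fun x => A x i j) s)
    (hdet : ∀ x ∈ s, (A x).det ≠ 0) (i j : κ) :
    ContDiffOn ℝ ∞ (fun x => (A x)⁻¹ i j) s := by
  have hadj : ContDiffOn ℝ ∞ (fun x => (A x).adjugate i j) s := by
    simp only [Matrix.adjugate_apply]
    refine contDiffOn_det fun k l => ?_
    simp only [Matrix.updateRow_apply]
    split_ifs
    · exact contDiffOn_const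
    · exact hA k l
  simp only [Matrix.inv_def, Matrix.smul_apply, Ring.inverse_eq_inv', smul_eq_mul]
  exact ((contDiffOn_det hA).inv hdet).mul hadj

/-- Jacobi's formula along a line. -/
lemma hasDerivAt_det_add_smul (A H : Matrix κ κ ℝ) (hA : A.det ≠ 0) :
    HasDerivAt (fun t : ℝ => (A + t • H).det) (A.det * (A⁻¹ * H).trace) 0 := by
  have h1 : ∀ t : ℝ, (A + t • H).det = A.det * (1 + t • (A⁻¹ * H)).det := fun t => by
    rw [← Matrix.det_mul, mul_add, mul_one, mul_smul_comm, ← mul_assoc,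
      Matrix.mul_nonsing_inv _ (isUnit_iff_ne_zero.2 hA), one_mul]
  simp only [h1]
  refine HasDerivAt.const_mul _ ?_
  -- The determinant is 1 + t tr(A⁻¹H) + t² p(t) for a polynomial p, so only the trace survives
  -- differentiation at 0.
  rw [funext fun t => Matrix.det_one_add_smul t (A⁻¹ * H)]
  set p := Polynomial.divX (Polynomial.divX (1 + (Polynomial.X : Polynomial ℝ) •
    (A⁻¹ * H).map Polynomial.C).det)
  have h2 := (((hasDerivAt_id (0 : ℝ)).const_mul (A⁻¹ * H).trace).const_add 1).add
    ((p.hasDerivAt 0).mul ((hasDerivAt_id (0 : ℝ)).pow 2))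
  simpa using! h2

variable {ι : Type*} [Fintype ι] [DecidableEq ι]

/-- Jacobi's formula for the derivative of a determinant. -/
lemma partialDeriv_det {A : EuclideanSpace ℝ ι → Matrix κ κ ℝ} {x : EuclideanSpace ℝ ι}
    (hA : ∀ i j, DifferentiableAt ℝ (fun y => A y i j) x) (hdet : (A x).det ≠ 0) (i : ι) :
    partialDeriv i (fun y => (A y).det) x
      = (A x).det * ∑ k, ∑ l, (A x)⁻¹ k l * partialDeriv i (fun y => A y l k) x := by
  set Dt : (κ → κ → ℝ) → ℝ := fun M => (Matrix.of M).det
  have hDt : Differentiable ℝ Dt := by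
    have : ContDiffOn ℝ ∞ Dt Set.univ := contDiffOn_det fun i j => by
      change ContDiffOn ℝ ∞ (fun M : κ → κ → ℝ => M i j) Set.univ
      fun_prop
    exact (contDiffOn_univ.1 this).differentiable (by simp)
  set H : κ → κ → ℝ := fun k l => partialDeriv i (fun y => A y k l) x
  have hline : HasDerivAt (fun t : ℝ => (fun k l => A x k l) + t • H) H 0 := by
    simpa using! ((hasDerivAt_id (0 : ℝ)).smul_const H).const_add (fun k l => A x k l)
  have hfd : fderiv ℝ Dt (fun k l => A x k l) H = (A x).det * ((A x)⁻¹ * Matrix.of H).trace := by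
    have h1 := (hDt ((fun k l => A x k l) + (0 : ℝ) • H)).hasFDerivAt.comp_hasDerivAt
      (0 : ℝ) hline
    have h2 := hasDerivAt_det_add_smul (A x) (Matrix.of H) hdet
    have := h1.unique h2
    simpa using! this
  have hAd : HasFDerivAt (fun y => (fun k l => A y k l : κ → κ → ℝ))
      (ContinuousLinearMap.pi fun k => ContinuousLinearMap.pi fun l =>
        fderiv ℝ (fun y => A y k l) x) x :=
    hasFDerivAt_pi.2 fun k => hasFDerivAt_pi.2 fun l => (hA k l).hasFDerivAt
  have h3 := ((hDt _).hasFDerivAt.comp x hAd).fderiv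
  have h4 : partialDeriv i (fun y => (A y).det) x
      = fderiv ℝ Dt (fun k l => A x k l) H := by
    rw [partialDeriv]
    change fderiv ℝ (Dt ∘ fun y => (fun k l => A y k l : κ → κ → ℝ)) x _ = _
    rw [h3]
    rfl
  rw [h4, hfd]
  simp [Matrix.trace, Matrix.mul_apply, H]

end MatrixCalculus

/-! ### Static metrics in coordinates -/

section StaticCoordinates

variable {d : ℕ}

/-- The projection `(t, x) ↦ x` as a continuous linear map. -/
def spatialCLM (d : ℕ) : EuclideanSpace ℝ (Unit ⊕ Fin d) →L[ℝ] EuclideanSpace ℝ (Fin d) :=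
  LinearMap.toContinuousLinearMap
    { toFun := spatial
      map_add' := fun _ _ => rfl
      map_smul' := fun _ _ => rfl }

lemma spatialCLM_apply (z : EuclideanSpace ℝ (Unit ⊕ Fin d)) : spatialCLM d z = spatial z := rfl

lemma continuous_spatial : Continuous (spatial : EuclideanSpace ℝ (Unit ⊕ Fin d) → _) :=
  (spatialCLM d).continuous

lemma exists_spatial_eq (x : EuclideanSpace ℝ (Fin d)) :
    ∃ z : EuclideanSpace ℝ (Unit ⊕ Fin d), spatial z = x :=
  ⟨WithLp.toLp 2 (Sum.elim 0 fun i => x i), rfl⟩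

lemma fderiv_comp_spatial {f : EuclideanSpace ℝ (Fin d) → ℝ}
    {z : EuclideanSpace ℝ (Unit ⊕ Fin d)} (hf : DifferentiableAt ℝ f (spatial z)) :
    fderiv ℝ (fun y => f (spatial y)) z = (fderiv ℝ f (spatial z)).comp (spatialCLM d) :=
  ((show HasFDerivAt f _ (spatialCLM d z) from hf.hasFDerivAt).comp z
    (spatialCLM d).hasFDerivAt).fderiv

lemma partialDeriv_inl_comp_spatial {f : EuclideanSpace ℝ (Fin d) → ℝ}
    {z : EuclideanSpace ℝ (Unit ⊕ Fin d)} (hf : DifferentiableAt ℝ f (spatial z)) (t : Unit) :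
    partialDeriv (Sum.inl t) (fun y => f (spatial y)) z = 0 := by
  have : spatialCLM d (EuclideanSpace.single (Sum.inl t) 1) = 0 := by
    ext j; simp [spatialCLM_apply, spatial]
  rw [partialDeriv, fderiv_comp_spatial hf, ContinuousLinearMap.comp_apply, this, map_zero]

lemma partialDeriv_inr_comp_spatial {f : EuclideanSpace ℝ (Fin d) → ℝ}
    {z : EuclideanSpace ℝ (Unit ⊕ Fin d)} (hf : DifferentiableAt ℝ f (spatial z)) (i : Fin d) :
    partialDeriv (Sum.inr i) (fun y => f (spatial y)) z = partialDeriv i f (spatial z) := by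
  have : spatialCLM d (EuclideanSpace.single (Sum.inr i) 1) = EuclideanSpace.single i 1 := by
    ext j; simp [spatialCLM_apply, spatial]
  rw [partialDeriv, fderiv_comp_spatial hf, ContinuousLinearMap.comp_apply, this, partialDeriv]

/-- The block matrix `-v² dt² + G`. -/
def blockMetric (v : EuclideanSpace ℝ (Fin d) → ℝ)
    (G : EuclideanSpace ℝ (Fin d) → Matrix (Fin d) (Fin d) ℝ)
    (z : EuclideanSpace ℝ (Unit ⊕ Fin d)) : Matrix (Unit ⊕ Fin d) (Unit ⊕ Fin d) ℝ :=
  Matrix.fromBlocks (Matrix.of fun _ _ => -(v (spatial z)) ^ 2) 0 0 (G (spatial z))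

/-- The components of the 2-form `ds ∧ dt + b`. -/
def blockField (s : EuclideanSpace ℝ (Fin d) → ℝ)
    (b : EuclideanSpace ℝ (Fin d) → Matrix (Fin d) (Fin d) ℝ)
    (z : EuclideanSpace ℝ (Unit ⊕ Fin d)) : Matrix (Unit ⊕ Fin d) (Unit ⊕ Fin d) ℝ :=
  Matrix.fromBlocks 0
    (Matrix.of fun _ j => -partialDeriv j s (spatial z))
    (Matrix.of fun i _ => partialDeriv i s (spatial z))
    (b (spatial z))

/-- The coefficients `√det G / v · G⁻¹`. -/
def staticCoeff (G : EuclideanSpace ℝ (Fin d) → Matrix (Fin d) (Fin d) ℝ)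
    (v : EuclideanSpace ℝ (Fin d) → ℝ) (x : EuclideanSpace ℝ (Fin d)) :
    Matrix (Fin d) (Fin d) ℝ :=
  (√(G x).det / v x) • (G x)⁻¹

variable {s v : EuclideanSpace ℝ (Fin d) → ℝ}
  {G b : EuclideanSpace ℝ (Fin d) → Matrix (Fin d) (Fin d) ℝ}
  {Ω : Set (EuclideanSpace ℝ (Fin d))}

lemma blockMetric_inv {z : EuclideanSpace ℝ (Unit ⊕ Fin d)} (hv : v (spatial z) ≠ 0)
    (hG : (G (spatial z)).det ≠ 0) :
    (blockMetric v G z)⁻¹ = Matrix.fromBlocks (Matrix.of fun _ _ => -(v (spatial z) ^ 2)⁻¹) 0 0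
      (G (spatial z))⁻¹ := by
  refine Matrix.inv_eq_right_inv ?_
  rw [blockMetric, Matrix.fromBlocks_multiply]
  simp only [Matrix.mul_zero, Matrix.zero_mul, add_zero, zero_add,
    Matrix.mul_nonsing_inv _ (isUnit_iff_ne_zero.2 hG)]
  rw [← Matrix.fromBlocks_one]
  congr 1
  ext i j
  simp [Matrix.mul_apply, hv]

lemma abs_det_blockMetric {z : EuclideanSpace ℝ (Unit ⊕ Fin d)} (hv : 0 < v (spatial z)) 
    (hG : 0 < (G (spatial z)).det) :
    √|(blockMetric v G z).det| = v (spatial z) * √(G (spatial z)).det := by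
  have : (blockMetric v G z).det = -(v (spatial z) ^ 2 * (G (spatial z)).det) := by
    rw [blockMetric, Matrix.det_fromBlocks_zero₂₁, Matrix.det_unique]
    simp
  rw [this, abs_neg, abs_of_pos (by positivity), Real.sqrt_mul (sq_nonneg _),
    Real.sqrt_sq hv.le]

lemma contDiffOn_staticCoeff (hG : ∀ i j, ContDiffOn ℝ ∞ (fun x => G x i j) Ω)
    (hpos : ∀ x ∈ Ω, (G x).PosDef) (hv : ContDiffOn ℝ ∞ v Ω) (hv0 : ∀ x ∈ Ω, 0 < v x)
    (i j : Fin d) : ContDiffOn ℝ ∞ (fun x => staticCoeff G v x i j) Ω := by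
  have hdet : ∀ x ∈ Ω, (G x).det ≠ 0 := fun x hx => (hpos x hx).det_pos.ne'
  simp only [staticCoeff, Matrix.smul_apply, smul_eq_mul]
  exact (((contDiffOn_det hG).sqrt hdet).div hv fun x hx => (hv0 x hx).ne').mul
    (contDiffOn_inv_apply hG hdet i j)

lemma posDef_staticCoeff {x : EuclideanSpace ℝ (Fin d)} (hpos : (G x).PosDef) (hv : 0 < v x) :
    (staticCoeff G v x).PosDef :=
  hpos.inv.smul (div_pos (Real.sqrt_pos.2 hpos.det_pos) hv)

lemma raised_inr_inl {z : EuclideanSpace ℝ (Unit ⊕ Fin d)} (hv : v (spatial z) ≠ 0)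
    (hG : (G (spatial z)).det ≠ 0) (i : Fin d) :
    raised (blockMetric v G) (blockField s b) z (Sum.inr i) (Sum.inl ())
      = -(v (spatial z) ^ 2)⁻¹ * ∑ j, (G (spatial z))⁻¹ i j * partialDeriv j s (spatial z) := by
  rw [raised, blockMetric_inv hv hG, blockField]
  simp [Matrix.fromBlocks_multiply, Matrix.fromBlocks_transpose, Matrix.mul_apply, mul_comm]

lemma raised_inl_inl {z : EuclideanSpace ℝ (Unit ⊕ Fin d)} (hv : v (spatial z) ≠ 0)
    (hG : (G (spatial z)).det ≠ 0) :
    raised (blockMetric v G) (blockField s b) z (Sum.inl ()) (Sum.inl ()) = 0 := by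
  rw [raised, blockMetric_inv hv hG, blockField]
  simp [Matrix.fromBlocks_multiply, Matrix.fromBlocks_transpose, Matrix.mul_apply]

lemma raised_inl_inr {z : EuclideanSpace ℝ (Unit ⊕ Fin d)} (hv : v (spatial z) ≠ 0)
    (hG : (G (spatial z)).det ≠ 0) (i : Fin d) :
    raised (blockMetric v G) (blockField s b) z (Sum.inl ()) (Sum.inr i)
      = (v (spatial z) ^ 2)⁻¹ * ∑ j, (G (spatial z))⁻¹ i j * partialDeriv j s (spatial z) := by
  rw [raised, blockMetric_inv hv hG, blockField]
  simp only [Matrix.fromBlocks_multiply, Matrix.fromBlocks_transpose, Matrix.fromBlocks_apply₁₂]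
  simp [Matrix.mul_apply, Finset.mul_sum]
  exact Finset.sum_congr rfl fun _ _ => by ring

lemma raised_inr_inr {z : EuclideanSpace ℝ (Unit ⊕ Fin d)} (hv : v (spatial z) ≠ 0)
    (hG : (G (spatial z)).det ≠ 0) (i j : Fin d) :
    raised (blockMetric v G) (blockField s b) z (Sum.inr i) (Sum.inr j)
      = raised G b (spatial z) i j := by
  rw [raised, blockMetric_inv hv hG, blockField, raised]
  simp [Matrix.fromBlocks_multiply, Matrix.fromBlocks_transpose]

/-- The time component of Maxwell's equation is `div (√det G / v · ∇s) = 0`. -/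
lemma divForm_potential (hΩ : IsOpen Ω) (hG : ∀ i j, ContDiffOn ℝ ∞ (fun x => G x i j) Ω)
    (hpos : ∀ x ∈ Ω, (G x).PosDef) (hv : ContDiffOn ℝ ∞ v Ω) (hv0 : ∀ x ∈ Ω, 0 < v x)
    (hs : ContDiffOn ℝ ∞ s Ω) {z : EuclideanSpace ℝ (Unit ⊕ Fin d)} (hz : spatial z ∈ Ω)
    (hEM : EinsteinMaxwellAt (blockMetric v G) (blockField s b) z) :
    divForm (staticCoeff G v) s (spatial z) = 0 := by
  have hmax := hEM.maxwell (Sum.inl ())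
  rw [Fintype.sum_sum_type] at hmax
  have hev : ∀ᶠ y in 𝓝 z, spatial y ∈ Ω := continuous_spatial.continuousAt (hΩ.mem_nhds hz)
  have h0 : partialDeriv (Sum.inl ()) (fun y => √|(blockMetric v G y).det| *
      raised (blockMetric v G) (blockField s b) y (Sum.inl ()) (Sum.inl ())) z = 0 := by
    rw [partialDeriv_congr (h := fun _ => 0) _ _, partialDeriv_const]
    filter_upwards [hev] with y hy
    rw [raised_inl_inl (hv0 _ hy).ne' (hpos _ hy).det_pos.ne', mul_zero]
  -- The spacetime density is V√det G and F^{it} carries -V⁻², which produces the weight 1/V in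
  -- `staticCoeff`.
  have h1 : ∀ i : Fin d, partialDeriv (Sum.inr i) (fun y => √|(blockMetric v G y).det| *
      raised (blockMetric v G) (blockField s b) y (Sum.inr i) (Sum.inl ())) z
      = -partialDeriv i (flux (staticCoeff G v) s i) (spatial z) := by
    intro i
    rw [← partialDeriv_inr_comp_spatial ((contDiffOn_flux hΩ
      (contDiffOn_staticCoeff hG hpos hv hv0) hs i).differentiableAt_of_isOpen hΩ hz),
      ← partialDeriv_neg]
    refine partialDeriv_congr ?_ _
    filter_upwards [hev] with y hy
    have hvy := hv0 _ hy
    rw [raised_inr_inl hvy.ne' (hpos _ hy).det_pos.ne',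
      abs_det_blockMetric hvy (hpos _ hy).det_pos]
    simp only [flux, staticCoeff, Matrix.smul_apply, smul_eq_mul, mul_assoc, ← Finset.mul_sum]
    field_simp
  simp only [Finset.univ_unique, Finset.sum_singleton, PUnit.default_eq_unit, h0, h1, zero_add,
    Finset.sum_neg_distrib, neg_eq_zero] at hmax
  exact hmax

end StaticCoordinates

/-! ### Christoffel symbols, the time-time Einstein equation, and the subsolution identity. -/

section StaticCoordinates

variable {d : ℕ} {s v : EuclideanSpace ℝ (Fin d) → ℝ}
  {G b : EuclideanSpace ℝ (Fin d) → Matrix (Fin d) (Fin d) ℝ}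
  {Ω : Set (EuclideanSpace ℝ (Fin d))}

section Christoffel

variable {z : EuclideanSpace ℝ (Unit ⊕ Fin d)}
  (hG : ∀ i j, DifferentiableAt ℝ (fun x => G x i j) (spatial z))
  (hv : DifferentiableAt ℝ v (spatial z))
include hG hv

lemma partialDeriv_inl_blockMetric (μ ν : Unit ⊕ Fin d) :
    partialDeriv (Sum.inl ()) (fun y => blockMetric v G y μ ν) z = 0 := by
  rcases μ with μ | μ <;> rcases ν with ν | ν
  · exact partialDeriv_inl_comp_spatial (f := fun x => -v x ^ 2) (hv.pow 2).neg ()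
  · exact partialDeriv_const _ 0 z
  · exact partialDeriv_const _ 0 z
  · exact partialDeriv_inl_comp_spatial (f := fun x => G x μ ν) (hG μ ν) ()

omit hG in
lemma partialDeriv_inr_blockMetric_inl_inl (i : Fin d) :
    partialDeriv (Sum.inr i) (fun y => blockMetric v G y (Sum.inl ()) (Sum.inl ())) z
      = -partialDeriv i (fun x => v x ^ 2) (spatial z) := by
  rw [← partialDeriv_neg]
  exact partialDeriv_inr_comp_spatial (f := fun x => -v x ^ 2) (hv.pow 2).neg i

omit hv hG in
lemma partialDeriv_blockMetric_inl_inr (μ : Unit ⊕ Fin d) (j : Fin d) :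
    partialDeriv μ (fun y => blockMetric v G y (Sum.inl ()) (Sum.inr j)) z = 0 :=
  partialDeriv_const _ 0 z

omit hv hG in
lemma partialDeriv_blockMetric_inr_inl (μ : Unit ⊕ Fin d) (j : Fin d) :
    partialDeriv μ (fun y => blockMetric v G y (Sum.inr j) (Sum.inl ())) z = 0 :=
  partialDeriv_const _ 0 z

omit hv in
lemma partialDeriv_inr_blockMetric_inr_inr (i j k : Fin d) :
    partialDeriv (Sum.inr i) (fun y => blockMetric v G y (Sum.inr j) (Sum.inr k)) z
      = partialDeriv i (fun x => G x j k) (spatial z) :=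
  partialDeriv_inr_comp_spatial (f := fun x => G x j k) (hG j k) i

variable (hv0 : v (spatial z) ≠ 0) (hdet : (G (spatial z)).det ≠ 0)
include hv0 hdet

/-- Staticity kills every symbol with an odd number of time indices. What remains is Γ^i_{tt},
Γ^t_{ti} = Γ^t_{it} and the spatial symbols. -/
lemma christoffel_inl_inl_inl :
    christoffel (blockMetric v G) (Sum.inl ()) (Sum.inl ()) (Sum.inl ()) z = 0 := by
  simp [christoffel, blockMetric_inv hv0 hdet, partialDeriv_inl_blockMetric hG hv]

lemma christoffel_inr_inl_inl (i : Fin d) :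
    christoffel (blockMetric v G) (Sum.inr i) (Sum.inl ()) (Sum.inl ()) z
      = 1 / 2 * ∑ k, (G (spatial z))⁻¹ i k * partialDeriv k (fun x => v x ^ 2) (spatial z) := by
  simp [christoffel, blockMetric_inv hv0 hdet, partialDeriv_inl_blockMetric hG hv,
    partialDeriv_inr_blockMetric_inl_inl hv]

lemma christoffel_inl_inl_inr (i : Fin d) :
    christoffel (blockMetric v G) (Sum.inl ()) (Sum.inl ()) (Sum.inr i) z
      = 1 / 2 * ((v (spatial z) ^ 2)⁻¹ * partialDeriv i (fun x => v x ^ 2) (spatial z)) := by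
  simp [christoffel, blockMetric_inv hv0 hdet, partialDeriv_inl_blockMetric hG hv,
    partialDeriv_inr_blockMetric_inl_inl hv]

lemma christoffel_inl_inr_inl (i : Fin d) :
    christoffel (blockMetric v G) (Sum.inl ()) (Sum.inr i) (Sum.inl ()) z
      = 1 / 2 * ((v (spatial z) ^ 2)⁻¹ * partialDeriv i (fun x => v x ^ 2) (spatial z)) := by
  simp [christoffel, blockMetric_inv hv0 hdet, partialDeriv_inl_blockMetric hG hv,
    partialDeriv_inr_blockMetric_inl_inl hv]

lemma christoffel_inr_inl_inr (i j : Fin d) :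
    christoffel (blockMetric v G) (Sum.inr i) (Sum.inl ()) (Sum.inr j) z = 0 := by
  simp [christoffel, blockMetric_inv hv0 hdet, partialDeriv_inl_blockMetric hG hv,
    partialDeriv_blockMetric_inl_inr, partialDeriv_blockMetric_inr_inl]

lemma christoffel_inr_inr_inl (i j : Fin d) :
    christoffel (blockMetric v G) (Sum.inr i) (Sum.inr j) (Sum.inl ()) z = 0 := by
  simp [christoffel, blockMetric_inv hv0 hdet, partialDeriv_inl_blockMetric hG hv,
    partialDeriv_blockMetric_inr_inl]

omit hv in
lemma christoffel_inr_inr_inr (i j k : Fin d) :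
    christoffel (blockMetric v G) (Sum.inr i) (Sum.inr j) (Sum.inr k) z
      = christoffel G i j k (spatial z) := by
  simp [christoffel, blockMetric_inv hv0 hdet, partialDeriv_inr_blockMetric_inr_inr hG]

end Christoffel

/-- The contracted Christoffel symbol. -/
lemma sum_christoffel {x : EuclideanSpace ℝ (Fin d)} (hsymm : ∀ i j y, G y i j = G y j i)
    (i : Fin d) :
    ∑ k, christoffel G k k i x
      = 1 / 2 * ∑ k, ∑ l, (G x)⁻¹ k l * partialDeriv i (fun y => G y l k) x := by
  have hinv : ∀ k l, (G x)⁻¹ k l = (G x)⁻¹ l k := fun k l => by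
    have h1 : (G x)ᵀ = G x := by ext a b; exact hsymm _ _ _
    have h2 : ((G x)⁻¹)ᵀ = (G x)⁻¹ := by rw [Matrix.transpose_nonsing_inv, h1]
    exact congrFun (congrFun h2 l) k
  simp only [christoffel, ← Finset.mul_sum, mul_add, mul_sub, Finset.sum_add_distrib,
    Finset.sum_sub_distrib]
  have : ∑ k, ∑ l, (G x)⁻¹ k l * partialDeriv k (fun y => G y l i) x
      = ∑ k, ∑ l, (G x)⁻¹ k l * partialDeriv l (fun y => G y k i) x := by
    rw [Finset.sum_comm]
    exact Finset.sum_congr rfl fun k _ => Finset.sum_congr rfl fun l _ => by rw [hinv]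
  rw [this]
  ring

/-- Logarithmic derivative of the density `√det G / v`. -/
lemma partialDeriv_density (hΩ : IsOpen Ω) (hG : ∀ i j, ContDiffOn ℝ ∞ (fun x => G x i j) Ω)
    (hsymm : ∀ i j y, G y i j = G y j i)
    (hpos : ∀ x ∈ Ω, (G x).PosDef) (hv : ContDiffOn ℝ ∞ v Ω) (hv0 : ∀ x ∈ Ω, 0 < v x)
    {x : EuclideanSpace ℝ (Fin d)} (hx : x ∈ Ω) (i : Fin d) :
    partialDeriv i (fun y => √(G y).det / v y) x
      = √(G x).det / v x * (∑ k, christoffel G k k i x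
        - 1 / 2 * ((v x ^ 2)⁻¹ * partialDeriv i (fun x => v x ^ 2) x)) := by
  have hGd : ∀ i j, DifferentiableAt ℝ (fun y => G y i j) x := fun i j =>
    (hG i j).differentiableAt_of_isOpen hΩ hx
  have hvd := hv.differentiableAt_of_isOpen hΩ hx
  have hvx := hv0 x hx
  have hD := (hpos x hx).det_pos
  have hdd : DifferentiableAt ℝ (fun y => (G y).det) x :=
    (contDiffOn_det hG).differentiableAt_of_isOpen hΩ hx
  have hsq : DifferentiableAt ℝ (fun y => √(G y).det) x := hdd.sqrt hD.ne'
  have h1 : partialDeriv i (fun y => √(G y).det) x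
      = √(G x).det * ∑ k, christoffel G k k i x := by
    rw [partialDeriv_comp (θ := Real.sqrt) (Real.hasDerivAt_sqrt hD.ne').differentiableAt hdd,
      (Real.hasDerivAt_sqrt hD.ne').deriv, partialDeriv_det hGd hD.ne', sum_christoffel hsymm]
    have hS := Real.sq_sqrt hD.le
    have hS0 := Real.sqrt_pos.2 hD
    set S := √(G x).det
    rw [← hS]
    field_simp
  have h2 : partialDeriv i (fun x => v x ^ 2) x = 2 * v x * partialDeriv i v x := by
    simp only [pow_two]
    rw [partialDeriv_mul hvd hvd]; ring
  have h3 : partialDeriv i (fun y => (v y)⁻¹) x = -(v x ^ 2)⁻¹ * partialDeriv i v x := by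
    rw [partialDeriv_comp (θ := fun t => t⁻¹) (hasDerivAt_inv hvx.ne').differentiableAt hvd,
      (hasDerivAt_inv hvx.ne').deriv]
  simp only [div_eq_mul_inv]
  rw [partialDeriv_mul hsq (hvd.fun_inv hvx.ne'), h1, h2, h3]
  field_simp
  ring

/-- The time-time component of the Ricci tensor of `-v² dt² + G`. -/
lemma divForm_sq_eq_ricci (hΩ : IsOpen Ω) (hG : ∀ i j, ContDiffOn ℝ ∞ (fun x => G x i j) Ω)
    (hsymm : ∀ i j y, G y i j = G y j i)
    (hpos : ∀ x ∈ Ω, (G x).PosDef) (hv : ContDiffOn ℝ ∞ v Ω) (hv0 : ∀ x ∈ Ω, 0 < v x)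
    {z : EuclideanSpace ℝ (Unit ⊕ Fin d)} (hz : spatial z ∈ Ω) :
    divForm (staticCoeff G v) (fun y => v y ^ 2) (spatial z)
      = 2 * (√(G (spatial z)).det / v (spatial z))
        * ricci (blockMetric v G) (Sum.inl ()) (Sum.inl ()) z := by
  have hGd : ∀ x ∈ Ω, ∀ i j, DifferentiableAt ℝ (fun y => G y i j) x := fun x hx i j =>
    (hG i j).differentiableAt_of_isOpen hΩ hx
  have hvd : ∀ x ∈ Ω, DifferentiableAt ℝ v x := fun x hx => hv.differentiableAt_of_isOpen hΩ hx
  have hne : ∀ x ∈ Ω, v x ≠ 0 := fun x hx => (hv0 x hx).ne'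
  have hdet : ∀ x ∈ Ω, (G x).det ≠ 0 := fun x hx => (hpos x hx).det_pos.ne'
  have hev : ∀ᶠ y in 𝓝 z, spatial y ∈ Ω := continuous_spatial.continuousAt (hΩ.mem_nhds hz)
  -- `N i` is Γ^i_{tt} = ½ G^{ik} ∂_k v², half the gradient of v².
  set N : Fin d → EuclideanSpace ℝ (Fin d) → ℝ := fun i x =>
    1 / 2 * ∑ k, (G x)⁻¹ i k * partialDeriv k (fun x => v x ^ 2) x with hN
  have hv2 : ContDiffOn ℝ ∞ (fun x => v x ^ 2) Ω := hv.pow 2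
  have hNs : ∀ i, ContDiffOn ℝ ∞ (N i) Ω := fun i =>
    contDiffOn_const.mul (ContDiffOn.sum fun k _ =>
      (contDiffOn_inv_apply hG hdet i k).mul (contDiffOn_partialDeriv hΩ hv2 k))
  have hNd : ∀ i, DifferentiableAt ℝ (N i) (spatial z) := fun i =>
    (hNs i).differentiableAt_of_isOpen hΩ hz
  have hdz : ∀ {f : EuclideanSpace ℝ (Unit ⊕ Fin d) → ℝ} (μ : Unit ⊕ Fin d),
      (∀ y, spatial y ∈ Ω → f y = 0) → partialDeriv μ f z = 0 := fun μ hf => by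
    rw [partialDeriv_congr (h := fun _ => 0) _ μ, partialDeriv_const]
    filter_upwards [hev] with y hy using hf y hy
  have d1 : ∀ μ, partialDeriv μ (christoffel (blockMetric v G) (Sum.inl ()) (Sum.inl ())
      (Sum.inl ())) z = 0 := fun μ => hdz μ fun y hy =>
    christoffel_inl_inl_inl (hGd _ hy) (hvd _ hy) (hne _ hy) (hdet _ hy)
  have d2 : ∀ μ (i : Fin d), partialDeriv μ (christoffel (blockMetric v G) (Sum.inr i) (Sum.inr i)
      (Sum.inl ())) z = 0 := fun μ i => hdz μ fun y hy =>
    christoffel_inr_inr_inl (hGd _ hy) (hvd _ hy) (hne _ hy) (hdet _ hy) i i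
  have d3 : ∀ i : Fin d, partialDeriv (Sum.inr i) (christoffel (blockMetric v G) (Sum.inr i)
      (Sum.inl ()) (Sum.inl ())) z = partialDeriv i (N i) (spatial z) := fun i => by
    rw [← partialDeriv_inr_comp_spatial (hNd i)]
    refine partialDeriv_congr ?_ _
    filter_upwards [hev] with y hy using
      christoffel_inr_inl_inl (hGd _ hy) (hvd _ hy) (hne _ hy) (hdet _ hy) i
  have c1 := christoffel_inl_inl_inl (hGd _ hz) (hvd _ hz) (hne _ hz) (hdet _ hz)
  have c2 : ∀ i, christoffel (blockMetric v G) (Sum.inr i) (Sum.inl ()) (Sum.inl ()) z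
      = N i (spatial z) :=
    christoffel_inr_inl_inl (hGd _ hz) (hvd _ hz) (hne _ hz) (hdet _ hz)
  have c3 := christoffel_inl_inl_inr (hGd _ hz) (hvd _ hz) (hne _ hz) (hdet _ hz)
  have c4 := christoffel_inl_inr_inl (hGd _ hz) (hvd _ hz) (hne _ hz) (hdet _ hz)
  have c5 := christoffel_inr_inl_inr (hGd _ hz) (hvd _ hz) (hne _ hz) (hdet _ hz)
  have c6 := christoffel_inr_inr_inl (hGd _ hz) (hvd _ hz) (hne _ hz) (hdet _ hz)
  have c7 := christoffel_inr_inr_inr (v := v) (hGd _ hz) (hne _ hz) (hdet _ hz)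
  -- `T i` is Γ^t_{ti} = ∂_i log v.
  set T : Fin d → ℝ := fun i => 1 / 2 * ((v (spatial z) ^ 2)⁻¹ *
    partialDeriv i (fun x => v x ^ 2) (spatial z)) with hT
  set c := √(G (spatial z)).det / v (spatial z) with hc
  -- The trace term contributes (Γ^k_{ki} + T_i)N^i and the quadratic term -2T_iN^i. The resulting
  -- factor Γ^k_{ki} - T_i is the logarithmic derivative of √det G / v, so R_tt is a weighted
  -- divergence of N.
  have hricci : ricci (blockMetric v G) (Sum.inl ()) (Sum.inl ()) z
      = ∑ i, (partialDeriv i (N i) (spatial z)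
        + (∑ k, christoffel G k k i (spatial z) - T i) * N i (spatial z)) := by
    simp only [ricci, Fintype.sum_sum_type, Finset.univ_unique, Finset.sum_singleton,
      PUnit.default_eq_unit, d1, d2, d3, c1, c2, c3, c4, c5, c6, c7]
    have hswap : ∑ i, (∑ k, christoffel G k k i (spatial z)) * N i (spatial z)
        = ∑ k, ∑ i, christoffel G k k i (spatial z) * N i (spatial z) := by
      simp only [Finset.sum_mul]; rw [Finset.sum_comm]
    simp only [sub_mul, Finset.sum_add_distrib, Finset.sum_sub_distrib, hswap]
    simp only [hT, mul_zero, sub_zero, zero_add, Finset.sum_const_zero, mul_comm (N _ _)]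
    ring
  have hflux : ∀ i, ∀ x, flux (staticCoeff G v) (fun y => v y ^ 2) i x
      = √(G x).det / v x * (2 * N i x) := fun i x => by
    simp only [flux, staticCoeff, Matrix.smul_apply, smul_eq_mul, hN, mul_assoc, ← Finset.mul_sum]
    ring
  have hdens : DifferentiableAt ℝ (fun y => √(G y).det / v y) (spatial z) :=
    (((contDiffOn_det hG).sqrt hdet).div hv hne).differentiableAt_of_isOpen hΩ hz
  rw [hricci, divForm, Finset.mul_sum]
  refine Finset.sum_congr rfl fun i _ => ?_
  rw [partialDeriv_congr (Filter.Eventually.of_forall (hflux i)), partialDeriv_mul hdens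
    ((hNd i).const_mul 2), partialDeriv_const_mul 2 (hNd i),
    partialDeriv_density hΩ hG hsymm hpos hv hv0 hz]
  simp only [hT, hc]
  ring

/-- The electric part appears twice, as F_{ti} and F_{it}, each time with the negative sign of the
inverse metric in the time direction. -/
lemma normSq_block {z : EuclideanSpace ℝ (Unit ⊕ Fin d)} (hv : v (spatial z) ≠ 0)
    (hG : (G (spatial z)).det ≠ 0) :
    normSq (blockMetric v G) (blockField s b) z
      = -2 * (v (spatial z) ^ 2)⁻¹ * carre (fun x => (G x)⁻¹) s s (spatial z)
        + normSq G b (spatial z) := by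
  simp only [normSq, Fintype.sum_sum_type, Finset.univ_unique, Finset.sum_singleton,
    PUnit.default_eq_unit, raised_inl_inl hv hG, raised_inl_inr hv hG, raised_inr_inl hv hG,
    raised_inr_inr hv hG]
  simp only [blockField, Matrix.fromBlocks_apply₁₁, Matrix.fromBlocks_apply₁₂,
    Matrix.fromBlocks_apply₂₁, Matrix.fromBlocks_apply₂₂, Matrix.of_apply, carre, flux,
    Finset.sum_add_distrib, mul_zero, zero_add, Finset.mul_sum, ← add_assoc]
  congr 1
  simp only [← Finset.sum_add_distrib]
  exact Finset.sum_congr rfl fun _ _ => Finset.sum_congr rfl fun _ _ => by ring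

/-- The time-time component of Einstein's equation. -/
lemma divForm_lapse_sq (hd : 3 ≤ d) (hΩ : IsOpen Ω)
    (hG : ∀ i j, ContDiffOn ℝ ∞ (fun x => G x i j) Ω)
    (hsymm : ∀ i j y, G y i j = G y j i)
    (hpos : ∀ x ∈ Ω, (G x).PosDef) (hv : ContDiffOn ℝ ∞ v Ω) (hv0 : ∀ x ∈ Ω, 0 < v x)
    {z : EuclideanSpace ℝ (Unit ⊕ Fin d)} (hz : spatial z ∈ Ω)
    (hEM : EinsteinMaxwellAt (blockMetric v G) (blockField s b) z) :
    divForm (staticCoeff G v) (fun y => v y ^ 2) (spatial z)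
      = 2 * (2 * ((d : ℝ) - 2) / ((d : ℝ) - 1) * carre (staticCoeff G v) s s (spatial z)
        + √(G (spatial z)).det / v (spatial z) *
          (v (spatial z) ^ 2 * normSq G b (spatial z) / ((d : ℝ) - 1))) := by
  have hvz := (hv0 _ hz).ne'
  have hdz := (hpos _ hz).det_pos.ne'
  have hd1 : (d : ℝ) - 1 ≠ 0 := by
    have : (3 : ℝ) ≤ d := by exact_mod_cast hd
    linarith
  rw [divForm_sq_eq_ricci hΩ hG hsymm hpos hv hv0 hz, hEM.einstein, normSq_block hvz hdz,
    blockMetric_inv hvz hdz]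
  have h1 : ∑ ρ, ∑ σ, blockField s b z (Sum.inl ()) ρ * Matrix.fromBlocks
      (Matrix.of fun _ _ : Unit => -(v (spatial z) ^ 2)⁻¹) 0 0 (G (spatial z))⁻¹ ρ σ *
      blockField s b z (Sum.inl ()) σ = carre (fun x => (G x)⁻¹) s s (spatial z) := by
    simp [Fintype.sum_sum_type, blockField, carre, flux, Finset.mul_sum, mul_assoc]
  have h2 : carre (staticCoeff G v) s s (spatial z) = √(G (spatial z)).det / v (spatial z) *
      carre (fun x => (G x)⁻¹) s s (spatial z) := by
    simp only [carre, flux, staticCoeff, Matrix.smul_apply, smul_eq_mul, Finset.mul_sum]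
    exact Finset.sum_congr rfl fun _ _ => Finset.sum_congr rfl fun _ _ => by ring
  have h3 : (Fintype.card (Unit ⊕ Fin d) : ℝ) - 2 = (d : ℝ) - 1 := by
    simp; ring
  rw [h1, h2, h3]
  simp only [blockMetric, Matrix.fromBlocks_apply₁₁, Matrix.of_apply]
  field_simp
  ring

/-- The key differential identity: `v² - (1 - κ s)²` is a subsolution. -/
theorem divForm_sq_sub_sq (hd : 3 ≤ d) (hΩ : IsOpen Ω)
    (hG : ∀ i j, ContDiffOn ℝ ∞ (fun x => G x i j) Ω)
    (hsymm : ∀ i j y, G y i j = G y j i)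
    (hpos : ∀ x ∈ Ω, (G x).PosDef) (hv : ContDiffOn ℝ ∞ v Ω) (hv0 : ∀ x ∈ Ω, 0 < v x)
    (hs : ContDiffOn ℝ ∞ s Ω)
    (hEM : ∀ z, spatial z ∈ Ω → EinsteinMaxwellAt (blockMetric v G) (blockField s b) z)
    {κ : ℝ} (hκ : κ ^ 2 = 2 * ((d : ℝ) - 2) / ((d : ℝ) - 1))
    {x : EuclideanSpace ℝ (Fin d)} (hx : x ∈ Ω) :
    divForm (staticCoeff G v) (fun y => v y ^ 2 - (1 - κ * s y) ^ 2) x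
      = 2 * (√(G x).det / v x * (v x ^ 2 * normSq G b x / ((d : ℝ) - 1))) := by
  obtain ⟨z, rfl⟩ := exists_spatial_eq x
  have ha := contDiffOn_staticCoeff hG hpos hv hv0
  -- The electric square is θ(s) with θ'' = -2κ². Because s is annihilated by the operator, the
  -- chain rule leaves only -2κ² a∇s·∇s, the opposite of the electric term in `divForm_lapse_sq`.
  have hθ : ContDiff ℝ ∞ fun t : ℝ => -(1 - κ * t) ^ 2 := by fun_prop
  have hd1 : deriv (fun t : ℝ => -(1 - κ * t) ^ 2) = fun t => 2 * κ * (1 - κ * t) := by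
    ext t
    have := ((((hasDerivAt_id t).const_mul κ).const_sub 1).pow 2).neg.deriv
    simp only [id, mul_one] at this
    refine Eq.trans ?_ (this.trans ?_)
    · rfl
    · push_cast; ring
  have hd2 : ∀ t, deriv (fun t : ℝ => 2 * κ * (1 - κ * t)) t = -2 * κ ^ 2 := fun t => by
    have := (((hasDerivAt_id t).const_mul κ).const_sub 1).const_mul (2 * κ) |>.deriv
    simp only [id, mul_one] at this
    rw [this]; ring
  have h1 : (fun y => v y ^ 2 - (1 - κ * s y) ^ 2) = fun y => v y ^ 2 + -(1 - κ * s y) ^ 2 := by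
    ext y; ring
  rw [h1, divForm_add hΩ ha (u := fun y => v y ^ 2) (v := fun y => -(1 - κ * s y) ^ 2) (hv.pow 2)
      (hθ.comp_contDiffOn hs) hx,
    divForm_comp hΩ ha hs hθ hx, hd1, hd2, divForm_potential hΩ hG hpos hv hv0 hs hx (hEM z hx),
    divForm_lapse_sq hd hΩ hG hsymm hpos hv hv0 hx (hEM z hx), hκ]
  ring

/-- With G⁻¹ = PᵀP, the norm of `b` is the sum of squares of the entries of W = P b Pᵀ, and P is
invertible. -/
lemma normSq_nonneg_and_eq_zero {x : EuclideanSpace ℝ (Fin d)} (hpos : (G x).PosDef) :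
    0 ≤ normSq G b x ∧ (normSq G b x = 0 → b x = 0) := by
  obtain ⟨P, hP⟩ : ∃ P : Matrix (Fin d) (Fin d) ℝ, (G x)⁻¹ = Pᴴ * P := by
    open scoped MatrixOrder in
    exact CStarAlgebra.nonneg_iff_eq_star_mul_self.mp hpos.inv.posSemidef.nonneg
  rw [Matrix.conjTranspose_eq_transpose_of_trivial] at hP
  have hPdet : IsUnit P.det := by
    have h1 : ((G x)⁻¹).det ≠ 0 := hpos.inv.det_pos.ne'
    rw [hP, Matrix.det_mul] at h1
    exact isUnit_iff_ne_zero.2 (right_ne_zero_of_mul h1)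
  set W := P * b x * Pᵀ with hW
  have hsum : ∀ A B : Matrix (Fin d) (Fin d) ℝ, ∑ i, ∑ j, A i j * B i j = (Aᵀ * B).trace := by
    intro A B
    simp only [Matrix.trace, Matrix.diag, Matrix.mul_apply, Matrix.transpose_apply]
    rw [Finset.sum_comm]
  have h1 : normSq G b x = ∑ i, ∑ j, W i j ^ 2 := by
    simp only [pow_two]
    rw [normSq, hsum, hsum, raised, hP, hW]
    simp only [Matrix.transpose_mul, Matrix.transpose_transpose]
    rw [show P * ((b x)ᵀ * Pᵀ) * (P * b x * Pᵀ) = P * ((b x)ᵀ * (Pᵀ * P * b x * Pᵀ)) by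
      simp only [Matrix.mul_assoc], Matrix.trace_mul_comm P]
    simp only [Matrix.mul_assoc]
  refine ⟨h1 ▸ Finset.sum_nonneg fun i _ => Finset.sum_nonneg fun j _ => sq_nonneg _, fun h0 => ?_⟩
  rw [h1] at h0
  replace h0 := (Finset.sum_eq_zero_iff_of_nonneg (f := fun i => ∑ j, W i j ^ 2)
    fun i _ => Finset.sum_nonneg fun j _ => sq_nonneg _).1 h0
  have hW0 : W = 0 := by
    ext i j
    have := h0 i (Finset.mem_univ _)
    have := (Finset.sum_eq_zero_iff_of_nonneg (f := fun j => W i j ^ 2)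
      fun j _ => sq_nonneg _).1 this j (Finset.mem_univ _)
    simpa using this
  calc b x = P⁻¹ * W * (P⁻¹)ᵀ := by
        rw [hW, Matrix.mul_assoc P, Matrix.nonsing_inv_mul_cancel_left _ _ hPdet,
          Matrix.mul_assoc, ← Matrix.transpose_mul, Matrix.nonsing_inv_mul _ hPdet,
          Matrix.transpose_one, Matrix.mul_one]
    _ = 0 := by simp [hW0]

end StaticCoordinates

/-! ### Smooth charts of a manifold with boundary -/

section Manifold

variable {d : ℕ} [NeZero d] {X : Type*} [TopologicalSpace X]
  [ChartedSpace (EuclideanHalfSpace d) X]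

section Charts

variable {Φ : OpenPartialHomeomorph X (EuclideanSpace ℝ (Fin d))}

lemma IsSmoothChart.mdifferentiable (hΦ : IsSmoothChart Φ) :
    Φ.MDifferentiable (𝓡∂ d) 𝓘(ℝ, EuclideanSpace ℝ (Fin d)) :=
  ⟨hΦ.1.mdifferentiableOn (by simp), hΦ.2.mdifferentiableOn (by simp)⟩

lemma IsSmoothChart.contDiffOn_comp (hΦ : IsSmoothChart Φ) {f : X → ℝ}
    (hf : ContMDiff (𝓡∂ d) 𝓘(ℝ, ℝ) ∞ f) :
    ContDiffOn ℝ ∞ (fun x => f (Φ.symm x)) Φ.target :=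
  contMDiffOn_iff_contDiffOn.1 (hf.comp_contMDiffOn hΦ.2)

variable (T : ∀ p : X, TangentSpace (𝓡∂ d) p →L[ℝ] TangentSpace (𝓡∂ d) p →L[ℝ] ℝ)

/-- This passes between matrix components and the invariant bilinear form, so that positivity and
vanishing transfer in both directions. -/
lemma components_dotProduct (x : EuclideanSpace ℝ (Fin d)) (ξ η : Fin d → ℝ) :
    ξ ⬝ᵥ (components T Φ x *ᵥ η) = T (Φ.symm x)
      (mfderiv 𝓘(ℝ, EuclideanSpace ℝ (Fin d)) (𝓡∂ d) Φ.symm x (WithLp.toLp 2 ξ : EuclideanSpace ℝ (Fin d)))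
      (mfderiv 𝓘(ℝ, EuclideanSpace ℝ (Fin d)) (𝓡∂ d) Φ.symm x (WithLp.toLp 2 η : EuclideanSpace ℝ (Fin d))) := by
  set L : EuclideanSpace ℝ (Fin d) →L[ℝ] TangentSpace (𝓡∂ d) (Φ.symm x) :=
    mfderiv 𝓘(ℝ, EuclideanSpace ℝ (Fin d)) (𝓡∂ d) Φ.symm x
  have hexp : ∀ ζ : Fin d → ℝ, (WithLp.toLp 2 ζ : EuclideanSpace ℝ (Fin d))
      = ∑ i, ζ i • EuclideanSpace.single i (1 : ℝ) := fun ζ => by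
    conv_lhs => rw [← (EuclideanSpace.basisFun (Fin d) ℝ).sum_repr (WithLp.toLp 2 ζ)]
    simp
  have h1 : T (Φ.symm x) (L (WithLp.toLp 2 ξ)) (L (WithLp.toLp 2 η))
      = ∑ i, ∑ j, ξ i * (η j * T (Φ.symm x) (L (EuclideanSpace.single i 1))
          (L (EuclideanSpace.single j 1))) := by
    rw [hexp ξ, hexp η]
    simp only [map_sum, map_smul, sum_apply, smul_apply,
      smul_eq_mul, Finset.mul_sum]
    rw [Finset.sum_comm]
    exact Finset.sum_congr rfl fun i _ => Finset.sum_congr rfl fun j _ => by ring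
  refine Eq.trans ?_ h1.symm
  simp only [dotProduct, Matrix.mulVec, components, Matrix.of_apply, Finset.mul_sum]
  exact Finset.sum_congr rfl fun i _ => Finset.sum_congr rfl fun j _ => by
    rw [mul_comm (η j)]; rfl

variable {T}

lemma eq_zero_of_components_eq_zero (hΦ : IsSmoothChart Φ) {p : X} (hp : p ∈ Φ.source)
    (h : components T Φ (Φ p) = 0) : T p = 0 := by
  have hx : Φ p ∈ Φ.target := Φ.map_source hp
  have hsurj : Function.Surjective
      (mfderiv 𝓘(ℝ, EuclideanSpace ℝ (Fin d)) (𝓡∂ d) Φ.symm (Φ p)) :=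
    hΦ.mdifferentiable.symm.mfderiv_surjective hx
  have hzero : T (Φ.symm (Φ p)) = 0 := by
    refine ContinuousLinearMap.ext fun v => ContinuousLinearMap.ext fun w => ?_
    obtain ⟨ξ, rfl⟩ := hsurj v
    obtain ⟨η, rfl⟩ := hsurj w
    have := components_dotProduct T (Φ := Φ) (Φ p) (WithLp.ofLp ξ) (WithLp.ofLp η)
    rw [h] at this
    simp only [Matrix.zero_mulVec, dotProduct_zero] at this
    exact this.symm
  rwa [Φ.left_inv hp] at hzero

variable [IsManifold (𝓡∂ d) ∞ X]

/-- The coordinate vector fields are images of constant sections under the tangent map of `Φ.symm`,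
hence smooth; a component is the smooth tensor evaluated on two of them. -/
lemma contDiffOn_components (hΦ : IsSmoothChart Φ)
    (hT : ContMDiff (𝓡∂ d)
      ((𝓡∂ d).prod 𝓘(ℝ, EuclideanSpace ℝ (Fin d) →L[ℝ] EuclideanSpace ℝ (Fin d) →L[ℝ] ℝ)) ∞
      (fun p : X => TotalSpace.mk'
        (EuclideanSpace ℝ (Fin d) →L[ℝ] EuclideanSpace ℝ (Fin d) →L[ℝ] ℝ)
        (E := fun p : X => TangentSpace (𝓡∂ d) p →L[ℝ] TangentSpace (𝓡∂ d) p →L[ℝ] ℝ) p (T p)))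
    (i j : Fin d) : ContDiffOn ℝ ∞ (fun x => components T Φ x i j) Φ.target := by
  have : IsManifold (𝓡∂ d) 1 X := IsManifold.of_le (n := ∞) (by simp)
  set E := EuclideanSpace ℝ (Fin d)
  have hvec : ∀ e : E, ContMDiffOn 𝓘(ℝ, E) ((𝓡∂ d).prod 𝓘(ℝ, E)) ∞
      (fun x : E => (TotalSpace.mk' E (Φ.symm x) (mfderiv 𝓘(ℝ, E) (𝓡∂ d) Φ.symm x e) :
        TangentBundle (𝓡∂ d) X)) Φ.target := by
    intro e
    have h1 := hΦ.2.contMDiffOn_tangentMapWithin (m := ∞) (by simp) Φ.open_target.uniqueMDiffOn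
    have h2 : ContMDiff 𝓘(ℝ, E) (𝓘(ℝ, E).prod 𝓘(ℝ, E)) ∞
        (fun x : E => (TotalSpace.mk' E x e : TangentBundle 𝓘(ℝ, E) E)) := by
      intro x₀
      rw [contMDiffAt_totalSpace]
      refine ⟨contMDiff_id x₀, ?_⟩
      simpa using contMDiffAt_const
    have h3 := h1.comp h2.contMDiffOn (s := Φ.target) (fun x hx => hx)
    refine h3.congr fun x hx => ?_
    simp only [Function.comp, tangentMapWithin]
    rw [mfderivWithin_of_isOpen Φ.open_target hx]
  have key : ContMDiffOn 𝓘(ℝ, E) ((𝓡∂ d).prod 𝓘(ℝ, ℝ)) ∞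
      (fun x => TotalSpace.mk' ℝ (E := Bundle.Trivial X ℝ) (Φ.symm x) (components T Φ x i j))
      Φ.target := by
    intro x hx
    apply ContMDiffWithinAt.clm_bundle_apply₂ (F₁ := E) (F₂ := E)
      (E₁ := fun p : X => TangentSpace (𝓡∂ d) p) (E₂ := fun p : X => TangentSpace (𝓡∂ d) p)
    · exact ContMDiffAt.comp_contMDiffWithinAt x hT.contMDiffAt (hΦ.2 x hx)
    · exact hvec _ x hx
    · exact hvec _ x hx
  intro x hx
  have := key x hx
  simp only [contMDiffWithinAt_totalSpace] at this
  exact contMDiffWithinAt_iff_contDiffWithinAt.1 this.2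

variable (g : ContMDiffRiemannianMetric (𝓡∂ d) ∞ (EuclideanSpace ℝ (Fin d))
      (fun p : X => TangentSpace (𝓡∂ d) p))

lemma components_symm (i j : Fin d) (x : EuclideanSpace ℝ (Fin d)) :
    components g.inner Φ x i j = components g.inner Φ x j i :=
  g.symm _ _ _

lemma posDef_components (hΦ : IsSmoothChart Φ) {x : EuclideanSpace ℝ (Fin d)}
    (hx : x ∈ Φ.target) : (components g.inner Φ x).PosDef := by
  refine Matrix.PosDef.of_dotProduct_mulVec_pos ?_ fun ξ hξ => ?_
  · ext i j
    simpa using components_symm g j i x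
  · rw [star_trivial, components_dotProduct]
    refine g.pos _ _ fun h0 => hξ ?_
    have := hΦ.mdifferentiable.symm.mfderiv_injective hx (h0.trans (map_zero _).symm)
    exact (WithLp.toLp_eq_zero 2).1 this

end Charts

/-! ### The interior, described by coordinate domains. -/

variable (d) in
/-- The points that lie in the domain of a smooth coordinate system with values in `ℝ^d`. -/
def chartPoints (X : Type*) [TopologicalSpace X] [ChartedSpace (EuclideanHalfSpace d) X] : Set X :=
  {p | ∃ Φ : OpenPartialHomeomorph X (EuclideanSpace ℝ (Fin d)), IsSmoothChart Φ ∧ p ∈ Φ.source}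

/-- The part of the preferred chart at `p` that lies in the open half space. -/
def interiorChart (p : X) : OpenPartialHomeomorph X (EuclideanSpace ℝ (Fin d)) where
  toFun := extChartAt (𝓡∂ d) p
  invFun := (extChartAt (𝓡∂ d) p).symm
  source := (chartAt (EuclideanHalfSpace d) p).source ∩ extChartAt (𝓡∂ d) p ⁻¹' {y | 0 < y 0}
  target := (extChartAt (𝓡∂ d) p).target ∩ {y | 0 < y 0}
  map_source' q hq := ⟨(extChartAt (𝓡∂ d) p).map_source (by simpa using hq.1), hq.2⟩
  map_target' y hy := ⟨by simpa using (extChartAt (𝓡∂ d) p).map_target hy.1, by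
    rw [Set.mem_preimage, (extChartAt (𝓡∂ d) p).right_inv hy.1]; exact hy.2⟩
  left_inv' q hq := (extChartAt (𝓡∂ d) p).left_inv (by simpa using hq.1)
  right_inv' y hy := (extChartAt (𝓡∂ d) p).right_inv hy.1
  open_source := isOpen_extChartAt_preimage (I := 𝓡∂ d) p
    (isOpen_lt continuous_const (by fun_prop))
  open_target := by
    have : (extChartAt (𝓡∂ d) p).target ∩ {y | 0 < y 0}
        = (𝓡∂ d).symm ⁻¹' (chartAt (EuclideanHalfSpace d) p).target ∩ {y | 0 < y 0} := by
      rw [extChartAt_target, range_modelWithCornersEuclideanHalfSpace]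
      ext y
      simp only [Set.mem_inter_iff, Set.mem_ofPred_eq, Set.mem_preimage]
      exact ⟨fun h => ⟨h.1.1, h.2⟩, fun h => ⟨⟨h.1, h.2.le⟩, h.2⟩⟩
    rw [this]
    exact ((chartAt (EuclideanHalfSpace d) p).open_target.preimage (𝓡∂ d).continuous_symm).inter
      (isOpen_lt continuous_const (by fun_prop))
  continuousOn_toFun := (continuousOn_extChartAt p).mono fun q hq => by simpa using hq.1
  continuousOn_invFun := (continuousOn_extChartAt_symm p).mono Set.inter_subset_left

section IsManifold

variable [IsManifold (𝓡∂ d) ∞ X]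

lemma isSmoothChart_interiorChart (p : X) : IsSmoothChart (interiorChart (d := d) p) :=
  ⟨(contMDiffOn_extChartAt (I := 𝓡∂ d) (x := p)).mono Set.inter_subset_left,
    (contMDiffOn_extChartAt_symm (I := 𝓡∂ d) p).mono Set.inter_subset_left⟩

lemma mem_chartPoints_of_pos {p q : X} (hq : q ∈ (chartAt (EuclideanHalfSpace d) p).source)
    (h : 0 < extChartAt (𝓡∂ d) p q 0) : q ∈ chartPoints d X :=
  ⟨interiorChart p, isSmoothChart_interiorChart p, hq, h⟩

/-- `chartPoints` serves as the interior throughout: it contains the source of the asymptotic chart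
by definition, and this inclusion places its complement in the boundary, where the lapse vanishes.
-/
lemma interior_subset_chartPoints : (𝓡∂ d).interior X ⊆ chartPoints d X := by
  intro p hp
  have hp' : extChartAt (𝓡∂ d) p p ∈ interior (Set.range (𝓡∂ d)) := hp
  rw [interior_range_modelWithCornersEuclideanHalfSpace] at hp'
  exact mem_chartPoints_of_pos (mem_chart_source _ p) hp'

/-- Every point has a neighborhood in which a connected set of interior points is dense. -/
lemma exists_nhds_subset_closure (p : X) : ∃ N N' : Set X, IsOpen N ∧ p ∈ N ∧
    N' ⊆ N ∩ chartPoints d X ∧ N ⊆ closure N' ∧ IsPreconnected N' := by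
  set e := extChartAt (𝓡∂ d) p
  obtain ⟨ε, hε, hball⟩ := Metric.mem_nhdsWithin_iff.1 (extChartAt_target_mem_nhdsWithin (I := 𝓡∂ d) p)
  -- The open half ball is convex, hence connected, consists of interior coordinates, and is dense
  -- in the relatively closed half ball.
  set W : Set (EuclideanSpace ℝ (Fin d)) := Metric.ball (e p) ε ∩ {y | 0 < y 0}
  have hrange : {y : EuclideanSpace ℝ (Fin d) | 0 < y 0} ⊆ Set.range (𝓡∂ d) := by
    rw [range_modelWithCornersEuclideanHalfSpace]
    exact fun y (hy : 0 < y 0) => hy.le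
  have hW : W ⊆ e.target := fun y hy => hball ⟨hy.1, hrange hy.2⟩
  refine ⟨(chartAt (EuclideanHalfSpace d) p).source ∩ e ⁻¹' Metric.ball (e p) ε, e.symm '' W,
    isOpen_extChartAt_preimage (I := 𝓡∂ d) p Metric.isOpen_ball,
    ⟨mem_chart_source _ p, Metric.mem_ball_self hε⟩, ?_, ?_, ?_⟩
  · rintro _ ⟨y, hy, rfl⟩
    have h1 : e.symm y ∈ (chartAt (EuclideanHalfSpace d) p).source := by
      simpa [e] using e.map_target (hW hy)
    have h2 : e (e.symm y) = y := e.right_inv (hW hy)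
    refine ⟨⟨h1, by rw [Set.mem_preimage, h2]; exact hy.1⟩, mem_chartPoints_of_pos h1 ?_⟩
    change 0 < e (e.symm y) 0
    rw [h2]; exact hy.2
  · rintro q ⟨hq, hqb⟩
    have hqs : q ∈ e.source := by simpa [e] using hq
    have h1 : e q ∈ closure W := by
      have h2 : e q ∈ {y : EuclideanSpace ℝ (Fin d) | 0 ≤ y 0} := by
        rw [← range_modelWithCornersEuclideanHalfSpace]
        exact extChartAt_target_subset_range (I := 𝓡∂ d) p (e.map_source hqs)
      rw [← closure_open_halfSpace] at h2
      exact Metric.isOpen_ball.inter_closure ⟨hqb, h2⟩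
    have h3 := ((continuousOn_extChartAt_symm (I := 𝓡∂ d) p) (e q) (e.map_source hqs)).mono hW
    have h4 := h3.mem_closure_image h1
    rwa [e.left_inv hqs] at h4
  · have hconv : Convex ℝ W := (convex_ball _ _).inter
      (convex_halfSpace_gt (f := fun y : EuclideanSpace ℝ (Fin d) => y 0)
        ⟨fun _ _ => rfl, fun _ _ => rfl⟩ 0)
    exact hconv.isPreconnected.image _ ((continuousOn_extChartAt_symm (I := 𝓡∂ d) p).mono hW)

lemma dense_chartPoints : Dense (chartPoints d X) := by
  intro p
  obtain ⟨N, N', -, hp, hN', hcl, -⟩ := exists_nhds_subset_closure (d := d) p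
  exact closure_mono (hN'.trans Set.inter_subset_right) (hcl hp)

/-- If open sets split `chartPoints`, the closures of the two pieces cover the connected space and
so share a point. Near that point `chartPoints` is connected, being squeezed between a connected set
and its closure, yet meets both pieces. -/
lemma isPreconnected_chartPoints [ConnectedSpace X] : IsPreconnected (chartPoints d X) := by
  intro u w hu hw hsub hAu hAw
  set A := chartPoints d X
  have hcover : Set.univ ⊆ closure (A ∩ u) ∪ closure (A ∩ w) := by
    intro p _
    rw [← closure_union, ← Set.inter_union_distrib_left, Set.inter_eq_left.2 hsub]
    exact dense_chartPoints p
  obtain ⟨p, -, hpu, hpw⟩ := isPreconnected_closed_iff.1 isPreconnected_univ _ _ isClosed_closure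
    isClosed_closure hcover (by simpa using hAu.mono subset_closure)
    (by simpa using hAw.mono subset_closure)
  obtain ⟨N, N', hN, hp, hN', hcl, hconn⟩ := exists_nhds_subset_closure (d := d) p
  have hNA : IsPreconnected (N ∩ A) :=
    hconn.subset_closure hN' (Set.inter_subset_left.trans hcl)
  obtain ⟨q, hqN, hqA, hqu⟩ := mem_closure_iff.1 hpu N hN hp
  obtain ⟨q', hqN', hqA', hqw⟩ := mem_closure_iff.1 hpw N hN hp
  obtain ⟨r, hr, hr'⟩ := hNA u w hu hw (Set.inter_subset_right.trans hsub)
    ⟨q, ⟨hqN, hqA⟩, hqu⟩ ⟨q', ⟨hqN', hqA'⟩, hqw⟩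
  exact ⟨r, hr.2, hr'⟩

variable {g : ContMDiffRiemannianMetric (𝓡∂ d) ∞ (EuclideanSpace ℝ (Fin d))
      (fun p : X => TangentSpace (𝓡∂ d) p)} {V ψ : X → ℝ}
    {B : ∀ p : X, TangentSpace (𝓡∂ d) p →L[ℝ] TangentSpace (𝓡∂ d) p →L[ℝ] ℝ}

/-- The lapse is positive on the domain of every smooth coordinate system: a boundary point there
would be an interior minimum of the lapse, which contradicts non-degeneracy. -/
lemma IsStaticSolution.lapse_pos_of_mem_chartPoints (h : IsStaticSolution g V ψ B) {p : X}
    (hp : p ∈ chartPoints d X) : 0 < V p := by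
  obtain ⟨Φ, hΦ, hpΦ⟩ := hp
  rcases (𝓡∂ d).isInteriorPoint_or_isBoundaryPoint p with hi | hb
  · exact h.lapse_pos p hi
  exfalso
  have hV0 : V p = 0 := h.lapse_boundary p hb
  have hVnonneg : ∀ q, 0 ≤ V q := fun q => by
    rcases (𝓡∂ d).isInteriorPoint_or_isBoundaryPoint q with hi | hb
    · exact (h.lapse_pos q hi).le
    · exact (h.lapse_boundary q hb).ge
  have hmin : IsLocalMin (fun x => V (Φ.symm x)) (Φ p) := Filter.Eventually.of_forall fun x => by
    simp only [Φ.left_inv hpΦ, hV0]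
    exact hVnonneg _
  have hx : Φ p ∈ Φ.target := Φ.map_source hpΦ
  have hd : DifferentiableAt ℝ (fun x => V (Φ.symm x)) (Φ p) :=
    (hΦ.contDiffOn_comp h.smooth_lapse).differentiableAt_of_isOpen Φ.open_target hx
  have hcomp := mfderiv_comp p (I := 𝓡∂ d) (I' := 𝓘(ℝ, EuclideanSpace ℝ (Fin d)))
    (I'' := 𝓘(ℝ, ℝ)) (f := Φ) (g := fun x => V (Φ.symm x)) hd.mdifferentiableAt
    (hΦ.mdifferentiable.mdifferentiableAt hpΦ)
  rw [mfderiv_eq_fderiv, hmin.fderiv_eq_zero] at hcomp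
  have hev : (fun x => V (Φ.symm x)) ∘ Φ =ᶠ[𝓝 p] V := by
    filter_upwards [Φ.open_source.mem_nhds hpΦ] with q hq
    simp [Φ.left_inv hq]
  rw [hev.mfderiv_eq] at hcomp
  exact h.nondegenerate p hb (hcomp.trans (ContinuousLinearMap.zero_comp _))

lemma IsStaticSolution.lapse_eq_zero_of_notMem_chartPoints (h : IsStaticSolution g V ψ B) {p : X}
    (hp : p ∉ chartPoints d X) : V p = 0 := by
  refine h.lapse_boundary p ?_
  rw [← (𝓡∂ d).compl_interior]
  exact fun hi => hp (interior_subset_chartPoints hi)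

end IsManifold

end Manifold

/-! ### Asymptotic expansions -/

section Asymptotics

variable {E : Type*} [NormedAddCommGroup E]

lemma exists_radius_of_eventually_cobounded {P : E → Prop}
    (h : ∀ᶠ x in Bornology.cobounded E, P x) (R : ℝ) : ∃ r > R, ∀ x, r < ‖x‖ → P x := by
  rw [← comap_norm_atTop, Filter.eventually_comap] at h
  obtain ⟨r, hr⟩ := Filter.eventually_atTop.1 h
  exact ⟨max r (R + 1), lt_of_lt_of_le (lt_add_one R) (le_max_right _ _),
    fun x hx => hr ‖x‖ ((le_max_left _ _).trans hx.le) x rfl⟩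

lemma tendsto_inv_norm_pow {n : ℕ} (hn : n ≠ 0) :
    Tendsto (fun x : E => 1 / ‖x‖ ^ n) (Bornology.cobounded E) (𝓝 0) := by
  simp only [one_div]
  exact tendsto_inv_atTop_zero.comp ((tendsto_pow_atTop hn).comp tendsto_norm_cobounded_atTop)

/-- The leading coefficient of an expansion `f = c / ‖x‖ⁿ + O(‖x‖⁻ⁿ⁻¹)`. -/
lemma tendsto_norm_pow_mul_of_isBigO {f : E → ℝ} {c : ℝ} {n : ℕ}
    (h : (fun x => f x - c / ‖x‖ ^ n) =O[Bornology.cobounded E] fun x => 1 / ‖x‖ ^ (n + 1)) :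
    Tendsto (fun x => ‖x‖ ^ n * f x) (Bornology.cobounded E) (𝓝 c) := by
  have hpos : ∀ᶠ x : E in Bornology.cobounded E, 0 < ‖x‖ :=
    tendsto_norm_cobounded_atTop.eventually_gt_atTop 0
  have h1 : (fun x => ‖x‖ ^ n * (f x - c / ‖x‖ ^ n)) =O[Bornology.cobounded E]
      fun x => 1 / ‖x‖ ^ 1 := by
    have := (isBigO_refl (fun x : E => ‖x‖ ^ n) (Bornology.cobounded E)).mul h
    refine this.trans_eventuallyEq ?_
    filter_upwards [hpos] with x hx
    field_simp
    ring
  have h2 := (h1.trans_tendsto (tendsto_inv_norm_pow one_ne_zero)).add_const c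
  rw [zero_add] at h2
  refine h2.congr' ?_
  filter_upwards [hpos] with x hx
  field_simp
  ring

lemma tendsto_zero_of_norm_pow_mul {f : E → ℝ} {c : ℝ} {n : ℕ} (hn : n ≠ 0)
    (h : Tendsto (fun x => ‖x‖ ^ n * f x) (Bornology.cobounded E) (𝓝 c)) :
    Tendsto f (Bornology.cobounded E) (𝓝 0) := by
  have h1 := (tendsto_inv_norm_pow (E := E) hn).mul h
  rw [zero_mul] at h1
  refine h1.congr' ?_
  filter_upwards [tendsto_norm_cobounded_atTop.eventually_gt_atTop (0 : ℝ)] with x hx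
  field_simp

/-- If `G` tends to the identity and `v` to `1` then the coefficients `√det G / v · G⁻¹` stay
bounded. -/
lemma eventually_staticCoeff_le {d : ℕ}
    {G : EuclideanSpace ℝ (Fin d) → Matrix (Fin d) (Fin d) ℝ}
    {v : EuclideanSpace ℝ (Fin d) → ℝ} {l : Filter (EuclideanSpace ℝ (Fin d))}
    (hG : ∀ i j, Tendsto (fun x => G x i j) l (𝓝 ((1 : Matrix (Fin d) (Fin d) ℝ) i j)))
    (hv : Tendsto v l (𝓝 1)) : ∀ᶠ x in l, ∀ i j, |staticCoeff G v x i j| ≤ 2 := by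
  have hGm : Tendsto G l (𝓝 1) := tendsto_pi_nhds.2 fun i => tendsto_pi_nhds.2 fun j => hG i j
  have hdet : Tendsto (fun x => (G x).det) l (𝓝 1) := by
    have := ((continuous_id.matrix_det (A := (id : Matrix (Fin d) (Fin d) ℝ → _))).tendsto 1).comp
      hGm
    simpa using! this
  have hadj : Tendsto (fun x => (G x).adjugate) l (𝓝 1) := by
    have := ((continuous_id.matrix_adjugate (A := (id : Matrix (Fin d) (Fin d) ℝ → _))).tendsto
      1).comp hGm
    simpa using! this
  rw [Filter.eventually_all]
  intro i
  rw [Filter.eventually_all]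
  intro j
  have hadj' : Tendsto (fun x => (G x).adjugate i j) l
      (𝓝 ((1 : Matrix (Fin d) (Fin d) ℝ) i j)) :=
    tendsto_pi_nhds.1 (tendsto_pi_nhds.1 hadj i) j
  have h1 : Tendsto (fun x => staticCoeff G v x i j) l
      (𝓝 (√1 / 1 * ((1 : ℝ)⁻¹ * (1 : Matrix (Fin d) (Fin d) ℝ) i j))) := by
    have := (hdet.sqrt.div hv one_ne_zero).mul ((hdet.inv₀ one_ne_zero).mul hadj')
    refine this.congr fun x => ?_
    simp [staticCoeff, Matrix.inv_def, Ring.inverse_eq_inv']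
  have h2 := h1.abs
  have h3 : |√1 / 1 * ((1 : ℝ)⁻¹ * (1 : Matrix (Fin d) (Fin d) ℝ) i j)| < 2 := by
    rw [Matrix.one_apply]
    split_ifs <;> simp
  exact (h2.eventually (gt_mem_nhds h3)).mono fun x hx => le_of_lt hx

end Asymptotics

/-! ### The mass-charge inequality -/

/-- The level set is closed by continuity and relatively open in `A` by `hloc`; connectedness does
the rest. -/
lemma forall_eq_of_isPreconnected {X : Type*} [TopologicalSpace X] {A : Set X}
    (hA : IsPreconnected A) {f : X → ℝ} (hf : Continuous f) {c : ℝ}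
    (hloc : ∀ p ∈ A, f p = c → ∀ᶠ q in 𝓝 p, q ∈ A → f q = c) {p₀ : X} (hp₀ : p₀ ∈ A)
    (h₀ : f p₀ = c) : ∀ p ∈ A, f p = c := by
  by_contra! hne
  obtain ⟨p, hp, hpc⟩ := hne
  obtain ⟨q, hqA, hq1, hq2⟩ := hA {q | ∀ᶠ r in 𝓝 q, r ∈ A → f r = c} {q | f q ≠ c}
    isOpen_setOfPred_eventually_nhds (isOpen_ne_fun hf continuous_const)
    (fun q hq => or_iff_not_imp_right.2 fun h => hloc q hq (not_not.1 h))
    ⟨p₀, hp₀, hloc p₀ hp₀ h₀⟩ ⟨p, hp, hpc⟩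
  exact hq2 (hq1.self_of_nhds hqA)

section Global

variable {d : ℕ} [NeZero d] {X : Type*} [TopologicalSpace X]
  [ChartedSpace (EuclideanHalfSpace d) X] [IsManifold (𝓡∂ d) ∞ X]
  {g : ContMDiffRiemannianMetric (𝓡∂ d) ∞ (EuclideanSpace ℝ (Fin d))
      (fun p : X => TangentSpace (𝓡∂ d) p)} {V ψ : X → ℝ}
  {B : ∀ p : X, TangentSpace (𝓡∂ d) p →L[ℝ] TangentSpace (𝓡∂ d) p →L[ℝ] ℝ} {M Q κ : ℝ}

lemma couplingC_pos (hd : 3 ≤ d) : 0 < couplingC d := by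
  have : (3 : ℝ) ≤ d := by exact_mod_cast hd
  exact Real.sqrt_pos.2 (div_pos (by linarith) (by linarith))

lemma couplingC_sq (hd : 3 ≤ d) : couplingC d ^ 2 = 2 * ((d : ℝ) - 2) / ((d : ℝ) - 1) := by
  have : (3 : ℝ) ≤ d := by exact_mod_cast hd
  exact Real.sq_sqrt (div_nonneg (by linarith) (by linarith))

/-- The function `V² - (1 - κ ψ)²`. -/
def deficit (V ψ : X → ℝ) (κ : ℝ) (p : X) : ℝ := V p ^ 2 - (1 - κ * ψ p) ^ 2

lemma IsStaticSolution.continuous_deficit (h : IsStaticSolution g V ψ B) (κ : ℝ) :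
    Continuous (deficit V ψ κ) :=
  (h.smooth_lapse.continuous.pow 2).sub
    ((continuous_const.sub (continuous_const.mul h.smooth_potential.continuous)).pow 2)

section Chart

variable {Φ : OpenPartialHomeomorph X (EuclideanSpace ℝ (Fin d))}

lemma IsStaticSolution.lapse_symm_pos (h : IsStaticSolution g V ψ B) (hΦ : IsSmoothChart Φ)
    {x : EuclideanSpace ℝ (Fin d)} (hx : x ∈ Φ.target) : 0 < V (Φ.symm x) :=
  h.lapse_pos_of_mem_chartPoints ⟨Φ, hΦ, Φ.map_target hx⟩

lemma IsStaticSolution.contDiffOn_deficit (h : IsStaticSolution g V ψ B) (hΦ : IsSmoothChart Φ)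
    (κ : ℝ) : ContDiffOn ℝ ∞ (fun x => deficit V ψ κ (Φ.symm x)) Φ.target :=
  ((hΦ.contDiffOn_comp h.smooth_lapse).pow 2).sub
    ((contDiffOn_const.sub (contDiffOn_const.mul (hΦ.contDiffOn_comp h.smooth_potential))).pow 2)

lemma IsStaticSolution.contDiffOn_coeff (h : IsStaticSolution g V ψ B) (hΦ : IsSmoothChart Φ)
    (i j : Fin d) : ContDiffOn ℝ ∞
      (fun x => staticCoeff (components g.inner Φ) (fun y => V (Φ.symm y)) x i j) Φ.target :=
  contDiffOn_staticCoeff (fun i j => contDiffOn_components hΦ g.contMDiff i j)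
    (fun _ hx => posDef_components g hΦ hx) (hΦ.contDiffOn_comp h.smooth_lapse)
    (fun _ hx => h.lapse_symm_pos hΦ hx) i j

lemma IsStaticSolution.posDef_coeff (h : IsStaticSolution g V ψ B) (hΦ : IsSmoothChart Φ)
    {x : EuclideanSpace ℝ (Fin d)} (hx : x ∈ Φ.target) :
    (staticCoeff (components g.inner Φ) (fun y => V (Φ.symm y)) x).PosDef :=
  posDef_staticCoeff (posDef_components g hΦ hx) (h.lapse_symm_pos hΦ hx)

lemma IsStaticSolution.divForm_deficit (h : IsStaticSolution g V ψ B) (hd : 3 ≤ d)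
    (hκ : κ ^ 2 = couplingC d ^ 2) (hΦ : IsSmoothChart Φ)
    {x : EuclideanSpace ℝ (Fin d)} (hx : x ∈ Φ.target) :
    divForm (staticCoeff (components g.inner Φ) fun y => V (Φ.symm y))
      (fun y => deficit V ψ κ (Φ.symm y)) x
      = 2 * (√(components g.inner Φ x).det / V (Φ.symm x) *
        (V (Φ.symm x) ^ 2 * normSq (components g.inner Φ) (components B Φ) x / ((d : ℝ) - 1))) :=
  divForm_sq_sub_sq hd Φ.open_target (fun i j => contDiffOn_components hΦ g.contMDiff i j)
    (fun i j y => components_symm g i j y)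
    (fun _ hx => posDef_components g hΦ hx) (hΦ.contDiffOn_comp h.smooth_lapse)
    (fun _ hx => h.lapse_symm_pos hΦ hx) (hΦ.contDiffOn_comp h.smooth_potential)
    (fun z hz => h.field_equations Φ hΦ z hz) (hκ.trans (couplingC_sq hd)) hx

lemma IsStaticSolution.divForm_deficit_nonneg (h : IsStaticSolution g V ψ B) (hd : 3 ≤ d)
    (hκ : κ ^ 2 = couplingC d ^ 2) (hΦ : IsSmoothChart Φ)
    {x : EuclideanSpace ℝ (Fin d)} (hx : x ∈ Φ.target) :
    0 ≤ divForm (staticCoeff (components g.inner Φ) fun y => V (Φ.symm y))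
      (fun y => deficit V ψ κ (Φ.symm y)) x := by
  rw [h.divForm_deficit hd hκ hΦ hx]
  have h1 := h.lapse_symm_pos hΦ hx
  have h2 := (normSq_nonneg_and_eq_zero (b := components B Φ) (posDef_components g hΦ hx)).1
  have h3 : (3 : ℝ) ≤ d := by exact_mod_cast hd
  have h4 : 0 < (d : ℝ) - 1 := by linarith
  positivity

end Chart

/-- The strong maximum principle for `V² - (1 - κ ψ)²`. -/
lemma IsStaticSolution.eventually_deficit_eq (h : IsStaticSolution g V ψ B) (hd : 3 ≤ d)
    (hκ : κ ^ 2 = couplingC d ^ 2) {m : ℝ} (hm : ∀ q, deficit V ψ κ q ≤ m) {p : X}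
    (hp : p ∈ chartPoints d X) (hpm : deficit V ψ κ p = m) :
    ∀ᶠ q in 𝓝 p, deficit V ψ κ q = m := by
  obtain ⟨Φ, hΦ, hpΦ⟩ := hp
  have h1 := eventually_eq_of_subsolution Φ.open_target (h.contDiffOn_coeff hΦ)
    (fun _ hx => h.posDef_coeff hΦ hx) (h.contDiffOn_deficit hΦ κ)
    (fun _ hx => h.divForm_deficit_nonneg hd hκ hΦ hx) (fun _ _ => hm _) (Φ.map_source hpΦ)
    (by rw [Φ.left_inv hpΦ, hpm])
  filter_upwards [(Φ.continuousAt hpΦ).eventually h1, Φ.open_source.mem_nhds hpΦ] with q hq hqΦ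
  rwa [Φ.left_inv hqΦ] at hq

/-- The lapse vanishes there and the remaining term is minus a square, so the sign holds whatever
the boundary value of ψ. -/
lemma IsStaticSolution.deficit_nonpos_of_notMem (h : IsStaticSolution g V ψ B) {p : X}
    (hp : p ∉ chartPoints d X) : deficit V ψ κ p ≤ 0 := by
  rw [deficit, h.lapse_eq_zero_of_notMem_chartPoints hp]
  have := sq_nonneg (1 - κ * ψ p)
  linarith

/-- The maximum principle: if `V² - (1 - κ ψ)²` tends to `0` at infinity then it is nonpositive. -/
lemma IsStaticSolution.deficit_nonpos [PreconnectedSpace X] (h : IsStaticSolution g V ψ B)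
    (hd : 3 ≤ d) (hκ : κ ^ 2 = couplingC d ^ 2)
    (hlim : ∀ ε > 0, ∃ K : Set X, IsCompact K ∧ Kᶜ.Nonempty ∧ ∀ p ∉ K, deficit V ψ κ p < ε)
    (p : X) : deficit V ψ κ p ≤ 0 := by
  by_contra! hp
  obtain ⟨K, hK, ⟨q₀, hq₀⟩, hKlt⟩ := hlim _ hp
  have hpK : p ∈ K := by
    by_contra hpK
    exact lt_irrefl _ (hKlt p hpK)
  have hcont := h.continuous_deficit κ
  obtain ⟨q, hqK, hq⟩ := hK.exists_isMaxOn ⟨p, hpK⟩ hcont.continuousOn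
  have hpq : deficit V ψ κ p ≤ deficit V ψ κ q := hq hpK
  have hmax : ∀ r, deficit V ψ κ r ≤ deficit V ψ κ q := fun r => by
    by_cases hr : r ∈ K
    · exact hq hr
    · exact (hKlt r hr).le.trans hpq
  -- A point of this positive level set is not a boundary point, so the strong maximum principle
  -- applies around it. The level set is then the whole space, against the smallness of the function
  -- outside `K`.
  have hclopen : IsClopen {r | deficit V ψ κ r = deficit V ψ κ q} := by
    refine ⟨isClosed_eq hcont continuous_const, isOpen_iff_mem_nhds.2 fun r hr => ?_⟩
    have hrA : r ∈ chartPoints d X := by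
      by_contra hrA
      have h1 := h.deficit_nonpos_of_notMem (κ := κ) hrA
      have h2 : deficit V ψ κ r = deficit V ψ κ q := hr
      linarith
    exact h.eventually_deficit_eq hd hκ hmax hrA hr
  have huniv := hclopen.eq_univ ⟨q, rfl⟩
  have h1 : deficit V ψ κ q₀ = deficit V ψ κ q := by
    have : q₀ ∈ {r | deficit V ψ κ r = deficit V ψ κ q} := huniv ▸ Set.mem_univ q₀
    exact this
  have h2 := hKlt q₀ hq₀
  linarith

/-- If `V² - (1 - κ ψ)²` vanishes identically in the interior then so does the magnetic field. -/
lemma IsStaticSolution.magnetic_eq_zero_of_deficit (h : IsStaticSolution g V ψ B) (hd : 3 ≤ d)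
    (hκ : κ ^ 2 = couplingC d ^ 2) (h0 : ∀ p ∈ chartPoints d X, deficit V ψ κ p = 0) {p : X}
    (hp : p ∈ chartPoints d X) : B p = 0 := by
  obtain ⟨Φ, hΦ, hpΦ⟩ := hp
  have hx := Φ.map_source hpΦ
  have h1 := h.divForm_deficit (κ := κ) hd hκ hΦ hx
  have h2 : divForm (staticCoeff (components g.inner Φ) fun y => V (Φ.symm y))
      (fun y => deficit V ψ κ (Φ.symm y)) (Φ p) = 0 := by
    rw [divForm_congr (v := fun _ => 0)]
    · have hflux : ∀ i, flux (staticCoeff (components g.inner Φ) fun y => V (Φ.symm y))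
          (fun _ => (0 : ℝ)) i = fun _ => 0 := fun i => by
        funext y
        simp [flux, partialDeriv]
      simp only [divForm, hflux]
      simp [partialDeriv]
    · filter_upwards [Φ.open_target.mem_nhds hx] with y hy using
        h0 _ ⟨Φ, hΦ, Φ.map_target hy⟩
  rw [h2] at h1
  have hVx := h.lapse_symm_pos hΦ hx
  have hdet := Real.sqrt_pos.2 (posDef_components g hΦ hx).det_pos
  have h3 : (3 : ℝ) ≤ d := by exact_mod_cast hd
  have h4 : (d : ℝ) - 1 ≠ 0 := by linarith
  -- All factors multiplying |B|² in the identity for Lf are nonzero, so Lf = 0 gives |B|² = 0.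
  have h5 : normSq (components g.inner Φ) (components B Φ) (Φ p) = 0 := by
    have h6 := h1.symm
    simpa [hVx.ne', hdet.ne', h4] using h6
  exact eq_zero_of_components_eq_zero hΦ hpΦ
    ((normSq_nonneg_and_eq_zero (posDef_components g hΦ hx)).2 h5)

/-- A continuous tensor field that vanishes on a dense set vanishes. -/
lemma IsStaticSolution.magnetic_eq_zero_of_dense (h : IsStaticSolution g V ψ B) {A : Set X}
    (hA : Dense A) (h0 : ∀ p ∈ A, B p = 0) (p : X) : B p = 0 := by
  -- A local trivialization extends each pair of tangent vectors at `p` to continuous local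
  -- sections. Evaluating B on these is continuous and zero on a dense set.
  let e := trivializationAt (EuclideanSpace ℝ (Fin d)) (fun p : X => TangentSpace (𝓡∂ d) p) p
  have hpe : p ∈ e.baseSet := FiberBundle.mem_baseSet_trivializationAt' p
  have hsec : ∀ v : EuclideanSpace ℝ (Fin d), ContinuousAt (fun q : X =>
      TotalSpace.mk' (EuclideanSpace ℝ (Fin d)) (E := fun p : X => TangentSpace (𝓡∂ d) p) q
        (e.symm q v)) p := fun v => by
    have h1 := e.continuousOn_symm.comp (f := fun q : X => (q, v)) (s := e.baseSet)
      (by fun_prop) (fun q hq => ⟨hq, Set.mem_univ _⟩)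
    exact h1.continuousAt (e.open_baseSet.mem_nhds hpe)
  have hzero : ∀ v w : EuclideanSpace ℝ (Fin d), B p (e.symm p v) (e.symm p w) = 0 := by
    intro v w
    have h1 : ContinuousAt (fun q => TotalSpace.mk' ℝ (E := Bundle.Trivial X ℝ) q
        (B q (e.symm q v) (e.symm q w))) p :=
      ContinuousAt.clm_bundle_apply₂ (F₁ := EuclideanSpace ℝ (Fin d))
        (F₂ := EuclideanSpace ℝ (Fin d)) (E₁ := fun p : X => TangentSpace (𝓡∂ d) p)
        (E₂ := fun p : X => TangentSpace (𝓡∂ d) p)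
        h.smooth_magnetic.continuous.continuousAt (hsec v) (hsec w)
    have h2 : ContinuousAt (fun q => B q (e.symm q v) (e.symm q w)) p :=
      ((FiberBundle.continuousAt_totalSpace ℝ _).1 h1).2
    by_contra hne
    refine mem_closure_iff_frequently.1 (hA p) ((h2.eventually_ne hne).mono fun q hq hqA => hq ?_)
    simp [h0 q hqA]
  ext v w
  have hv := e.symm_proj_apply ⟨p, v⟩ hpe
  have hw := e.symm_proj_apply ⟨p, w⟩ hpe
  have h3 := hzero (e ⟨p, v⟩).2 (e ⟨p, w⟩).2
  rw [hv, hw] at h3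
  exact h3

end Global

/-! ### Asymptotically flat solutions: the inequality and its equality case. -/

section Flat

variable {d : ℕ} [NeZero d] {X : Type*} [TopologicalSpace X]
  [ChartedSpace (EuclideanHalfSpace d) X] [IsManifold (𝓡∂ d) ∞ X]
  {g : ContMDiffRiemannianMetric (𝓡∂ d) ∞ (EuclideanSpace ℝ (Fin d))
      (fun p : X => TangentSpace (𝓡∂ d) p)} {V ψ : X → ℝ}
  {B : ∀ p : X, TangentSpace (𝓡∂ d) p →L[ℝ] TangentSpace (𝓡∂ d) p →L[ℝ] ℝ} {M Q κ : ℝ}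

/-- The consequences of asymptotic flatness that are used: the leading coefficients of `V` and
`ψ`, and the boundedness of the coefficients of the elliptic operator. -/
lemma IsAsymptoticallyFlat.exists_chart (h : IsAsymptoticallyFlat g V ψ M Q) (hd : 3 ≤ d) :
    ∃ (Φ : OpenPartialHomeomorph X (EuclideanSpace ℝ (Fin d))) (R : ℝ),
      IsSmoothChart Φ ∧ Φ.target = {x | R < ‖x‖} ∧
      (∀ r > R, IsCompact (Φ.source ∩ Φ ⁻¹' {x | r < ‖x‖})ᶜ) ∧
      Tendsto (fun x => ‖x‖ ^ (d - 2) * (V (Φ.symm x) - 1)) (Bornology.cobounded _) (𝓝 (-M)) ∧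
      Tendsto (fun x => ‖x‖ ^ (d - 2) * ψ (Φ.symm x)) (Bornology.cobounded _)
        (𝓝 (Q / couplingC d)) ∧
      ∀ᶠ x in Bornology.cobounded _, ∀ i j,
        |staticCoeff (components g.inner Φ) (fun y => V (Φ.symm y)) x i j| ≤ 2 := by
  obtain ⟨Φ, R, -, hΦ, htarget, hcompact, hg, hV, hψ⟩ := h
  have hd1 : d - 1 = (d - 2) + 1 := by omega
  have hd2 : d - 2 ≠ 0 := by omega
  have hC := couplingC_pos hd
  have hV' : Tendsto (fun x => ‖x‖ ^ (d - 2) * (V (Φ.symm x) - 1)) (Bornology.cobounded _)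
      (𝓝 (-M)) := by
    refine tendsto_norm_pow_mul_of_isBigO ?_
    rw [← hd1]
    exact hV.congr_left fun x => by ring
  have hV1 : Tendsto (fun x => V (Φ.symm x)) (Bornology.cobounded _) (𝓝 1) := by
    simpa using (tendsto_zero_of_norm_pow_mul hd2 hV').add_const 1
  refine ⟨Φ, R, hΦ, htarget, hcompact, hV', ?_, eventually_staticCoeff_le (fun i j => ?_) hV1⟩
  · refine tendsto_norm_pow_mul_of_isBigO ?_
    rw [← hd1]
    exact hψ.congr_left fun x => by rw [div_div]
  · have h1 := (hg i j).trans_tendsto (tendsto_inv_norm_pow (by omega))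
    have h2 : Tendsto (fun x : EuclideanSpace ℝ (Fin d) =>
        (1 + 2 * M / ((d : ℝ) - 2) * (1 / ‖x‖ ^ (d - 2))) * (1 : Matrix (Fin d) (Fin d) ℝ) i j)
        (Bornology.cobounded _)
        (𝓝 ((1 + 2 * M / ((d : ℝ) - 2) * 0) * (1 : Matrix (Fin d) (Fin d) ℝ) i j)) :=
      (((tendsto_inv_norm_pow hd2).const_mul _).const_add 1).mul_const _
    simpa using h1.add h2

/-- Write v² - (1 - κw)² = (v - 1)((v - 1) + 2) + κw(2 - κw). In each product one factor has the
prescribed leading coefficient and the other tends to 2. -/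
lemma tendsto_norm_pow_mul_sq_sub_sq {E : Type*} [NormedAddCommGroup E] {n : ℕ} (hn : n ≠ 0)
    {v w : E → ℝ} {a b : ℝ}
    (hv : Tendsto (fun x => ‖x‖ ^ n * (v x - 1)) (Bornology.cobounded E) (𝓝 a))
    (hw : Tendsto (fun x => ‖x‖ ^ n * w x) (Bornology.cobounded E) (𝓝 b)) (κ : ℝ) :
    Tendsto (fun x => ‖x‖ ^ n * (v x ^ 2 - (1 - κ * w x) ^ 2)) (Bornology.cobounded E)
      (𝓝 (2 * (a + κ * b))) := by
  have hv0 := tendsto_zero_of_norm_pow_mul hn hv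
  have hw0 := tendsto_zero_of_norm_pow_mul hn hw
  have h1 := (hv.mul (hv0.add_const 2)).add ((hw.const_mul κ).mul ((hw0.const_mul κ).const_sub 2))
  have h2 : 2 * (a + κ * b) = a * (0 + 2) + κ * b * (2 - κ * 0) := by ring
  rw [h2]
  exact h1.congr fun x => by ring

section

variable {Φ : OpenPartialHomeomorph X (EuclideanSpace ℝ (Fin d))} {R : ℝ} [PreconnectedSpace X]

lemma IsStaticSolution.deficit_nonpos_of_tendsto (h : IsStaticSolution g V ψ B) (hd : 3 ≤ d)
    (hκ : κ ^ 2 = couplingC d ^ 2) (htarget : Φ.target = {x | R < ‖x‖})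
    (hcompact : ∀ r > R, IsCompact (Φ.source ∩ Φ ⁻¹' {x | r < ‖x‖})ᶜ)
    (hlim : Tendsto (fun x => deficit V ψ κ (Φ.symm x)) (Bornology.cobounded _) (𝓝 0)) (p : X) :
    deficit V ψ κ p ≤ 0 := by
  have : Nontrivial (EuclideanSpace ℝ (Fin d)) := by
    have : Nonempty (Fin d) := ⟨⟨0, by omega⟩⟩
    infer_instance
  refine h.deficit_nonpos hd hκ (fun ε hε => ?_) p
  obtain ⟨r, hrR, hr⟩ := exists_radius_of_eventually_cobounded (hlim.eventually_lt_const hε) R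
  refine ⟨_, hcompact r hrR, ?_, fun q hq => ?_⟩
  · rw [compl_compl]
    obtain ⟨x, hx⟩ := NormedSpace.exists_lt_norm ℝ (EuclideanSpace ℝ (Fin d)) r
    have hxt : x ∈ Φ.target := htarget ▸ hrR.trans hx
    exact ⟨Φ.symm x, Φ.map_target hxt, by simpa [Φ.right_inv hxt] using hx⟩
  · rw [Set.notMem_compl_iff] at hq
    have h1 := hr (Φ q) hq.2
    rwa [Φ.left_inv hq.1] at h1

/-- The Hopf lemma at infinity: `V² - (1 - κ ψ)²` vanishes at a point of the end if its leading
coefficient vanishes. -/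
lemma IsStaticSolution.exists_deficit_eq_zero (h : IsStaticSolution g V ψ B) (hd : 3 ≤ d)
    (hκ : κ ^ 2 = couplingC d ^ 2) (hΦ : IsSmoothChart Φ) (htarget : {x | R < ‖x‖} ⊆ Φ.target)
    (hle : ∀ p, deficit V ψ κ p ≤ 0)
    (hlim : Tendsto (fun x => ‖x‖ ^ (d - 2) * deficit V ψ κ (Φ.symm x)) (Bornology.cobounded _)
      (𝓝 0))
    (hbdd : ∀ x, R < ‖x‖ → ∀ i j,
      |staticCoeff (components g.inner Φ) (fun y => V (Φ.symm y)) x i j| ≤ 2) :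
    ∃ x, R < ‖x‖ ∧ deficit V ψ κ (Φ.symm x) = 0 := by
  by_contra! hne
  have : Nonempty (Fin d) := ⟨⟨0, by omega⟩⟩
  have hsm := h.contDiffOn_deficit hΦ κ
  have hcoeff := h.contDiffOn_coeff hΦ
  have hmem : ∀ x, R < ‖x‖ → x ∈ Φ.target := fun x hx => htarget hx
  refine false_of_fast_decay (R := R)
    (a := staticCoeff (components g.inner Φ) fun y => V (Φ.symm y))
    -- If the deficit has no zero in the end, its negative is a positive supersolution there,
    -- decaying faster than r^{2-d} by `hlim`.
    (u := fun x => -1 * deficit V ψ κ (Φ.symm x)) (Λ := 2) (by simp; omega)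
    (fun i j => (hcoeff i j).mono htarget) (fun x hx => h.posDef_coeff hΦ (hmem x hx)) (by norm_num)
    hbdd ((contDiffOn_const.mul hsm).mono htarget) (fun x hx => ?_) (fun x hx => ?_)
    (fun ε hε => ?_)
  · have := (hle (Φ.symm x)).lt_of_ne (hne x hx)
    linarith
  · rw [divForm_const_mul Φ.open_target hcoeff hsm (-1) (hmem x hx)]
    have := h.divForm_deficit_nonneg hd hκ hΦ (hmem x hx)
    linarith
  · have h1 := hlim.neg
    rw [neg_zero] at h1
    obtain ⟨r, -, hr⟩ :=
      exists_radius_of_eventually_cobounded (h1.eventually_lt_const hε) 0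
    refine ⟨r + 1, fun x hx => ?_⟩
    have h2 := hr x (by linarith)
    rw [Fintype.card_fin]
    linarith

end

variable [ConnectedSpace X]

/-- The mass-charge inequality, for both signs `κ = ± C`. -/
lemma IsStaticSolution.charge_le_mass (h : IsStaticSolution g V ψ B)
    (haf : IsAsymptoticallyFlat g V ψ M Q) (hd : 3 ≤ d) (hκ : κ ^ 2 = couplingC d ^ 2) :
    κ * (Q / couplingC d) ≤ M := by
  have : Nontrivial (EuclideanSpace ℝ (Fin d)) := by
    have : Nonempty (Fin d) := ⟨⟨0, by omega⟩⟩
    infer_instance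
  have hd2 : d - 2 ≠ 0 := by omega
  obtain ⟨Φ, R, hΦ, htarget, hcompact, hV, hψ, -⟩ := haf.exists_chart hd
  have hlim := tendsto_norm_pow_mul_sq_sub_sq hd2 hV hψ κ
  have hle := h.deficit_nonpos_of_tendsto hd hκ htarget hcompact
    (tendsto_zero_of_norm_pow_mul hd2 hlim)
  have := le_of_tendsto' hlim fun x =>
    mul_nonpos_of_nonneg_of_nonpos (by positivity) (hle (Φ.symm x))
  linarith

/-- The rigidity case of the mass-charge inequality. -/
lemma IsStaticSolution.eq_of_charge_eq_mass (h : IsStaticSolution g V ψ B)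
    (haf : IsAsymptoticallyFlat g V ψ M Q) (hd : 3 ≤ d) (hκ : κ ^ 2 = couplingC d ^ 2)
    (hM : κ * (Q / couplingC d) = M) : (∀ p, B p = 0) ∧ ∀ p, κ * ψ p = 1 - V p := by
  have : Nontrivial (EuclideanSpace ℝ (Fin d)) := by
    have : Nonempty (Fin d) := ⟨⟨0, by omega⟩⟩
    infer_instance
  have hd2 : d - 2 ≠ 0 := by omega
  obtain ⟨Φ, R, hΦ, htarget, hcompact, hV, hψ, hbdd⟩ := haf.exists_chart hd
  have hlim := tendsto_norm_pow_mul_sq_sub_sq hd2 hV hψ κ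
  -- Equality of mass and charge is exactly the vanishing of the leading coefficient 2(-M + κQ/C).
  rw [hM, neg_add_cancel, mul_zero] at hlim
  have hle := h.deficit_nonpos_of_tendsto hd hκ htarget hcompact
    (tendsto_zero_of_norm_pow_mul hd2 hlim)
  have hA : IsPreconnected (chartPoints d X) := isPreconnected_chartPoints
  have hmem : ∀ x, R < ‖x‖ → Φ.symm x ∈ chartPoints d X := fun x hx =>
    ⟨Φ, hΦ, Φ.map_target (htarget ▸ hx)⟩
  obtain ⟨r, hrR, hr⟩ := exists_radius_of_eventually_cobounded hbdd R
  obtain ⟨x₀, hx₀, hx₀'⟩ := h.exists_deficit_eq_zero hd hκ hΦ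
    (fun x hx => by rw [htarget]; exact hrR.trans hx) hle hlim hr
  have hzero : ∀ p ∈ chartPoints d X, deficit V ψ κ p = 0 :=
    forall_eq_of_isPreconnected hA (h.continuous_deficit κ)
      (fun p hp hp0 => (h.eventually_deficit_eq hd hκ hle hp hp0).mono fun q hq _ => hq)
      (hmem x₀ (hrR.trans hx₀)) hx₀'
  refine ⟨h.magnetic_eq_zero_of_dense dense_chartPoints fun p hp =>
    h.magnetic_eq_zero_of_deficit hd hκ hzero hp, ?_⟩
  have hVc := h.smooth_lapse.continuous
  have hψc : Continuous fun p => 1 - κ * ψ p :=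
    continuous_const.sub (continuous_const.mul h.smooth_potential.continuous)
  -- V² = (1 - κψ)² factors into two alternatives; V > 0 and 1 - κψ > 0 exclude 1 - κψ = -V.
  have hfactor : ∀ p ∈ chartPoints d X, 0 < 1 - κ * ψ p → 1 - κ * ψ p - V p = 0 := by
    intro p hp hpos
    have h1 := hzero p hp
    have h2 := h.lapse_pos_of_mem_chartPoints hp
    have h3 : (1 - κ * ψ p - V p) * (1 - κ * ψ p + V p) = 0 := by
      rw [deficit] at h1
      linarith
    exact (mul_eq_zero.1 h3).resolve_right (by positivity)
  have hψ1 : Tendsto (fun x => 1 - κ * ψ (Φ.symm x)) (Bornology.cobounded _) (𝓝 1) := by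
    simpa using ((tendsto_zero_of_norm_pow_mul hd2 hψ).const_mul κ).const_sub 1
  obtain ⟨r₁, hr₁R, hr₁⟩ :=
    exists_radius_of_eventually_cobounded (hψ1.eventually_const_lt one_pos) R
  obtain ⟨x₁, hx₁⟩ := NormedSpace.exists_lt_norm ℝ (EuclideanSpace ℝ (Fin d)) r₁
  have hx₁A := hmem x₁ (hr₁R.trans hx₁)
  -- The positive branch propagates: where 1 - κψ = V it is positive, remains so nearby, and
  -- `hfactor` applies again. The starting point lies far out, where 1 - κψ is near 1.
  have hsub : ∀ p ∈ chartPoints d X, 1 - κ * ψ p - V p = 0 := by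
    refine forall_eq_of_isPreconnected hA (hψc.sub hVc) (fun p hp hp0 => ?_) hx₁A
      (hfactor _ hx₁A (hr₁ x₁ hx₁))
    have h1 : 0 < 1 - κ * ψ p := by
      have hp1 : 1 - κ * ψ p = V p := sub_eq_zero.1 hp0
      rw [hp1]
      exact h.lapse_pos_of_mem_chartPoints hp
    filter_upwards [hψc.continuousAt.eventually_const_lt h1] with q hq hqA
    exact hfactor q hqA hq
  intro p
  have h1 : Set.EqOn (fun p => 1 - κ * ψ p) V (closure (chartPoints d X)) :=
    Set.EqOn.closure (fun p hp => sub_eq_zero.1 (hsub p hp)) hψc hVc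
  have h2 : 1 - κ * ψ p = V p := h1 (dense_chartPoints p)
  linarith

/-- If `κ ψ = 1 - V` then the mass is the charge, up to the sign of `κ`. -/
lemma IsAsymptoticallyFlat.charge_eq_mass (haf : IsAsymptoticallyFlat g V ψ M Q) (hd : 3 ≤ d)
    (hV : ∀ p, κ * ψ p = 1 - V p) : κ * (Q / couplingC d) = M := by
  have : Nontrivial (EuclideanSpace ℝ (Fin d)) := by
    have : Nonempty (Fin d) := ⟨⟨0, by omega⟩⟩
    infer_instance
  obtain ⟨Φ, R, -, -, -, hVlim, hψlim, -⟩ := haf.exists_chart hd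
  refine tendsto_nhds_unique (hψlim.const_mul κ) ?_
  have h1 := hVlim.neg
  rw [neg_neg] at h1
  refine h1.congr fun x => ?_
  linear_combination -‖x‖ ^ (d - 2) * hV (Φ.symm x)

end Flat

end StaticEM

end

/-! ### The theorem, from the two signs of the coupling constant. -/

theorem lemma1 {d : ℕ} [NeZero d] (hd : 3 ≤ d)
    {X : Type*} [TopologicalSpace X] [T2Space X] [SecondCountableTopology X] [ConnectedSpace X]
    [ChartedSpace (EuclideanHalfSpace d) X] [IsManifold (𝓡∂ d) ∞ X]
    (g : ContMDiffRiemannianMetric (𝓡∂ d) ∞ (EuclideanSpace ℝ (Fin d))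
      (fun p : X => TangentSpace (𝓡∂ d) p))
    (V ψ : X → ℝ)
    (B : ∀ p : X, TangentSpace (𝓡∂ d) p →L[ℝ] TangentSpace (𝓡∂ d) p →L[ℝ] ℝ)
    (M Q : ℝ)
    (hsol : StaticEM.IsStaticSolution g V ψ B)
    (haf : StaticEM.IsAsymptoticallyFlat g V ψ M Q) :
    M ≥ |Q| ∧
      (M = |Q| ↔ (∀ p : X, B p = 0) ∧
        ((∀ p : X, StaticEM.couplingC d * ψ p = 1 - V p) ∨
          (∀ p : X, -(StaticEM.couplingC d * ψ p) = 1 - V p))) := by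
  have hC := StaticEM.couplingC_pos hd
  have hpos : StaticEM.couplingC d * (Q / StaticEM.couplingC d) = Q := mul_div_cancel₀ Q hC.ne'
  have hneg : -StaticEM.couplingC d * (Q / StaticEM.couplingC d) = -Q := by
    rw [neg_mul, hpos]
  have hle1 := hsol.charge_le_mass haf hd (κ := StaticEM.couplingC d) rfl
  have hle2 := hsol.charge_le_mass haf hd (κ := -StaticEM.couplingC d) (neg_sq _)
  rw [hpos] at hle1
  rw [hneg] at hle2
  have hle : |Q| ≤ M := abs_le'.2 ⟨hle1, hle2⟩
  refine ⟨hle, fun hM => ?_, ?_⟩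
  -- The sign of Q selects the κ = ±C for which κQ/C = |Q| = M, and with it the alternative for ψ.
  · rcases abs_choice Q with hQ | hQ
    · obtain ⟨h1, h2⟩ := hsol.eq_of_charge_eq_mass haf hd (κ := StaticEM.couplingC d) rfl
        (by rw [hpos, hM, hQ])
      exact ⟨h1, Or.inl h2⟩
    · obtain ⟨h1, h2⟩ := hsol.eq_of_charge_eq_mass haf hd (κ := -StaticEM.couplingC d) (neg_sq _)
        (by rw [hneg, hM, hQ])
      exact ⟨h1, Or.inr fun p => by rw [← h2 p, neg_mul]⟩
  · rintro ⟨-, h | h⟩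
    · have h1 := haf.charge_eq_mass hd h
      rw [hpos] at h1
      exact le_antisymm (h1 ▸ le_abs_self Q) hle
    · have h1 := haf.charge_eq_mass (κ := -StaticEM.couplingC d) hd fun p => by
        rw [neg_mul, h p]
      rw [hneg] at h1
      exact le_antisymm (h1 ▸ neg_le_abs Q) hle
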